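/- Let $\mathcal F$ be the Fock space of the fermionic fields $b(z)=\sum_{n\in\mathbb Z} b(n)z^{-n}$, $c(z)=\sum_{n\in\mathbb Z} c(n)z^{-n-1}$, with $[b(m),c(n)]_+=\delta_{m,-n}$, $[b(m),b(n)]_+=[c(m),c(n)]_+=0$, and vacuum killed by $b(n+1)$, $c(n)$ for $n\ge 0$. Let $j(z)=\sum_n j(n)z^{-n-1}=\partial\phi(z)$, $[j(m),j(n)]=m\,\delta_{m,-n}$, be a free boson, let $\mathcal H_\alpha$ be its Fock space with highest weight vector $|\alpha\rangle$ ($j(n)|\alpha\rangle=\alpha\delta_{n,0}|\alpha\rangle$ for $n\ge0$), and let $X_{\eta}(z)={:}e^{\eta\phi(z)}{:}$ be the vertex operator, given on $\mathcal H_\alpha$ by $$X_\eta(z)=e^{\eta q}z^{\eta\alpha}\exp\Big(\eta\sum_{n>0}j(-n)\frac{z^n}{n}\Big)\exp\Big(\eta\sum_{n<0}j(-n)\frac{z^n}{n}\Big),$$ where $e^{\eta q}:\mathcal H_\alpha\to\mathcal H_{\alpha+\eta}$ maps $|\alpha\rangle$ to $|\alpha+\eta\rangle$ and commutes with $j(n)$,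 $n\ne0$. On $\mathcal F\otimes\bigoplus_{l\in\mathbb Z}\mathcal H_{il}$ (where $i=\sqrt{-1}$) put $$\beta(z)=\partial b(z)\,X_{-i}(z),\qquad \gamma(z)=c(z)\,X_i(z).$$ Let $\mathcal M_0$ be the Fock space of the $\beta\gamma$ fields $\beta(z)=\sum_n\beta(n)z^{-n}$, $\gamma(z)=\sum_n\gamma(n)z^{-n-1}$ with $[\gamma(m),\beta(n)]=\delta_{m,-n}$, $[\beta(m),\beta(n)]=[\gamma(m),\gamma(n)]=0$ and vacuum killed by $\beta(n+1),\gamma(n)$, $n\ge0$. Normal ordering moves the operators that annihilate the vacuum to the right (with a sign for fermions). 1. For every $m\ge0$ there is a unique polynomial $P_m(j)$ in $j,\partial j,\partial^2j,\dots$ with ${:}P_m(j)\,e^{-i\phi}{:}=\partial^m{:}e^{-i\phi}{:}$, that is, $P_m(j)=\partial^m{:}e^{-i\phi}{:}\,/\,{:}e^{-i\phi}{:}$. 2. For every $n\ge0$, as fields on $\mathcal F\otimes\bigoplus_l\mathcal H_{il}$, $$J^n(w)={:}\gamma(w)\partial^n\beta(w){:}=\sum_{k=1}^n k\binom nk\,{:}\partial^{n-k+1}b(w)\,c(w){:}\,P_{k-1}(j)+C_n\,P_{n+1}(j),\qquad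 C_n=(n+2)\sum_{m=0}^n\binom nm\frac{(-1)^{m+1}}{m+2}.$$ In particular $J^n(w)$ is a normally ordered polynomial (a linear combination of right-nested normally ordered products) in the fields ${:}\partial^kb(w)\partial^lc(w){:}$, $k>0$, $k+l\le n$, and $\partial^kj(w)$, $0\le k\le n$. 3. The field ${:}\gamma(w)\partial^n\beta(w){:}$ on $\mathcal M_0$ is given by the same right-hand side under any linear map $\varepsilon:\mathcal M_0\to\mathcal F\otimes\bigoplus_l\mathcal H_{il}$ that maps the vacuum to $|\mathrm{vac}\rangle_{bc}\otimes|0\rangle$ and intertwines all $\beta(n)$ and $\gamma(n)$. -/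

import Mathlib

open scoped TensorProduct

noncomputable section

namespace FMS

/-! ## Fields

A field `A(z) = ∑ A_k z^k` on a complex vector space `V` is a `VertexOperator ℂ V`, that is, a
linear map from `V` to Laurent series with coefficients in `V`; `HVertexOperator.coeff A k` is the
coefficient of `z ^ k`, an endomorphism of `V`. -/

section Fields

variable {V W : Type*} [AddCommGroup V] [Module ℂ V] [AddCommGroup W] [Module ℂ W]

/-- A family of endomorphisms is bounded below if every vector is killed by all the
members with sufficiently negative index. -/
def Bounded (f : ℤ → Module.End ℂ V) : Prop :=
  ∀ x : V, ∃ m : ℤ, ∀ n < m, f n x = 0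

/-- The field with prescribed coefficients. -/
def mkField (f : ℤ → Module.End ℂ V) (hf : Bounded f) : VertexOperator ℂ V :=
  VertexOperator.of_coeff f (fun x => by
    obtain ⟨m, hm⟩ := hf x
    refine ⟨m, fun n hn => ?_⟩
    by_contra h
    exact hn (hm n (not_le.mp h)))

theorem coeff_mkField (f : ℤ → Module.End ℂ V) (hf : Bounded f) :
    HVertexOperator.coeff (mkField f hf) = f := rfl

theorem bounded_coeff (A : VertexOperator ℂ V) : Bounded (HVertexOperator.coeff A) := fun x =>
  ⟨_, fun n hn => VertexOperator.coeff_eq_zero_of_lt_order A n x hn⟩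

/-- The sum `∑ₖ T k` of a family of endomorphisms of which only finitely many are nonzero on each
given vector. -/
def locSum (T : ℕ → Module.End ℂ V) (hT : ∀ x, (Function.support fun k => T k x).Finite) :
    Module.End ℂ V where
  toFun x := ∑ᶠ k, T k x
  map_add' x y := by
    simp only [map_add]
    exact finsum_add_distrib (hT x) (hT y)
  map_smul' a x := by
    simp only [map_smul, RingHom.id_apply]
    exact (smul_finsum' a (hT x)).symm

theorem locSum_apply (T : ℕ → Module.End ℂ V) (hT) (x : V) :
    locSum T hT x = ∑ᶠ k, T k x := rfl

/-- The identity field. -/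
def idField : VertexOperator ℂ V :=
  mkField (fun n => if n = 0 then LinearMap.id else 0) fun x => ⟨0, fun n hn => by simp [hn.ne]⟩

/-- The derivative `∂A(z) = ∑ (k+1) A_{k+1} z^k`. -/
def deriv (A : VertexOperator ℂ V) : VertexOperator ℂ V :=
  mkField (fun n => ((n : ℂ) + 1) • HVertexOperator.coeff A (n + 1)) fun x => by
    obtain ⟨m, hm⟩ := bounded_coeff A x
    exact ⟨m - 1, fun n hn => by
      rw [LinearMap.smul_apply, hm (n + 1) (by lia), smul_zero]⟩

/-- The iterated derivative `∂^m A(z)`. -/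
def iterD (m : ℕ) (A : VertexOperator ℂ V) : VertexOperator ℂ V := deriv^[m] A

theorem nop_aux₁ (A B : VertexOperator ℂ V) (N : ℤ) (x : V) :
    (Function.support fun k : ℕ =>
      (HVertexOperator.coeff A k * HVertexOperator.coeff B (N - k)) x).Finite := by
  obtain ⟨m, hm⟩ := bounded_coeff B x
  refine (Set.finite_Iic (N - m).toNat).subset fun k hk => ?_
  by_contra h
  simp only [Set.mem_Iic, not_le] at h
  exact hk (by beta_reduce; rw [Module.End.mul_apply, hm (N - k) (by lia), map_zero])

theorem nop_aux₂ (A B : VertexOperator ℂ V) (N : ℤ) (x : V) :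
    (Function.support fun k : ℕ =>
      (HVertexOperator.coeff B (N + k + 1) * HVertexOperator.coeff A (-k - 1)) x).Finite := by
  obtain ⟨m, hm⟩ := bounded_coeff A x
  refine (Set.finite_Iic (-m).toNat).subset fun k hk => ?_
  by_contra h
  simp only [Set.mem_Iic, not_le] at h
  exact hk (by beta_reduce; rw [Module.End.mul_apply, hm (-k - 1) (by lia), map_zero])

theorem nop_aux₃ (A B : VertexOperator ℂ V) (s : ℂ) :
    Bounded fun N => locSum _ (nop_aux₁ A B N) + s • locSum _ (nop_aux₂ A B N) := by
  intro x
  obtain ⟨m, hm⟩ := bounded_coeff B x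
  obtain ⟨m', hm'⟩ := bounded_coeff A x
  choose g hg using fun k : ℕ => bounded_coeff B (HVertexOperator.coeff A (-k - 1) x)
  obtain ⟨M, hM⟩ : ∃ M : ℤ, ∀ k ≤ (-m').toNat, M ≤ g k - k - 1 := by
    obtain ⟨M, hM⟩ := ((Set.finite_Iic (-m').toNat).image fun k : ℕ => g k - k - 1).bddBelow
    exact ⟨M, fun k hk => hM ⟨k, hk, rfl⟩⟩
  refine ⟨min m M, fun N hN => ?_⟩
  have h₁ : ∀ k : ℕ, (HVertexOperator.coeff A k * HVertexOperator.coeff B (N - k)) x = 0 :=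
    fun k => by rw [Module.End.mul_apply, hm (N - k) (by lia), map_zero]
  have h₂ : ∀ k : ℕ,
      (HVertexOperator.coeff B (N + k + 1) * HVertexOperator.coeff A (-k - 1)) x = 0 := fun k => by
    by_cases hk : k ≤ (-m').toNat
    · exact hg k _ (by have := hM k hk; lia)
    · rw [Module.End.mul_apply, hm' (-k - 1) (by lia), map_zero]
  simp only [LinearMap.add_apply, LinearMap.smul_apply, locSum_apply]
  rw [finsum_congr h₁, finsum_congr h₂, finsum_zero, smul_zero, add_zero]

/-- The normally ordered product `:A(z)B(z): = A₋(z) B(z) + s B(z) A₊(z)`, where `A₋(z)` is the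
part of `A(z)` with powers `z^k`, `k ≥ 0` (creation operators) and `A₊(z)` the part with powers
`z^k`, `k < 0` (annihilation operators); `s = -1` if `A` and `B` are both fermionic, and `s = 1`
otherwise. If `A` and `B` commute, then `nop 1 A B` is the ordinary product `A(z)B(z)`. -/
def nop (s : ℂ) (A B : VertexOperator ℂ V) : VertexOperator ℂ V :=
  mkField (fun N => locSum _ (nop_aux₁ A B N) + s • locSum _ (nop_aux₂ A B N)) (nop_aux₃ A B s)

/-- The normally ordered polynomials in the (bosonic) fields of a set `G`: the linear combinations
of the products `:A₁(:A₂(⋯ :A_r 1:)):` with all `A_i ∈ G`. -/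
def noPolys (G : Set (VertexOperator ℂ V)) : Submodule ℂ (VertexOperator ℂ V) :=
  Submodule.span ℂ {F | ∃ L : List (VertexOperator ℂ V),
    (∀ A ∈ L, A ∈ G) ∧ F = L.foldr (nop 1) idField}

/-- For a polynomial `p` in the variables `x_0, x_1, …`, the normally ordered product
`:p(A, ∂A, ∂²A, …) Y:`, where `x_k` stands for `∂^k A`; a monomial is
`:∂^{k₁}A (:∂^{k₂}A (⋯ :∂^{k_r}A Y:)):` with `k₁ ≤ ⋯ ≤ k_r`. -/
def noEval (p : MvPolynomial ℕ ℂ) (A Y : VertexOperator ℂ V) : VertexOperator ℂ V :=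
  ∑ m ∈ p.support, p.coeff m •
    ((Finsupp.toMultiset m).sort.map fun k => iterD k A).foldr (nop 1) Y

/-- A field on `V`, acting on the first factor of `V ⊗ W`. -/
def onLeft (A : VertexOperator ℂ V) : VertexOperator ℂ (V ⊗[ℂ] W) :=
  mkField (fun n => LinearMap.rTensor W (HVertexOperator.coeff A n)) fun x => by
    induction x using TensorProduct.induction_on with
    | zero => exact ⟨0, fun n _ => map_zero _⟩
    | tmul v w =>
      obtain ⟨m, hm⟩ := bounded_coeff A v
      exact ⟨m, fun n hn => by rw [LinearMap.rTensor_tmul, hm n hn, TensorProduct.zero_tmul]⟩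
    | add x y hx hy =>
      obtain ⟨m, hm⟩ := hx
      obtain ⟨m', hm'⟩ := hy
      exact ⟨min m m', fun n hn => by rw [map_add, hm n (by lia), hm' n (by lia), add_zero]⟩

/-- A field on `W`, acting on the second factor of `V ⊗ W`. -/
def onRight (A : VertexOperator ℂ W) : VertexOperator ℂ (V ⊗[ℂ] W) :=
  mkField (fun n => LinearMap.lTensor V (HVertexOperator.coeff A n)) fun x => by
    induction x using TensorProduct.induction_on with
    | zero => exact ⟨0, fun n _ => map_zero _⟩
    | tmul v w =>
      obtain ⟨m, hm⟩ := bounded_coeff A w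
      exact ⟨m, fun n hn => by rw [LinearMap.lTensor_tmul, hm n hn, TensorProduct.tmul_zero]⟩
    | add x y hx hy =>
      obtain ⟨m, hm⟩ := hx
      obtain ⟨m', hm'⟩ := hy
      exact ⟨min m m', fun n hn => by rw [map_add, hm n (by lia), hm' n (by lia), add_zero]⟩

end Fields

/-! ## The `βγ` fields and their Fock space -/

/-- The Fock space `M₀` of the `βγ` fields, the polynomial algebra on the creation operators
`β(-n)` (variable `Sum.inl n`) and `γ(-n-1)` (variable `Sum.inr n`), `n ≥ 0`. The vacuum is `1`. -/
abbrev BGFock : Type := MvPolynomial (ℕ ⊕ ℕ) ℂ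

/-- The operators `β(n)`: `β(-n)` is a multiplication and `β(n+1)` is minus the
derivative with respect to `γ(-n-1)`, `n ≥ 0`. -/
def betaMode (n : ℤ) : Module.End ℂ BGFock :=
  if n ≤ 0 then LinearMap.mulLeft ℂ (MvPolynomial.X (Sum.inl (-n).toNat))
  else -(MvPolynomial.pderiv (Sum.inr (n - 1).toNat)).toLinearMap

/-- The operators `γ(n)`: `γ(-n-1)` is a multiplication and `γ(n)` is the derivative with
respect to `β(-n)`, `n ≥ 0`. -/
def gammaMode (n : ℤ) : Module.End ℂ BGFock :=
  if n < 0 then LinearMap.mulLeft ℂ (MvPolynomial.X (Sum.inr (-n - 1).toNat))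
  else (MvPolynomial.pderiv (Sum.inl n.toNat)).toLinearMap

theorem pderiv_eventually (p : BGFock) :
    ∃ K : ℕ, ∀ n ≥ K, MvPolynomial.pderiv (Sum.inl n) p = 0 ∧
      MvPolynomial.pderiv (Sum.inr n) p = 0 := by
  refine ⟨(p.vars.image (Sum.elim id id)).sup id + 1, fun n hn => ⟨?_, ?_⟩⟩ <;>
  · refine MvPolynomial.pderiv_eq_zero_of_notMem_vars fun h => ?_
    have := Finset.le_sup (f := id) (Finset.mem_image_of_mem (Sum.elim id id) h)
    simp only [id, Sum.elim_inl, Sum.elim_inr] at this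
    lia

/-- `β(z) = ∑ β(n) z^{-n}` on `M₀`. -/
def betaM : VertexOperator ℂ BGFock :=
  mkField (fun k => betaMode (-k)) fun p => by
    obtain ⟨K, hK⟩ := pderiv_eventually p
    refine ⟨-K, fun n hn => ?_⟩
    simp only [betaMode]
    rw [if_neg (by lia)]
    rw [LinearMap.neg_apply, Derivation.coeFn_coe, (hK (-n - 1).toNat (by lia)).2, neg_zero]

/-- `γ(z) = ∑ γ(n) z^{-n-1}` on `M₀`. -/
def gammaM : VertexOperator ℂ BGFock :=
  mkField (fun k => gammaMode (-k - 1)) fun p => by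
    obtain ⟨K, hK⟩ := pderiv_eventually p
    refine ⟨-K, fun n hn => ?_⟩
    simp only [gammaMode]
    rw [if_neg (by lia)]
    exact (hK (-n - 1).toNat (by lia)).1

/-- The field `J^n(z) = :γ(z) ∂^n β(z):` on `M₀`. -/
def JM (n : ℕ) : VertexOperator ℂ BGFock := nop 1 gammaM (iterD n betaM)

/-! ## The `bc` fields and their Fock space -/

/-- The Fock space `F` of the `bc` fields, the exterior algebra on the creation
operators `b(-n)` (basis vector `Sum.inl n`) and `c(-n-1)` (basis vector `Sum.inr n`), `n ≥ 0`.
The vacuum is `1`. -/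
abbrev BCFock : Type := ExteriorAlgebra ℂ ((ℕ ⊕ ℕ) →₀ ℂ)

/-- Exterior multiplication by a basis vector. -/
def wedge (a : ℕ ⊕ ℕ) : Module.End ℂ BCFock :=
  LinearMap.mulLeft ℂ (ExteriorAlgebra.ι ℂ (Finsupp.single a 1))

/-- Contraction with a coordinate function, the odd derivation dual to `wedge a`. -/
def contract (a : ℕ ⊕ ℕ) : Module.End ℂ BCFock :=
  CliffordAlgebra.contractLeft (Finsupp.lapply a)

/-- The operators `b(n)`: `b(-n)` is a wedge product and `b(n+1)` is the contraction
with respect to `c(-n-1)`, `n ≥ 0`. -/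
def bMode (n : ℤ) : Module.End ℂ BCFock :=
  if n ≤ 0 then wedge (Sum.inl (-n).toNat) else contract (Sum.inr (n - 1).toNat)

/-- The operators `c(n)`: `c(-n-1)` is a wedge product and `c(n)` is the contraction
with respect to `b(-n)`, `n ≥ 0`. -/
def cMode (n : ℤ) : Module.End ℂ BCFock :=
  if n < 0 then wedge (Sum.inr (-n - 1).toNat) else contract (Sum.inl n.toNat)

theorem contract_eventually (x : BCFock) :
    ∃ K : ℕ, ∀ n ≥ K, contract (Sum.inl n) x = 0 ∧ contract (Sum.inr n) x = 0 := by
  refine CliffordAlgebra.left_induction _ (P := fun x => ∃ K : ℕ, ∀ n ≥ K,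
    contract (Sum.inl n) x = 0 ∧ contract (Sum.inr n) x = 0) ?_ ?_ ?_ x
  · intro r
    exact ⟨0, fun n _ => ⟨CliffordAlgebra.contractLeft_algebraMap _ _ r,
      CliffordAlgebra.contractLeft_algebraMap _ _ r⟩⟩
  · rintro x y ⟨K, hK⟩ ⟨L, hL⟩
    refine ⟨max K L, fun n hn => ?_⟩
    simp [hK n (by lia), hL n (by lia)]
  · rintro x v ⟨K, hK⟩
    refine ⟨max K ((v.support.image (Sum.elim id id)).sup id + 1), fun n hn => ?_⟩
    have hv : ∀ a : ℕ ⊕ ℕ, Sum.elim id id a = n → v a = 0 := fun a ha => by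
      by_contra h
      have := Finset.le_sup (f := id) (Finset.mem_image_of_mem (Sum.elim id id)
        (Finsupp.mem_support_iff.mpr h))
      rw [ha] at this
      simp only [id] at this
      lia
    have h := hK n (by lia)
    unfold contract at h ⊢
    constructor
    · rw [CliffordAlgebra.contractLeft_ι_mul, h.1, Finsupp.lapply_apply, hv _ rfl]
      simp
    · rw [CliffordAlgebra.contractLeft_ι_mul, h.2, Finsupp.lapply_apply, hv _ rfl]
      simp

/-- `b(z) = ∑ b(n) z^{-n}` on `F`. -/
def bF : VertexOperator ℂ BCFock :=
  mkField (fun k => bMode (-k)) fun p => by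
    obtain ⟨K, hK⟩ := contract_eventually p
    refine ⟨-K, fun n hn => ?_⟩
    simp only [bMode]
    rw [if_neg (by lia)]
    exact (hK (-n - 1).toNat (by lia)).2

/-- `c(z) = ∑ c(n) z^{-n-1}` on `F`. -/
def cF : VertexOperator ℂ BCFock :=
  mkField (fun k => cMode (-k - 1)) fun p => by
    obtain ⟨K, hK⟩ := contract_eventually p
    refine ⟨-K, fun n hn => ?_⟩
    simp only [cMode]
    rw [if_neg (by lia)]
    exact (hK (-n - 1).toNat (by lia)).1

/-! ## The free bosonic field and its vertex operators -/

/-- The Fock space of the oscillators `j(n)`, `n ≠ 0`: the polynomial algebra on the creation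
operators `j(-n-1)` (variable `n`), `n ≥ 0`. -/
abbrev Osc : Type := MvPolynomial ℕ ℂ

/-- The operators `j(n)` for `n ≠ 0`: for `n > 0`, `j(-n)` is a multiplication
and `j(n)` is `n` times the derivative with respect to `j(-n)`. (The value at `n = 0` is
not used.) -/
def osc (n : ℤ) : Module.End ℂ Osc :=
  if n < 0 then LinearMap.mulLeft ℂ (MvPolynomial.X (-n - 1).toNat)
  else (n : ℂ) • (MvPolynomial.pderiv (n - 1).toNat).toLinearMap

/-- The coefficient of `t ^ k` in `exp A(t) = ∑ A(t)^r / r!`, for a power series `A(t)` without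
constant term. -/
def expCoeff {R : Type*} [Ring R] [Algebra ℂ R] (A : PowerSeries R) (k : ℕ) : R :=
  ∑ r ∈ Finset.range (k + 1), ((r.factorial : ℂ)⁻¹) • PowerSeries.coeff k (A ^ r)

/-- The coefficient of `z^k` in `exp (η ∑_{n>0} j(-n) z^n / n)`. -/
def expCreate (η : ℂ) (k : ℤ) : Module.End ℂ Osc :=
  if k < 0 then 0
  else expCoeff (PowerSeries.mk fun n : ℕ => if n = 0 then 0 else (η / n) • osc (-n)) k.toNat

/-- The coefficient of `z^{-k}` in `exp (η ∑_{n<0} j(-n) z^n / n)`. -/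
def expAnnih (η : ℂ) (k : ℕ) : Module.End ℂ Osc :=
  expCoeff (PowerSeries.mk fun n : ℕ => if n = 0 then 0 else (-η / n) • osc n) k

/-- The grading of `Osc` by giving `j(-n)` the degree `n`. -/
def oscWt (n : ℕ) : ℕ := n + 1

theorem osc_hom {p : Osc} {d : ℕ} (hp : p.IsWeightedHomogeneous oscWt d) {n : ℕ} (hn : n ≠ 0) :
    (∀ e, e + n = d → (osc n p).IsWeightedHomogeneous oscWt e) ∧ (d < n → osc n p = 0) := by
  rw [osc, if_neg (by lia)]
  refine ⟨fun e he => ?_, fun hd => ?_⟩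
  · rw [LinearMap.smul_apply]
    refine Submodule.smul_mem (MvPolynomial.weightedHomogeneousSubmodule ℂ oscWt e) _ ?_
    exact hp.pderiv (by simp only [oscWt]; lia)
  · rw [LinearMap.smul_apply]
    have : MvPolynomial.pderiv ((n : ℤ) - 1).toNat p = 0 := by
      refine MvPolynomial.pderiv_eq_zero_of_notMem_vars fun h => ?_
      obtain ⟨s, hs, hi⟩ := MvPolynomial.mem_vars_iff_mem_support _ |>.mp h
      have h1 := hp (MvPolynomial.mem_support_iff.mp hs)
      have h2 := Finsupp.le_weight_of_ne_zero' oscWt (Finsupp.mem_support_iff.mp hi)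
      simp only [oscWt] at h1 h2
      lia
    rw [Derivation.coeFn_coe, this, smul_zero]

theorem coeff_pow_hom (A : PowerSeries (Module.End ℂ Osc))
    (hA : ∀ (i d : ℕ) (p : Osc), p.IsWeightedHomogeneous oscWt d →
      (∀ e, e + i = d → (PowerSeries.coeff i A p).IsWeightedHomogeneous oscWt e) ∧
        (d < i → PowerSeries.coeff i A p = 0)) (r j d : ℕ) (p : Osc)
    (hp : p.IsWeightedHomogeneous oscWt d) :
    (∀ e, e + j = d → (PowerSeries.coeff j (A ^ r) p).IsWeightedHomogeneous oscWt e) ∧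
      (d < j → PowerSeries.coeff j (A ^ r) p = 0) := by
  induction r generalizing j with
  | zero =>
    rw [pow_zero, PowerSeries.coeff_one]
    split_ifs with h
    · subst h
      exact ⟨fun e he => by subst he; exact hp, fun h => absurd h (by lia)⟩
    · exact ⟨fun e _ => MvPolynomial.isWeightedHomogeneous_zero _ _ _, fun _ => rfl⟩
  | succ r ih =>
    rw [pow_succ', PowerSeries.coeff_mul, LinearMap.sum_apply]
    refine ⟨fun e he => ?_, fun hd => Finset.sum_eq_zero fun x hx => ?_⟩
    · refine Submodule.sum_mem (MvPolynomial.weightedHomogeneousSubmodule ℂ oscWt e)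
        fun x hx => ?_
      rw [Finset.HasAntidiagonal.mem_antidiagonal] at hx
      exact (hA x.1 (e + x.1) _ ((ih x.2).1 (e + x.1) (by lia))).1 e rfl
    · rw [Finset.HasAntidiagonal.mem_antidiagonal] at hx
      rw [Module.End.mul_apply]
      by_cases h : d < x.2
      · rw [(ih x.2).2 h, map_zero]
      · exact (hA x.1 (d - x.2) _ ((ih x.2).1 (d - x.2) (by lia))).2 (by lia)

theorem expAnnih_eventually (η : ℂ) (p : Osc) : ∃ K : ℕ, ∀ k ≥ K, expAnnih η k p = 0 := by
  have key : ∀ (d : ℕ) (q : Osc), q.IsWeightedHomogeneous oscWt d →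
      ∀ k > d, expAnnih η k q = 0 := by
    intro d q hq k hk
    rw [expAnnih, expCoeff, LinearMap.sum_apply]
    refine Finset.sum_eq_zero fun r _ => ?_
    rw [LinearMap.smul_apply, (coeff_pow_hom _ ?_ r k d q hq).2 hk, smul_zero]
    intro i d p hp
    rw [PowerSeries.coeff_mk]
    split_ifs with h
    · exact ⟨fun e _ => MvPolynomial.isWeightedHomogeneous_zero _ _ _, fun _ => rfl⟩
    · refine ⟨fun e he => ?_, fun hd => ?_⟩
      · exact Submodule.smul_mem (MvPolynomial.weightedHomogeneousSubmodule ℂ oscWt e) _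
          ((osc_hom hp h).1 e he)
      · rw [LinearMap.smul_apply, (osc_hom hp h).2 hd, smul_zero]
  induction p using MvPolynomial.induction_on' with
  | monomial s a =>
    exact ⟨_ + 1, fun k hk => key _ _
      (MvPolynomial.isWeightedHomogeneous_monomial oscWt s a rfl) k hk⟩
  | add p q hp hq =>
    obtain ⟨K, hK⟩ := hp
    obtain ⟨L, hL⟩ := hq
    exact ⟨max K L, fun k hk => by rw [map_add, hK k (by lia), hL k (by lia), add_zero]⟩

theorem vertexOsc_aux (η : ℂ) (M : ℤ) (p : Osc) :
    (Function.support fun b : ℕ => (expCreate η (M + b) * expAnnih η b) p).Finite := by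
  obtain ⟨K, hK⟩ := expAnnih_eventually η p
  refine (Set.finite_Iio K).subset fun b hb => ?_
  by_contra h
  exact hb (by beta_reduce; rw [Module.End.mul_apply, hK b (by simpa using h), map_zero])

/-- The coefficient of `z^M` in
`exp (η ∑_{n>0} j(-n) z^n / n) exp (η ∑_{n<0} j(-n) z^n / n)`. -/
def vertexOsc (η : ℂ) (M : ℤ) : Module.End ℂ Osc :=
  locSum (fun b : ℕ => expCreate η (M + b) * expAnnih η b) (vertexOsc_aux η M)

theorem bounded_vertexOsc (η : ℂ) : Bounded (vertexOsc η) := fun p => by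
  obtain ⟨K, hK⟩ := expAnnih_eventually η p
  refine ⟨-K, fun n hn => ?_⟩
  rw [vertexOsc, locSum_apply, ← finsum_zero (α := ℕ)]
  refine finsum_congr fun b => ?_
  rw [Module.End.mul_apply]
  by_cases hb : K ≤ b
  · rw [hK b hb, map_zero]
  · rw [expCreate, if_pos (by lia), LinearMap.zero_apply]

/-- The direct sum `⨁_{l ∈ ℤ} H_{il}` of the Fock spaces of the field `j(z)`, where `j(0)` acts
on `H_α` as the scalar `α`. The highest weight vector of `H_{il}` is `Finsupp.single l 1`. -/
abbrev BosonFock : Type := ℤ →₀ Osc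

/-- The operators `j(n)`, with `[j(m), j(n)] = m δ_{m,-n}`. -/
def jMode (n : ℤ) : Module.End ℂ BosonFock :=
  Finsupp.lsum ℂ fun l : ℤ => Finsupp.lsingle l ∘ₗ
    (if n = 0 then (Complex.I * l) • LinearMap.id else osc n)

/-- `j(z) = ∑ j(n) z^{-n-1}` on `⨁ H_{il}`. -/
def jB : VertexOperator ℂ BosonFock :=
  mkField (fun k => jMode (-k - 1)) fun x => by
    induction x using Finsupp.induction_linear with
    | zero => exact ⟨0, fun n _ => map_zero _⟩
    | add x y hx hy =>
      obtain ⟨m, hm⟩ := hx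
      obtain ⟨m', hm'⟩ := hy
      exact ⟨min m m', fun n hn => by rw [map_add, hm n (by lia), hm' n (by lia), add_zero]⟩
    | single l p =>
      have key : ∃ K : ℕ, ∀ n ≥ K, n ≠ 0 → osc n p = 0 := by
        induction p using MvPolynomial.induction_on' with
        | monomial s a =>
          exact ⟨_ + 1, fun n hn h0 => (osc_hom
            (MvPolynomial.isWeightedHomogeneous_monomial oscWt s a rfl) h0).2 hn⟩
        | add p q hp hq =>
          obtain ⟨K, hK⟩ := hp
          obtain ⟨L, hL⟩ := hq
          exact ⟨max K L, fun n hn h0 => by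
            rw [map_add, hK n (by lia) h0, hL n (by lia) h0, add_zero]⟩
      obtain ⟨K, hK⟩ := key
      refine ⟨-K - 1, fun n hn => ?_⟩
      have h := hK (-n - 1).toNat (by lia) (by lia)
      rw [Int.toNat_of_nonneg (by lia)] at h
      simp only [jMode, Finsupp.lsum_single, LinearMap.comp_apply]
      rw [if_neg (by lia), h, map_zero]

/-- The vertex operator `X_η(z) = :exp(ηφ(z)):`, `φ(z) = q + j(0) ln z - ∑_{n≠0} j(n) z^{-n} / n`,
for `η = i e` with `e ∈ ℤ`: on `H_α` it is
`exp(ηq) z^{ηα} exp (η ∑_{n>0} j(-n) z^n / n) exp (η ∑_{n<0} j(-n) z^n / n)`, where `exp(ηq)` maps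
`H_α` to `H_{α+η}`, commutes with `j(n)` for `n ≠ 0`, and preserves highest weight vectors. For
`α = il` one has `α + η = i(l+e)` and `z^{ηα} = z^{-el}`. -/
def vertexB (e : ℤ) : VertexOperator ℂ BosonFock :=
  mkField (fun N => Finsupp.lsum ℂ fun l : ℤ => Finsupp.lsingle (l + e) ∘ₗ
      vertexOsc (Complex.I * e) (N + e * l)) fun x => by
    induction x using Finsupp.induction_linear with
    | zero => exact ⟨0, fun n _ => map_zero _⟩
    | add x y hx hy =>
      obtain ⟨m, hm⟩ := hx
      obtain ⟨m', hm'⟩ := hy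
      exact ⟨min m m', fun n hn => by rw [map_add, hm n (by lia), hm' n (by lia), add_zero]⟩
    | single l p =>
      obtain ⟨m, hm⟩ := bounded_vertexOsc (Complex.I * e) p
      refine ⟨m - e * l, fun n hn => ?_⟩
      simp only [Finsupp.lsum_single, LinearMap.comp_apply]
      rw [hm _ (by lia), map_zero]

/-! ## Bosonization -/

/-- The space `F ⊗ ⨁_{l ∈ ℤ} H_{il}`, on which all fields `b`, `c`, `j`, `X_{±i}` act. It
contains `N(0) = ⨁_{l ∈ ℤ} F^l ⊗ H_{il}`. -/
abbrev Total : Type := BCFock ⊗[ℂ] BosonFock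

/-- `b(z)` -/
def b : VertexOperator ℂ Total := onLeft bF

/-- `c(z)` -/
def c : VertexOperator ℂ Total := onLeft cF

/-- `j(z)` -/
def j : VertexOperator ℂ Total := onRight jB

/-- `X e = :exp(i e φ(z)):` -/
def X (e : ℤ) : VertexOperator ℂ Total := onRight (vertexB e)

/-- The bosonization `β(z) = ∂b(z) X_{-i}(z)`; the two factors commute. -/
def beta : VertexOperator ℂ Total := nop 1 (deriv b) (X (-1))

/-- The bosonization `γ(z) = c(z) X_i(z)`; the two factors commute. -/
def gamma : VertexOperator ℂ Total := nop 1 c (X 1)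

/-- The generator `J^n(z) = :γ(z) ∂^n β(z):` in the bosonization. -/
def J (n : ℕ) : VertexOperator ℂ Total := nop 1 gamma (iterD n beta)

/-- The fermionic bilinear `:∂^k b(z) ∂^l c(z):`. -/
def bc (k l : ℕ) : VertexOperator ℂ Total := nop (-1) (iterD k b) (iterD l c)

/-- The vacuum `|bc⟩ ⊗ |0⟩`. -/
def vac : Total := 1 ⊗ₜ[ℂ] Finsupp.single 0 1

/-- `p` is the quotient `∂^m :e^{-iφ}: / :e^{-iφ}:`, that is, the polynomial in `j, ∂j, …` with
`:p(j, ∂j, …) e^{-iφ}: = ∂^m :e^{-iφ}:`. -/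
def IsExpQuotient (m : ℕ) (p : MvPolynomial ℕ ℂ) : Prop := noEval p j (X (-1)) = iterD m (X (-1))

/-- The field `:p(j, ∂j, …):`. -/
def ofJ (p : MvPolynomial ℕ ℂ) : VertexOperator ℂ Total := noEval p j idField

/-- The homomorphism `M₀ → F ⊗ ⨁ H_{il}` given by the bosonization: it maps vacuum to vacuum and
intertwines the actions of all `β(n)` and `γ(n)`. -/
structure IsBosonization (ε : BGFock →ₗ[ℂ] Total) : Prop where
  map_vac : ε 1 = vac
  map_beta : ∀ k v, ε (HVertexOperator.coeff betaM k v) = HVertexOperator.coeff beta k (ε v)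
  map_gamma : ∀ k v, ε (HVertexOperator.coeff gammaM k v) = HVertexOperator.coeff gamma k (ε v)

/-- `C_n = (n+2) ∑_{m=0}^n (-1)^{m+1} binom(n,m) / (m+2)` -/
def constC (n : ℕ) : ℂ :=
  (n + 2) * ∑ m ∈ Finset.range (n + 1), (-1) ^ (m + 1) * (n.choose m : ℂ) / (m + 2)

/-- The right-hand side
`∑_{k=1}^n k binom(n,k) :∂^{n-k+1} b c: P_{k-1}(j) + C_n P_{n+1}(j)`. -/
def bosonized (P : ℕ → MvPolynomial ℕ ℂ) (n : ℕ) : VertexOperator ℂ Total :=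
  ∑ k ∈ Finset.Icc 1 n, ((k : ℂ) * n.choose k) • nop 1 (bc (n - k + 1) 0) (ofJ (P (k - 1))) +
    constC n • ofJ (P (n + 1))

end FMS

end

/-! The computation is point splitting. Let `x` carry `γ` and `w` carry `β`. The fermions give
`c(x)∂b(w) = :c(x)∂b(w): + (x - w)^{-2}`. The vertex operators give `X_i(x)X_{-i}(w) = (x - w)E(x,
w)`, where `E(x, w) = :e^{iφ(x) - iφ(w)}:` is regular on the diagonal, `E(w, w) = 1` and `∂_w E = -i
:j(w)E:`. Multiplying, `γ(x)β(w) = (x - w) :c(x)∂b(w): E + E/(x - w)`, and the normally ordered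
product removes the pole: `:γ(x)β(w): = (x - w) :c(x)∂b(w): E + (E - 1)/(x - w)`. This is
`nopTerm_gamma_beta`.

Now `J^n` is `∂_w^n` of this, restricted to `x = w`. The basic rule is `∂_w^{n+1}((x - w)f) = -(n +
1) ∂_w^n f` on the diagonal (`diag_dw_pow_succ_mulSub`). Together with the Leibniz rule and `n
binom(n-1,k-1) = k binom(n,k)` it turns the first summand into the fermionic sum; the sign cancels
against `:c ∂b: = -:∂b c:`. Read backwards, with `f = (E - 1)/(x - w)`, it turns the second summand
into `-∂_w^{n+1}E/(n + 1)`, and `C_n = -1/(n + 1)` is a Beta integral (`constC_eq`).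

That `∂_w^m E` restricts to `:P_m(j):` follows from `∂_w E = -i :j(w)E:`. The field `e^{-iφ}`
satisfies the same first order equation, so one recursion `P_{m+1} = DP_m - i x_0 P_m`, where `D x_k
= x_{k+1}`, serves both (`iterD_eq_noEval`). On the diagonal `E` becomes the identity field.

All of this is done with coefficients of formal series applied to a fixed vector. `E` is defined as
the quotient of `X_i(x)X_{-i}(w)` by `x - w`. Its properties are proved on highest weight vectors,
where it is an explicit product of Schur-type polynomials `expPoly`, and carried to the whole Fock
space by commutators with the `j(n)`. Uniqueness of `P_m` follows on applying the fields to the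
highest weight vector of `H_0`, which recovers the polynomial. The statement on `M_0` holds since a
map that intertwines modes intertwines normally ordered products. -/

noncomputable section

namespace FMS

open HVertexOperator (coeff)

/-! ### Calculus of formal series in two variables `x`, `w` and their restriction to the diagonal.
-/

section Series

variable {V : Type*} [AddCommGroup V]

/-- The two halves of `ℤ` are indexed as in `nop`: exponents `k ≥ 0` for creation operators, `-k -
1` for annihilation operators. -/
theorem finsum_int {f : ℤ → V} (hf : (Function.support f).Finite) :
    ∑ᶠ k, f k = ∑ᶠ k : ℕ, f k + ∑ᶠ k : ℕ, f (-k - 1) := by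
  have h1 : (Set.range (fun k : ℕ => (k : ℤ))) ∪ Set.range (fun k : ℕ => -(k : ℤ) - 1) =
      Set.univ := by
    ext k
    simp only [Set.mem_union, Set.mem_range, Set.mem_univ, iff_true]
    rcases le_or_gt 0 k with h | h
    · exact Or.inl ⟨k.toNat, by lia⟩
    · exact Or.inr ⟨(-k - 1).toNat, by lia⟩
  have h2 : Disjoint (Set.range (fun k : ℕ => (k : ℤ))) (Set.range (fun k : ℕ => -(k : ℤ) - 1)) := by
    rw [Set.disjoint_left]
    rintro _ ⟨a, rfl⟩ ⟨b, hb⟩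
    simp only at hb
    lia
  rw [← finsum_mem_univ, ← h1, finsum_mem_union' h2 (hf.subset Set.inter_subset_right)
    (hf.subset Set.inter_subset_right), finsum_mem_range fun a b h => by simpa using h,
    finsum_mem_range fun a b h => by simpa using h]

theorem finsum_comm_of_finite {α β : Type*} {f : α → β → V}
    (hf : (Function.support fun x : α × β => f x.1 x.2).Finite) :
    ∑ᶠ a, ∑ᶠ b, f a b = ∑ᶠ b, ∑ᶠ a, f a b := by
  rw [← finsum_curry (fun x : α × β => f x.1 x.2) hf, ← finsum_comp_equiv (Equiv.prodComm β α),
    finsum_curry]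
  · rfl
  · exact (hf.preimage (Equiv.prodComm β α).injective.injOn)

/-- Series `∑ f p q x^p w^q` whose exponents are bounded below. -/
def BddBelow₂ (f : ℤ → ℤ → V) : Prop := ∃ M : ℤ, ∀ p q, (p < M ∨ q < M) → f p q = 0

/-- The restriction `f(w, w)` of a series `f(x, w)` to the diagonal. -/
def diag (f : ℤ → ℤ → V) (N : ℤ) : V := ∑ᶠ p, f p (N - p)

theorem BddBelow₂.finite_support {f : ℤ → ℤ → V} (hf : BddBelow₂ f) (N : ℤ) :
    (Function.support fun p => f p (N - p)).Finite := by
  obtain ⟨M, hM⟩ := hf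
  refine (Set.finite_Icc M (N - M)).subset fun p hp => ?_
  by_contra h
  exact hp (hM _ _ (by simp only [Set.mem_Icc, not_and_or] at h; lia))

theorem BddBelow₂.add {f g : ℤ → ℤ → V} (hf : BddBelow₂ f) (hg : BddBelow₂ g) :
    BddBelow₂ (f + g) := by
  obtain ⟨M, hM⟩ := hf
  obtain ⟨L, hL⟩ := hg
  exact ⟨min M L, fun p q h => by
    rw [Pi.add_apply, Pi.add_apply, hM _ _ (by lia), hL _ _ (by lia), add_zero]⟩

theorem diag_shift (f : ℤ → ℤ → V) (N : ℤ) (d : ℤ) :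
    ∑ᶠ p, f (p + d) (N - p) = diag f (N + d) := by
  rw [diag, ← finsum_comp_equiv (Equiv.addRight d) (f := fun p => f p (N + d - p))]
  exact finsum_congr fun p => by simp

theorem diag_add {f g : ℤ → ℤ → V} (hf : BddBelow₂ f) (hg : BddBelow₂ g) :
    diag (f + g) = diag f + diag g :=
  funext fun N => finsum_add_distrib (hf.finite_support N) (hg.finite_support N)

theorem diag_sum {ι : Type*} (s : Finset ι) (f : ι → ℤ → ℤ → V) (hf : ∀ i ∈ s, BddBelow₂ (f i)) :
    BddBelow₂ (∑ i ∈ s, f i) ∧ diag (∑ i ∈ s, f i) = ∑ i ∈ s, diag (f i) := by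
  classical
  induction s using Finset.induction_on with
  | empty => exact ⟨⟨0, fun _ _ _ => rfl⟩, funext fun N => finsum_zero⟩
  | insert a s ha ih =>
    obtain ⟨h1, h2⟩ := ih fun i hi => hf i (Finset.mem_insert_of_mem hi)
    have h3 := hf a (Finset.mem_insert_self a s)
    rw [Finset.sum_insert ha, Finset.sum_insert ha]
    exact ⟨h3.add h1, by rw [diag_add h3 h1, h2]⟩

variable [Module ℂ V]

/-- The partial derivative with respect to `x`. -/
def dx : Module.End ℂ (ℤ → ℤ → V) where
  toFun f p q := ((p : ℂ) + 1) • f (p + 1) q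
  map_add' f g := by ext p q; exact smul_add _ _ _
  map_smul' a f := by ext p q; exact smul_comm _ _ _

/-- The partial derivative with respect to `w`. -/
def dw : Module.End ℂ (ℤ → ℤ → V) where
  toFun f p q := ((q : ℂ) + 1) • f p (q + 1)
  map_add' f g := by ext p q; exact smul_add _ _ _
  map_smul' a f := by ext p q; exact smul_comm _ _ _

/-- Multiplication by `x - w`. -/
def mulSub : Module.End ℂ (ℤ → ℤ → V) where
  toFun f p q := f (p - 1) q - f p (q - 1)
  map_add' f g := by ext p q; simp only [Pi.add_apply]; abel
  map_smul' a f := by ext p q; simp [smul_sub]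

theorem dx_apply (f : ℤ → ℤ → V) (p q : ℤ) : dx f p q = ((p : ℂ) + 1) • f (p + 1) q := rfl

theorem dw_apply (f : ℤ → ℤ → V) (p q : ℤ) : dw f p q = ((q : ℂ) + 1) • f p (q + 1) := rfl

theorem mulSub_apply (f : ℤ → ℤ → V) (p q : ℤ) : mulSub f p q = f (p - 1) q - f p (q - 1) := rfl

theorem BddBelow₂.dw {f : ℤ → ℤ → V} (hf : BddBelow₂ f) : BddBelow₂ (dw f) := by
  obtain ⟨M, hM⟩ := hf
  exact ⟨M - 1, fun p q h => by rw [dw_apply, hM _ _ (by lia), smul_zero]⟩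

theorem BddBelow₂.dw_pow {f : ℤ → ℤ → V} (hf : BddBelow₂ f) (n : ℕ) :
    BddBelow₂ ((FMS.dw ^ n) f) := by
  induction n with
  | zero => exact hf
  | succ n ih => rw [pow_succ', Module.End.mul_apply]; exact ih.dw

theorem BddBelow₂.mulSub {f : ℤ → ℤ → V} (hf : BddBelow₂ f) : BddBelow₂ (mulSub f) := by
  obtain ⟨M, hM⟩ := hf
  exact ⟨M, fun p q h => by
    rw [mulSub_apply, hM _ _ (by lia), hM _ _ (by lia), sub_zero]⟩

theorem BddBelow₂.smul {f : ℤ → ℤ → V} (hf : BddBelow₂ f) (a : ℂ) : BddBelow₂ (a • f) := by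
  obtain ⟨M, hM⟩ := hf
  exact ⟨M, fun p q h => by rw [Pi.smul_apply, Pi.smul_apply, hM _ _ h, smul_zero]⟩

theorem diag_smul {f : ℤ → ℤ → V} (hf : BddBelow₂ f) (a : ℂ) : diag (a • f) = a • diag f :=
  funext fun N => (smul_finsum' a (hf.finite_support N)).symm

theorem diag_sub {f g : ℤ → ℤ → V} (hf : BddBelow₂ f) (hg : BddBelow₂ g) :
    diag (f - g) = diag f - diag g := by
  rw [sub_eq_add_neg, ← neg_one_smul ℂ g, diag_add hf (hg.smul _), diag_smul hg, neg_one_smul,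
    sub_eq_add_neg]

theorem diag_mulSub {f : ℤ → ℤ → V} (hf : BddBelow₂ f) : diag (mulSub f) = 0 := by
  funext N
  have h1 : ∑ᶠ p, f (p - 1) (N - p) = diag f (N - 1) := diag_shift f N (-1)
  have h2 : ∑ᶠ p, f p (N - p - 1) = diag f (N - 1) := by
    exact finsum_congr fun p => by rw [sub_right_comm]
  have h3 : (Function.support fun p => f (p - 1) (N - p)).Finite := by
    obtain ⟨M, hM⟩ := hf
    refine BddBelow₂.finite_support (f := fun p q => f (p - 1) q) ⟨M, fun p q h => ?_⟩ N
    exact hM _ _ (by lia)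
  have h4 : (Function.support fun p => f p (N - p - 1)).Finite := by
    obtain ⟨M, hM⟩ := hf
    refine BddBelow₂.finite_support (f := fun p q => f p (q - 1)) ⟨M, fun p q h => ?_⟩ N
    exact hM _ _ (by lia)
  simp only [diag, mulSub_apply]
  rw [finsum_sub_distrib h3 h4, h1, h2, sub_self, Pi.zero_apply]

/-- The chain rule for `d/dw f(w, w)`: on coefficients, `N + 1 = p + (N + 1 - p)`. -/
theorem diag_succ {f : ℤ → ℤ → V} (hf : BddBelow₂ f) (N : ℤ) :
    ((N : ℂ) + 1) • diag f (N + 1) = diag (dx f) N + diag (dw f) N := by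
  let g : ℤ → ℤ → V := fun p q => (p : ℂ) • f p q
  let h : ℤ → ℤ → V := fun p q => (q : ℂ) • f p q
  have hg : BddBelow₂ g := hf.imp fun M hM p q hpq => by simp only [g, hM p q hpq, smul_zero]
  have hh : BddBelow₂ h := hf.imp fun M hM p q hpq => by simp only [h, hM p q hpq, smul_zero]
  have h1 : diag (dx f) N = diag g (N + 1) := by
    rw [← diag_shift]
    exact finsum_congr fun p => by simp [g, dx_apply]
  have h2 : diag (dw f) N = diag h (N + 1) := by
    exact finsum_congr fun p => by
      simp only [h, dw_apply]
      rw [show N + 1 - p = N - p + 1 by ring]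
      push_cast
      rfl
  rw [h1, h2, ← Pi.add_apply, ← diag_add hg hh, diag, diag, smul_finsum' _ (hf.finite_support _)]
  refine finsum_congr fun p => ?_
  simp only [g, h, Pi.add_apply, ← add_smul]
  congr 1
  push_cast
  ring

/-- Leibniz rule: `∂_w(x - w) = -1` and the higher derivatives of `x - w` vanish. -/
theorem dw_pow_succ_mulSub (n : ℕ) (f : ℤ → ℤ → V) :
    (dw ^ (n + 1)) (mulSub f) = mulSub ((dw ^ (n + 1)) f) - ((n : ℂ) + 1) • (dw ^ n) f := by
  have key : ∀ g : ℤ → ℤ → V, dw (mulSub g) = mulSub (dw g) - g := fun g => by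
    ext p q
    simp only [dw_apply, mulSub_apply, Pi.sub_apply]
    rw [sub_add_cancel, add_sub_cancel_right]
    push_cast
    module
  induction n with
  | zero => simp [key]
  | succ n ih =>
    have e : ∀ (m : ℕ) (g : ℤ → ℤ → V), (dw ^ (m + 1)) g = dw ((dw ^ m) g) := fun m g => by
      rw [pow_succ', Module.End.mul_apply]
    rw [e (n + 1), ih, map_sub, key, map_smul, ← e, ← e]
    push_cast
    module

/-- A factor `x - w` that is not differentiated dies on the diagonal. The rule evaluates the
fermionic summand of `J^n` and, read from right to left, the one with the pole removed. -/
theorem diag_dw_pow_succ_mulSub (n : ℕ) {f : ℤ → ℤ → V} (hf : BddBelow₂ f) :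
    diag ((dw ^ (n + 1)) (mulSub f)) = -((n : ℂ) + 1) • diag ((dw ^ n) f) := by
  rw [dw_pow_succ_mulSub, diag_sub (hf.dw_pow _).mulSub ((hf.dw_pow _).smul _),
    diag_mulSub (hf.dw_pow _), diag_smul (hf.dw_pow _)]
  module

/-- A series in which the exponents of `w` are bounded below is determined by its product
with `x - w`. -/
theorem eq_zero_of_mulSub_eq_zero {f : ℤ → ℤ → V} (M : ℤ) (hM : ∀ p q, q < M → f p q = 0)
    (hf : mulSub f = 0) : f = 0 := by
  have h1 : ∀ p q, f p q = f (p + 1) (q - 1) := fun p q => by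
    have := congr_fun (congr_fun hf (p + 1)) q
    rw [mulSub_apply, add_sub_cancel_right] at this
    exact sub_eq_zero.mp this
  have h2 : ∀ (k : ℕ) p q, f p q = f (p + k) (q - k) := fun k => by
    induction k with
    | zero => simp
    | succ k ih =>
      intro p q
      rw [ih, h1]
      push_cast
      congr 1 <;> ring
  funext p q
  -- Moving along the antidiagonal until the exponent of `w` drops below `M`.
  rw [h2 (q - M + 1).toNat]
  exact hM _ _ (by lia)

end Series

/-! ### Normally ordered products as diagonals; derivatives and commutation. -/

section Fields

variable {V : Type*} [AddCommGroup V] [Module ℂ V]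

theorem field_ext {A B : VertexOperator ℂ V} (h : ∀ n v, coeff A n v = coeff B n v) : A = B :=
  HVertexOperator.coeff_inj (funext fun n => LinearMap.ext (h n))

theorem coeff_deriv (A : VertexOperator ℂ V) (n : ℤ) (v : V) :
    coeff (deriv A) n v = ((n : ℂ) + 1) • coeff A (n + 1) v := rfl

theorem iterD_zero (A : VertexOperator ℂ V) : iterD 0 A = A := rfl

theorem iterD_succ (n : ℕ) (A : VertexOperator ℂ V) : iterD (n + 1) A = deriv (iterD n A) :=
  Function.iterate_succ_apply' _ _ _

theorem iterD_succ' (n : ℕ) (A : VertexOperator ℂ V) : iterD (n + 1) A = iterD n (deriv A) :=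
  Function.iterate_succ_apply _ _ _

theorem coeff_idField (n : ℤ) (v : V) : coeff idField n v = if n = 0 then v else 0 := by
  change (if n = 0 then LinearMap.id else 0 : Module.End ℂ V) v = _
  split_ifs <;> rfl

/-- The derivative as a linear operator on fields. -/
def derivHom : Module.End ℂ (VertexOperator ℂ V) where
  toFun := deriv
  map_add' A B := field_ext fun n v => by
    simp only [coeff_deriv, map_add, Pi.add_apply, LinearMap.add_apply, smul_add]
  map_smul' a A := field_ext fun n v => by
    simp only [coeff_deriv, map_smul, Pi.smul_apply, LinearMap.smul_apply, RingHom.id_apply,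
      smul_comm a]

theorem iterD_eq_pow (n : ℕ) (A : VertexOperator ℂ V) : iterD n A = (derivHom ^ n) A := by
  rw [Module.End.coe_pow]
  rfl

/-- The normally ordered product `:A(x)B(w):` of fields with different arguments, applied
to a vector. -/
def nopTerm (s : ℂ) (A B : VertexOperator ℂ V) (v : V) (p q : ℤ) : V :=
  if 0 ≤ p then coeff A p (coeff B q v) else s • coeff B q (coeff A p v)

theorem bddBelow₂_nopTerm (s : ℂ) (A B : VertexOperator ℂ V) (v : V) :
    BddBelow₂ (nopTerm s A B v) := by
  obtain ⟨m, hm⟩ := bounded_coeff B v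
  obtain ⟨m', hm'⟩ := bounded_coeff A v
  choose g hg using fun p : ℤ => bounded_coeff B (coeff A p v)
  obtain ⟨M, hM⟩ := ((Set.finite_Ico m' 0).image g).bddBelow
  refine ⟨min (min m m') (min M 0), fun p q h => ?_⟩
  unfold nopTerm
  split_ifs with hp
  · rw [hm q (by lia), map_zero]
  · by_cases hp' : p < m'
    · rw [hm' p hp', map_zero, smul_zero]
    · have := hM ⟨p, ⟨by lia, by lia⟩, rfl⟩
      rw [hg p q (by lia), smul_zero]

/-- This translates normally ordered products into the series calculus: `:A(w)B(w):` is `:A(x)B(w):`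
on the diagonal. -/
theorem coeff_nop (s : ℂ) (A B : VertexOperator ℂ V) (N : ℤ) (v : V) :
    coeff (nop s A B) N v = diag (nopTerm s A B v) N := by
  rw [diag, finsum_int ((bddBelow₂_nopTerm s A B v).finite_support N), nop, coeff_mkField]
  rw [LinearMap.add_apply, LinearMap.smul_apply, locSum_apply, locSum_apply,
    smul_finsum' _ (nop_aux₂ A B N v)]
  refine congrArg₂ _ (finsum_congr fun k => ?_) (finsum_congr fun k => ?_)
  · rw [nopTerm, if_pos (by lia)]
    rfl
  · rw [nopTerm, if_neg (by lia), show N - (-(k : ℤ) - 1) = N + k + 1 by ring]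
    rfl

/-- Differentiation respects the splitting into creation and annihilation parts: only for `p = -1`
do `p` and `p + 1` lie on different sides, and there the factor `p + 1` is zero. -/
theorem nopTerm_deriv_left (s : ℂ) (A B : VertexOperator ℂ V) (v : V) :
    nopTerm s (deriv A) B v = dx (nopTerm s A B v) := by
  ext p q
  rw [dx_apply, nopTerm, nopTerm, coeff_deriv, coeff_deriv]
  rcases lt_trichotomy p (-1) with h | rfl | h
  · rw [if_neg (by lia), if_neg (by lia), map_smul, smul_comm]
  · simp
  · rw [if_pos (by lia), if_pos (by lia)]

theorem nopTerm_deriv_right (s : ℂ) (A B : VertexOperator ℂ V) (v : V) :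
    nopTerm s A (deriv B) v = dw (nopTerm s A B v) := by
  ext p q
  rw [dw_apply, nopTerm, nopTerm, coeff_deriv, coeff_deriv]
  split_ifs
  · rw [map_smul]
  · rw [smul_comm]

theorem nopTerm_iterD_right (s : ℂ) (A B : VertexOperator ℂ V) (n : ℕ) (v : V) :
    nopTerm s A (iterD n B) v = (dw ^ n) (nopTerm s A B v) := by
  induction n with
  | zero => rfl
  | succ n ih => rw [iterD_succ, nopTerm_deriv_right, ih, pow_succ', Module.End.mul_apply]

theorem deriv_nop (s : ℂ) (A B : VertexOperator ℂ V) :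
    deriv (nop s A B) = nop s (deriv A) B + nop s A (deriv B) := by
  refine field_ext fun N v => ?_
  rw [coeff_deriv, coeff_nop, diag_succ (bddBelow₂_nopTerm s A B v), map_add, Pi.add_apply,
    LinearMap.add_apply, coeff_nop, coeff_nop, nopTerm_deriv_left, nopTerm_deriv_right]

/-- The operator `:A ·:` on fields. -/
def nopHom (A : VertexOperator ℂ V) : Module.End ℂ (VertexOperator ℂ V) where
  toFun := nop 1 A
  map_add' B C := field_ext fun n v => by
    rw [map_add, Pi.add_apply, LinearMap.add_apply, coeff_nop, coeff_nop, coeff_nop,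
      ← Pi.add_apply, ← diag_add (bddBelow₂_nopTerm _ _ _ _) (bddBelow₂_nopTerm _ _ _ _)]
    congr 1
    ext p q
    simp only [nopTerm, map_add, Pi.add_apply, LinearMap.add_apply]
    split_ifs <;> simp
  map_smul' a B := field_ext fun n v => by
    rw [RingHom.id_apply, map_smul, Pi.smul_apply, LinearMap.smul_apply, coeff_nop, coeff_nop,
      ← Pi.smul_apply, ← diag_smul (bddBelow₂_nopTerm _ _ _ _)]
    congr 1
    ext p q
    simp only [nopTerm, map_smul, Pi.smul_apply, LinearMap.smul_apply]
    split_ifs <;> simp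

theorem nopHom_apply (A B : VertexOperator ℂ V) : nopHom A B = nop 1 A B := rfl

theorem deriv_nopHom (A : VertexOperator ℂ V) :
    derivHom * nopHom A = nopHom (deriv A) + nopHom A * derivHom :=
  LinearMap.ext fun B => deriv_nop 1 A B

/-- The creation parts of `A` and `B` commute, and so do their annihilation parts. -/
def PartsCommute (A B : VertexOperator ℂ V) : Prop :=
  ∀ p q : ℤ, (0 ≤ p ↔ 0 ≤ q) → ∀ v, coeff A p (coeff B q v) = coeff B q (coeff A p v)

theorem PartsCommute.symm {A B : VertexOperator ℂ V} (h : PartsCommute A B) : PartsCommute B A :=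
  fun p q hpq v => (h q p hpq.symm v).symm

theorem PartsCommute.deriv_right {A B : VertexOperator ℂ V} (h : PartsCommute A B) :
    PartsCommute A (deriv B) := fun p q hpq v => by
  rw [coeff_deriv, coeff_deriv, map_smul]
  by_cases hq : q = -1
  · subst hq; simp
  · rw [h p (q + 1) (by lia)]

theorem PartsCommute.iterD_right {A B : VertexOperator ℂ V} (h : PartsCommute A B) (n : ℕ) :
    PartsCommute A (iterD n B) := by
  induction n with
  | zero => exact h
  | succ n ih => rw [iterD_succ]; exact ih.deriv_right

/-- The terms of `:A(:BY:):`. -/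
def nopTerm₂ (A B Y : VertexOperator ℂ V) (N : ℤ) (v : V) (p q : ℤ) : V :=
  if 0 ≤ p then
    if 0 ≤ q then coeff A p (coeff B q (coeff Y (N - p - q) v))
    else coeff A p (coeff Y (N - p - q) (coeff B q v))
  else
    if 0 ≤ q then coeff B q (coeff Y (N - p - q) (coeff A p v))
    else coeff Y (N - p - q) (coeff B q (coeff A p v))

theorem finite_nopTerm₂ (A B Y : VertexOperator ℂ V) (h : PartsCommute A B) (N : ℤ) (v : V) :
    (Function.support fun x : ℤ × ℤ => nopTerm₂ A B Y N v x.1 x.2).Finite := by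
  obtain ⟨a, ha⟩ := bounded_coeff A v
  obtain ⟨b, hb⟩ := bounded_coeff B v
  obtain ⟨y, hy⟩ := bounded_coeff Y v
  choose ya hya using fun p : ℤ => bounded_coeff Y (coeff A p v)
  choose yb hyb using fun p : ℤ => bounded_coeff Y (coeff B p v)
  have h1 : ∀ S : Set ℤ, S.Finite → ∀ g : ℤ → ℤ, ∃ M, ∀ p ∈ S, M ≤ g p := fun S hS g => by
    obtain ⟨M, hM⟩ := (hS.image g).bddBelow
    exact ⟨M, fun p hp => hM ⟨p, hp, rfl⟩⟩
  obtain ⟨M, hM⟩ := h1 _ (Set.finite_Ico a 0) fun p => ya p + p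
  obtain ⟨L, hL⟩ := h1 _ (Set.finite_Ico b 0) fun p => yb p + p
  refine ((Set.finite_Icc (min a 0) (max (max (N - y) (N - L)) 0)).prod
    (Set.finite_Icc (min b 0) (max (max (N - y) (N - M)) 0))).subset fun x hx => ?_
  obtain ⟨p, q⟩ := x
  by_contra hc
  simp only [Set.mem_prod, Set.mem_Icc, not_and_or, not_le] at hc
  refine hx ?_
  simp only [nopTerm₂]
  split_ifs with hp hq hq
  · rw [hy _ (by lia), map_zero, map_zero]
  · by_cases hq' : q < b
    · rw [hb q hq', map_zero, map_zero]
    · rw [hyb q _ (by have := hL q ⟨by lia, by lia⟩; lia), map_zero]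
  · by_cases hp' : p < a
    · rw [ha p hp', map_zero, map_zero]
    · rw [hya p _ (by have := hM p ⟨by lia, by lia⟩; lia), map_zero]
  · by_cases hp' : p < a
    · rw [ha p hp', map_zero, map_zero]
    · by_cases hq' : q < b
      -- With both exponents negative, `B` acts after `A`; commuting the annihilation parts lets `B`
      -- act on `v` first.
      · rw [← h p q (by lia), hb q hq', map_zero, map_zero]
      · lia

theorem coeff_nop_nop (A B Y : VertexOperator ℂ V) (N : ℤ) (v : V) :
    coeff (nop 1 A (nop 1 B Y)) N v = ∑ᶠ p, ∑ᶠ q, nopTerm₂ A B Y N v p q := by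
  rw [coeff_nop]
  refine finsum_congr fun p => ?_
  rw [nopTerm]
  split_ifs with hp
  · rw [coeff_nop, diag, map_finsum _ ((bddBelow₂_nopTerm 1 B Y v).finite_support _)]
    refine finsum_congr fun q => ?_
    simp only [nopTerm, nopTerm₂, if_pos hp, one_smul]
    split_ifs <;> rfl
  · rw [coeff_nop, diag, one_smul]
    refine finsum_congr fun q => ?_
    simp only [nopTerm, nopTerm₂, if_neg hp, one_smul]

/-- Nested products put all creation parts to the left of `Y` and all annihilation parts to the
right, so only the order within each group can matter. -/
theorem nop_left_comm {A B : VertexOperator ℂ V} (h : PartsCommute A B) (Y : VertexOperator ℂ V) :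
    nop 1 A (nop 1 B Y) = nop 1 B (nop 1 A Y) := by
  refine field_ext fun N v => ?_
  rw [coeff_nop_nop, coeff_nop_nop, finsum_comm_of_finite (finite_nopTerm₂ A B Y h N v)]
  refine finsum_congr fun q => finsum_congr fun p => ?_
  simp only [nopTerm₂]
  rw [sub_right_comm N q p]
  split_ifs with hp hq hq
  · rw [h p q (by lia)]
  · rfl
  · rfl
  · rw [h p q (by lia)]

theorem commute_nopHom {A B : VertexOperator ℂ V} (h : PartsCommute A B) :
    Commute (nopHom A) (nopHom B) :=
  LinearMap.ext fun Y => nop_left_comm h Y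

end Fields

/-! ### Polynomials in commuting operators and the recursion for `P_m`. -/

section Polynomials

variable {M : Type*} [AddCommGroup M] [Module ℂ M]

/-- The value of a polynomial at operators `L 0, L 1, …`; a monomial is evaluated with
increasing indices. -/
def opEval (L : ℕ → Module.End ℂ M) : MvPolynomial ℕ ℂ →ₗ[ℂ] Module.End ℂ M :=
  (MvPolynomial.basisMonomials ℕ ℂ).constr ℂ fun m => ((Finsupp.toMultiset m).sort.map L).prod

variable (L : ℕ → Module.End ℂ M)

theorem opEval_monomial (m : ℕ →₀ ℕ) (a : ℂ) :
    opEval L (MvPolynomial.monomial m a) = a • ((Finsupp.toMultiset m).sort.map L).prod := by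
  have h : MvPolynomial.monomial m a = a • MvPolynomial.basisMonomials ℕ ℂ m := by
    rw [MvPolynomial.coe_basisMonomials, MvPolynomial.smul_monomial, smul_eq_mul, mul_one]
  rw [h, map_smul, opEval, Module.Basis.constr_basis]

theorem opEval_apply (p : MvPolynomial ℕ ℂ) :
    opEval L p = ∑ m ∈ p.support, p.coeff m • ((Finsupp.toMultiset m).sort.map L).prod := by
  conv_lhs => rw [← MvPolynomial.support_sum_monomial_coeff p]
  simp only [map_sum, opEval_monomial]

theorem opEval_C (a : ℂ) : opEval L (MvPolynomial.C a) = a • 1 := by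
  rw [← MvPolynomial.monomial_zero', opEval_monomial]
  simp

theorem opEval_one : opEval L 1 = 1 := by
  rw [← MvPolynomial.C_1, opEval_C, one_smul]

/-- For commuting operators the sorting of indices in a monomial is immaterial. -/
theorem opEval_X_mul (hL : ∀ k l, Commute (L k) (L l)) (k : ℕ) (p : MvPolynomial ℕ ℂ) :
    opEval L (MvPolynomial.X k * p) = L k * opEval L p := by
  induction p using MvPolynomial.induction_on' with
  | monomial m a =>
    rw [MvPolynomial.X, MvPolynomial.monomial_mul, one_mul, opEval_monomial, opEval_monomial,
      mul_smul_comm, ← List.prod_cons, ← List.map_cons]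
    congr 1
    refine List.Perm.prod_eq' (List.Perm.map _ ?_) ?_
    · rw [← Multiset.coe_eq_coe, Multiset.sort_eq, ← Multiset.cons_coe, Multiset.sort_eq]
      simp
    · exact List.pairwise_map.mpr (List.pairwise_of_forall fun _ _ => hL _ _)
  | add p q hp hq => rw [mul_add, map_add, hp, hq, map_add, mul_add]

/-- The derivation `x_k ↦ x_{k+1}`. -/
def shiftD : Derivation ℂ (MvPolynomial ℕ ℂ) (MvPolynomial ℕ ℂ) :=
  MvPolynomial.mkDerivation ℂ fun k => MvPolynomial.X (k + 1)

theorem mul_opEval (hL : ∀ k l, Commute (L k) (L l)) (d : Module.End ℂ M)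
    (hd : ∀ k, d * L k = L (k + 1) + L k * d) (p : MvPolynomial ℕ ℂ) :
    d * opEval L p = opEval L (shiftD p) + opEval L p * d := by
  induction p using MvPolynomial.induction_on with
  | C a =>
    rw [opEval_C, MvPolynomial.derivation_C, map_zero, zero_add]
    simp
  | add p q hp hq => simp only [map_add, mul_add, add_mul, hp, hq]; abel
  | mul_X p n hp =>
    have h : shiftD (MvPolynomial.X n * p) =
        MvPolynomial.X n * shiftD p + MvPolynomial.X (n + 1) * p := by
      rw [Derivation.leibniz, shiftD, MvPolynomial.mkDerivation_X, smul_eq_mul, smul_eq_mul,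
        mul_comm p]
    rw [mul_comm p, h, map_add, opEval_X_mul L hL, opEval_X_mul L hL, opEval_X_mul L hL,
      ← mul_assoc, hd, add_mul, mul_assoc, hp, mul_add]
    noncomm_ring

/-- The polynomials `∂^m e^{-iφ} / e^{-iφ}` in the derivatives of `j = ∂φ`. -/
def expQuot : ℕ → MvPolynomial ℕ ℂ
  | 0 => 1
  | m + 1 => shiftD (expQuot m) - Complex.I • (MvPolynomial.X 0 * expQuot m)

/-- Abstract form of `∂^m e^{-iφ} = P_m e^{-iφ}`. It uses only the first order equation for `y`, so
that it applies to `X_{-i}` and to the coefficients of `E(x, w)` alike. -/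
theorem pow_apply_eq_opEval (hL : ∀ k l, Commute (L k) (L l)) (d : Module.End ℂ M)
    (hd : ∀ k, d * L k = L (k + 1) + L k * d) (y : M) (hy : d y = -Complex.I • L 0 y) (m : ℕ) :
    (d ^ m) y = opEval L (expQuot m) y := by
  have hcomm : ∀ p, opEval L p * L 0 = L 0 * opEval L p := fun p => by
    induction p using MvPolynomial.induction_on with
    | C a => rw [opEval_C]; simp
    | add p q hp hq => simp only [map_add, add_mul, mul_add, hp, hq]
    | mul_X p n hp =>
      rw [mul_comm p, opEval_X_mul L hL, mul_assoc, hp, ← mul_assoc, (hL n 0).eq, mul_assoc]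
  induction m with
  | zero => rw [expQuot, opEval_one, pow_zero]
  | succ m ih =>
    rw [pow_succ', Module.End.mul_apply, ih, ← Module.End.mul_apply, mul_opEval L hL d hd, expQuot,
      map_sub, map_smul, opEval_X_mul L hL, ← hcomm, LinearMap.add_apply, Module.End.mul_apply, hy,
      map_smul, LinearMap.sub_apply, LinearMap.smul_apply, Module.End.mul_apply, neg_smul,
      sub_eq_add_neg]

/-- Each step of the recursion raises the largest index by at most one. This bounds the derivatives
of `j` occurring in `P_{n+1}` by `n`. -/
theorem expQuot_mem_supported (m : ℕ) : expQuot m ∈ MvPolynomial.supported ℂ {k | k < m} := by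
  induction m with
  | zero => exact one_mem _
  | succ m ih =>
    have hmono : MvPolynomial.supported ℂ {k | k < m} ≤ MvPolynomial.supported ℂ {k | k < m + 1} :=
      MvPolynomial.supported_mono fun k hk => Nat.lt_succ_of_lt hk
    have hD : ∀ p ∈ MvPolynomial.supported ℂ {k | k < m},
        shiftD p ∈ MvPolynomial.supported ℂ {k | k < m + 1} := fun p hp => by
      have hp' := hp
      rw [MvPolynomial.supported_eq_adjoin_X] at hp'
      induction hp' using Algebra.adjoin_induction with
      | mem x hx =>
        obtain ⟨k, hk, rfl⟩ := hx
        rw [shiftD, MvPolynomial.mkDerivation_X]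
        exact MvPolynomial.X_mem_supported.mpr (Nat.succ_lt_succ hk)
      | algebraMap r => rw [Derivation.map_algebraMap]; exact zero_mem _
      | add x y hx hy hx' hy' =>
        rw [← MvPolynomial.supported_eq_adjoin_X] at hx hy
        rw [map_add]
        exact add_mem (hx' hx) (hy' hy)
      | mul x y hx hy hx' hy' =>
        rw [← MvPolynomial.supported_eq_adjoin_X] at hx hy
        rw [Derivation.leibniz]
        exact add_mem (mul_mem (hmono hx) (hy' hy)) (mul_mem (hmono hy) (hx' hx))
    rw [expQuot]
    exact sub_mem (hD _ ih) (SMulMemClass.smul_mem _ (mul_mem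
      (MvPolynomial.X_mem_supported.mpr (show 0 < m + 1 from Nat.succ_pos m)) (hmono ih)))

variable {V : Type*} [AddCommGroup V] [Module ℂ V]

theorem foldr_nop (l : List (VertexOperator ℂ V)) (Y : VertexOperator ℂ V) :
    l.foldr (nop 1) Y = (l.map nopHom).prod Y := by
  induction l with
  | nil => rfl
  | cons A l ih => rw [List.foldr_cons, ih, List.map_cons, List.prod_cons]; rfl

theorem noEval_eq_opEval (p : MvPolynomial ℕ ℂ) (A Y : VertexOperator ℂ V) :
    noEval p A Y = opEval (fun k => nopHom (iterD k A)) p Y := by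
  rw [noEval, opEval_apply, LinearMap.sum_apply]
  refine Finset.sum_congr rfl fun m _ => ?_
  rw [foldr_nop, List.map_map, LinearMap.smul_apply]
  rfl

theorem PartsCommute.commute_iterD {A : VertexOperator ℂ V} (h : PartsCommute A A) (k l : ℕ) :
    Commute (nopHom (iterD k A)) (nopHom (iterD l A)) :=
  commute_nopHom ((h.iterD_right l).symm.iterD_right k).symm

theorem iterD_eq_noEval {A : VertexOperator ℂ V} (h : PartsCommute A A) (Y : VertexOperator ℂ V)
    (hY : deriv Y = -Complex.I • nop 1 A Y) (m : ℕ) : iterD m Y = noEval (expQuot m) A Y := by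
  rw [iterD_eq_pow, noEval_eq_opEval]
  refine pow_apply_eq_opEval _ (fun k l => h.commute_iterD k l) derivHom (fun k => ?_) Y hY m
  rw [iterD_succ]
  exact deriv_nopHom _

end Polynomials

/-! ### The iterated Leibniz rule. -/

section Leibniz

variable {M : Type*} [AddCommGroup M] [Module ℂ M]

theorem pow_apply_leibniz (d : Module.End ℂ M) (F : ℕ → ℕ → M)
    (hd : ∀ a b, d (F a b) = F (a + 1) b + F a (b + 1)) (n : ℕ) :
    (d ^ n) (F 0 0) = ∑ x ∈ Finset.HasAntidiagonal.antidiagonal n, n.choose x.1 • F x.1 x.2 := by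
  induction n with
  | zero => simp
  | succ n ih =>
    rw [pow_succ', Module.End.mul_apply, ih, Finset.sum_antidiagonal_choose_succ_nsmul, map_sum,
      ← Finset.sum_add_distrib]
    refine Finset.sum_congr rfl fun x hx => ?_
    rw [map_nsmul, hd, smul_add, add_comm, ← Nat.choose_symm_of_eq_add
      (Finset.HasAntidiagonal.mem_antidiagonal.mp hx).symm]

end Leibniz

/-! ### Fields and series on a tensor product. -/

section Tensor

variable {V W : Type*} [AddCommGroup V] [Module ℂ V] [AddCommGroup W] [Module ℂ W]

theorem finsum_tmul {ι : Type*} {a : ι → V} (ha : (Function.support a).Finite) (y : W) :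
    (∑ᶠ i, a i) ⊗ₜ[ℂ] y = ∑ᶠ i, a i ⊗ₜ[ℂ] y :=
  map_finsum ((TensorProduct.mk ℂ V W).flip y) ha

theorem tmul_finsum {ι : Type*} {a : ι → W} (u : V) (ha : (Function.support a).Finite) :
    u ⊗ₜ[ℂ] (∑ᶠ i, a i) = ∑ᶠ i, u ⊗ₜ[ℂ] a i :=
  map_finsum (TensorProduct.mk ℂ V W u) ha

theorem coeff_onLeft (A : VertexOperator ℂ V) (n : ℤ) (u : V) (y : W) :
    coeff (onLeft A) n (u ⊗ₜ[ℂ] y) = coeff A n u ⊗ₜ[ℂ] y := rfl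

theorem coeff_onRight (A : VertexOperator ℂ W) (n : ℤ) (u : V) (y : W) :
    coeff (onRight A) n (u ⊗ₜ[ℂ] y) = u ⊗ₜ[ℂ] coeff A n y := rfl

theorem field_ext_tmul {A B : VertexOperator ℂ (V ⊗[ℂ] W)}
    (h : ∀ n u y, coeff A n (u ⊗ₜ[ℂ] y) = coeff B n (u ⊗ₜ[ℂ] y)) : A = B :=
  HVertexOperator.coeff_inj (funext fun n => TensorProduct.ext' (h n))

theorem deriv_onLeft (A : VertexOperator ℂ V) :
    deriv (onLeft A : VertexOperator ℂ (V ⊗[ℂ] W)) = onLeft (deriv A) :=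
  field_ext_tmul fun n u y => by
    rw [coeff_deriv, coeff_onLeft, coeff_onLeft, coeff_deriv, TensorProduct.smul_tmul']

theorem deriv_onRight (A : VertexOperator ℂ W) :
    deriv (onRight A : VertexOperator ℂ (V ⊗[ℂ] W)) = onRight (deriv A) :=
  field_ext_tmul fun n u y => by
    rw [coeff_deriv, coeff_onRight, coeff_onRight, coeff_deriv, TensorProduct.tmul_smul]

theorem iterD_onLeft (n : ℕ) (A : VertexOperator ℂ V) :
    iterD n (onLeft A : VertexOperator ℂ (V ⊗[ℂ] W)) = onLeft (iterD n A) := by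
  induction n with
  | zero => rfl
  | succ n ih => rw [iterD_succ, ih, deriv_onLeft, iterD_succ]

theorem iterD_onRight (n : ℕ) (A : VertexOperator ℂ W) :
    iterD n (onRight A : VertexOperator ℂ (V ⊗[ℂ] W)) = onRight (iterD n A) := by
  induction n with
  | zero => rfl
  | succ n ih => rw [iterD_succ, ih, deriv_onRight, iterD_succ]

theorem nop_onLeft (s : ℂ) (A B : VertexOperator ℂ V) :
    nop s (onLeft A : VertexOperator ℂ (V ⊗[ℂ] W)) (onLeft B) = onLeft (nop s A B) :=
  field_ext_tmul fun n u y => by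
    rw [coeff_onLeft, coeff_nop, coeff_nop, diag, diag,
      finsum_tmul ((bddBelow₂_nopTerm s A B u).finite_support n)]
    refine finsum_congr fun p => ?_
    simp only [nopTerm, coeff_onLeft]
    split_ifs
    · rfl
    · rw [TensorProduct.smul_tmul']

theorem nop_onRight (s : ℂ) (A B : VertexOperator ℂ W) :
    nop s (onRight A : VertexOperator ℂ (V ⊗[ℂ] W)) (onRight B) = onRight (nop s A B) :=
  field_ext_tmul fun n u y => by
    rw [coeff_onRight, coeff_nop, coeff_nop, diag, diag,
      tmul_finsum u ((bddBelow₂_nopTerm s A B y).finite_support n)]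
    refine finsum_congr fun p => ?_
    simp only [nopTerm, coeff_onRight]
    split_ifs
    · rfl
    · rw [TensorProduct.tmul_smul]

theorem onRight_idField : (onRight idField : VertexOperator ℂ (V ⊗[ℂ] W)) = idField :=
  field_ext_tmul fun n u y => by
    rw [coeff_onRight, coeff_idField, coeff_idField]
    split_ifs
    · rfl
    · exact TensorProduct.tmul_zero _ _

/-- `onRight` as a linear map. -/
def onRightHom : VertexOperator ℂ W →ₗ[ℂ] VertexOperator ℂ (V ⊗[ℂ] W) where
  toFun := onRight
  map_add' A B := field_ext_tmul fun n u y => by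
    simp only [coeff_onRight, map_add, Pi.add_apply, LinearMap.add_apply, TensorProduct.tmul_add]
  map_smul' a A := field_ext_tmul fun n u y => by
    simp only [coeff_onRight, map_smul, Pi.smul_apply, LinearMap.smul_apply, RingHom.id_apply,
      TensorProduct.tmul_smul]

theorem noEval_onRight (p : MvPolynomial ℕ ℂ) (A Y : VertexOperator ℂ W) :
    noEval p (onRight A : VertexOperator ℂ (V ⊗[ℂ] W)) (onRight Y) = onRight (noEval p A Y) := by
  change _ = onRightHom (noEval p A Y)
  rw [noEval, noEval, map_sum]
  refine Finset.sum_congr rfl fun m _ => ?_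
  rw [map_smul]
  congr 1
  generalize (Finsupp.toMultiset m).sort (· ≤ ·) = l
  induction l with
  | nil => rfl
  | cons k l ih =>
    rw [List.map_cons, List.map_cons, List.foldr_cons, List.foldr_cons, ih, iterD_onRight]
    exact nop_onRight 1 _ _

/-- Fields on different tensor factors commute, so both branches of the normal ordering agree and
the plain Cauchy product remains. -/
theorem coeff_nop_onLeft_onRight (A : VertexOperator ℂ V) (B : VertexOperator ℂ W) (N : ℤ) (u : V)
    (y : W) : coeff (nop 1 (onLeft A) (onRight B)) N (u ⊗ₜ[ℂ] y) =
      ∑ᶠ k, coeff A k u ⊗ₜ[ℂ] coeff B (N - k) y := by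
  rw [coeff_nop]
  refine finsum_congr fun k => ?_
  simp only [nopTerm, coeff_onLeft, coeff_onRight, one_smul, ite_self]

theorem finite_support_of_bounds {X : Type*} [Zero X] {F : ℤ → ℤ → X} (a b c d : ℤ)
    (h : ∀ p q, (p < a ∨ b < p ∨ q < c ∨ d < q) → F p q = 0) :
    (Function.support fun x : ℤ × ℤ => F x.1 x.2).Finite := by
  refine ((Set.finite_Icc a b).prod (Set.finite_Icc c d)).subset fun x hx => ?_
  by_contra hc
  simp only [Set.mem_prod, Set.mem_Icc, not_and_or, not_le] at hc
  exact hx (h _ _ (by tauto))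

theorem finite_support_int {X : Type*} [Zero X] {F : ℤ → X} (a b : ℤ)
    (h : ∀ p, (p < a ∨ b < p) → F p = 0) : (Function.support F).Finite := by
  refine (Set.finite_Icc a b).subset fun x hx => ?_
  by_contra hc
  simp only [Set.mem_Icc, not_and_or, not_le] at hc
  exact hx (h _ hc)

/-- The product of a series in `V` and a series in `W`. -/
def tconv (f : ℤ → ℤ → V) (g : ℤ → ℤ → W) (p q : ℤ) : V ⊗[ℂ] W :=
  ∑ᶠ r, ∑ᶠ s, f r s ⊗ₜ[ℂ] g (p - r) (q - s)

theorem finite_tconv_inner {f : ℤ → ℤ → V} {g : ℤ → ℤ → W} (hf : BddBelow₂ f) (hg : BddBelow₂ g)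
    (p q r : ℤ) : (Function.support fun s => f r s ⊗ₜ[ℂ] g (p - r) (q - s)).Finite := by
  obtain ⟨M, hM⟩ := hf
  obtain ⟨L, hL⟩ := hg
  refine finite_support_int M (q - L) fun s hs => ?_
  rcases hs with hs | hs
  · rw [hM _ _ (by lia), TensorProduct.zero_tmul]
  · rw [hL _ _ (by lia), TensorProduct.tmul_zero]

theorem finite_tconv_outer {f : ℤ → ℤ → V} {g : ℤ → ℤ → W} (hf : BddBelow₂ f) (hg : BddBelow₂ g)
    (p q : ℤ) : (Function.support fun r => ∑ᶠ s, f r s ⊗ₜ[ℂ] g (p - r) (q - s)).Finite := by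
  obtain ⟨M, hM⟩ := hf
  obtain ⟨L, hL⟩ := hg
  refine finite_support_int M (p - L) fun r hr => ?_
  rw [← finsum_zero (α := ℤ)]
  refine finsum_congr fun s => ?_
  rcases hr with hr | hr
  · rw [hM _ _ (by lia), TensorProduct.zero_tmul]
  · rw [hL _ _ (by lia), TensorProduct.tmul_zero]

theorem BddBelow₂.tconv {f : ℤ → ℤ → V} {g : ℤ → ℤ → W} (hf : BddBelow₂ f) (hg : BddBelow₂ g) :
    BddBelow₂ (tconv f g) := by
  obtain ⟨M, hM⟩ := hf
  obtain ⟨L, hL⟩ := hg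
  refine ⟨M + L, fun p q h => ?_⟩
  rw [FMS.tconv, ← finsum_zero (α := ℤ)]
  refine finsum_congr fun r => ?_
  rw [← finsum_zero (α := ℤ)]
  refine finsum_congr fun s => ?_
  by_cases h' : r < M ∨ s < M
  · rw [hM _ _ h', TensorProduct.zero_tmul]
  · rw [hL _ _ (by lia), TensorProduct.tmul_zero]

theorem tconv_mulSub {f : ℤ → ℤ → V} {g : ℤ → ℤ → W} (hf : BddBelow₂ f) (hg : BddBelow₂ g) :
    tconv f (mulSub g) = mulSub (tconv f g) := by
  ext p q
  rw [mulSub_apply, tconv, tconv, tconv, ← finsum_sub_distrib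
    (finite_tconv_outer hf hg (p - 1) q) (finite_tconv_outer hf hg p (q - 1))]
  refine finsum_congr fun r => ?_
  rw [← finsum_sub_distrib
    (finite_tconv_inner hf hg (p - 1) q r) (finite_tconv_inner hf hg p (q - 1) r)]
  refine finsum_congr fun s => ?_
  rw [mulSub_apply, TensorProduct.tmul_sub, sub_right_comm p, sub_right_comm q]

theorem dw_tconv {f : ℤ → ℤ → V} {g : ℤ → ℤ → W} (hf : BddBelow₂ f) (hg : BddBelow₂ g) :
    dw (tconv f g) = tconv (dw f) g + tconv f (dw g) := by
  ext p q
  have hf' : BddBelow₂ fun r s => (s : ℂ) • f r s :=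
    hf.imp fun M hM r s h => by simp only [hM r s h, smul_zero]
  -- After this shift both terms have total exponent `q + 1` in `w`, which splits as `s + (q + 1 -
  -- s)`.
  have h1 : tconv (dw f) g p q = tconv (fun r s => (s : ℂ) • f r s) g p (q + 1) := by
    refine finsum_congr fun r => ?_
    rw [← finsum_comp_equiv (Equiv.addRight (1 : ℤ))
      (f := fun s => ((s : ℂ) • f r s) ⊗ₜ[ℂ] g (p - r) (q + 1 - s))]
    refine finsum_congr fun s => ?_
    rw [dw_apply, Equiv.coe_addRight, add_sub_add_right_eq_sub]
    push_cast
    rfl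
  rw [Pi.add_apply, Pi.add_apply, h1, dw_apply, tconv, tconv, tconv,
    smul_finsum' _ (finite_tconv_outer hf hg p (q + 1)),
    ← finsum_add_distrib (finite_tconv_outer hf' hg p (q + 1))
      (finite_tconv_outer hf hg.dw p q)]
  refine finsum_congr fun r => ?_
  rw [smul_finsum' _ (finite_tconv_inner hf hg p (q + 1) r),
    ← finsum_add_distrib (finite_tconv_inner hf' hg p (q + 1) r)
      (finite_tconv_inner hf hg.dw p q r)]
  refine finsum_congr fun s => ?_
  rw [dw_apply, TensorProduct.tmul_smul, ← TensorProduct.smul_tmul',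
    show q - s + 1 = q + 1 - s by ring, ← add_smul]
  congr 1
  push_cast
  ring

theorem dw_pow_tconv {f : ℤ → ℤ → V} {g : ℤ → ℤ → W} (hf : BddBelow₂ f) (hg : BddBelow₂ g)
    (n : ℕ) : (dw ^ n) (tconv f g) =
      ∑ x ∈ Finset.HasAntidiagonal.antidiagonal n, n.choose x.1 • tconv ((dw ^ x.1) f) ((dw ^ x.2) g) := by
  refine pow_apply_leibniz dw (fun a b => tconv ((dw ^ a) f) ((dw ^ b) g)) (fun a b => ?_) n
  rw [dw_tconv (hf.dw_pow a) (hg.dw_pow b), pow_succ', Module.End.mul_apply, pow_succ',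
    Module.End.mul_apply]

/-- Restriction to the diagonal is multiplicative. Both sides are reindexed to one triple sum, which
is finite because all exponents are bounded below. -/
theorem diag_tconv {f : ℤ → ℤ → V} {g : ℤ → ℤ → W} (hf : BddBelow₂ f) (hg : BddBelow₂ g) (N : ℤ) :
    diag (tconv f g) N = ∑ᶠ k, diag f k ⊗ₜ[ℂ] diag g (N - k) := by
  obtain ⟨M, hM⟩ := id hf
  obtain ⟨L, hL⟩ := id hg
  have hleft : diag (tconv f g) N = ∑ᶠ r, ∑ᶠ s, ∑ᶠ t, f r s ⊗ₜ[ℂ] g t (N - (r + s) - t) := by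
    have h0 : ∀ p r s, (r < M ∨ s < M ∨ p - r < L ∨ N - p - s < L) →
        f r s ⊗ₜ[ℂ] g (p - r) (N - p - s) = 0 := fun p r s h => by
      by_cases h' : r < M ∨ s < M
      · rw [hM _ _ h', TensorProduct.zero_tmul]
      · rw [hL _ _ (by lia), TensorProduct.tmul_zero]
    simp only [diag, tconv]
    rw [finsum_comm_of_finite]
    · refine finsum_congr fun r => ?_
      rw [finsum_comm_of_finite]
      · refine finsum_congr fun s => ?_
        rw [← finsum_comp_equiv (Equiv.addRight r)
          (f := fun p => f r s ⊗ₜ[ℂ] g (p - r) (N - p - s))]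
        refine finsum_congr fun t => ?_
        rw [Equiv.coe_addRight, add_sub_cancel_right, show N - (t + r) - s = N - (r + s) - t by ring]
      · exact finite_support_of_bounds (F := fun p s => f r s ⊗ₜ[ℂ] g (p - r) (N - p - s))
          (r + L) (N - L - M) M (N - L - r - L) fun p s h =>
          h0 p r s (by lia)
    · refine finite_support_of_bounds
        (F := fun p r => ∑ᶠ s, f r s ⊗ₜ[ℂ] g (p - r) (N - p - s)) (M + L) (N - L - M) M (N - L - M - L) fun p r h => ?_
      rw [← finsum_zero (α := ℤ)]
      exact finsum_congr fun s => h0 p r s (by lia)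
  have hright : ∀ k, diag f k ⊗ₜ[ℂ] diag g (N - k) =
      ∑ᶠ r, ∑ᶠ t, f r (k - r) ⊗ₜ[ℂ] g t (N - k - t) := fun k => by
    rw [diag, finsum_tmul (hf.finite_support k)]
    exact finsum_congr fun r => tmul_finsum _ (hg.finite_support (N - k))
  have h0 : ∀ k r t, (r < M ∨ k - r < M ∨ t < L ∨ N - k - t < L) →
      f r (k - r) ⊗ₜ[ℂ] g t (N - k - t) = 0 := fun k r t h => by
    by_cases h' : r < M ∨ k - r < M
    · rw [hM _ _ h', TensorProduct.zero_tmul]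
    · rw [hL _ _ (by lia), TensorProduct.tmul_zero]
  rw [hleft, finsum_congr hright]
  symm
  rw [finsum_comm_of_finite]
  · refine finsum_congr fun r => ?_
    rw [← finsum_comp_equiv (Equiv.addRight r)]
    refine finsum_congr fun s => finsum_congr fun t => ?_
    simp only [Equiv.coe_addRight, add_comm s r, add_sub_cancel_left]
  · refine finite_support_of_bounds
        (F := fun k r => ∑ᶠ t, f r (k - r) ⊗ₜ[ℂ] g t (N - k - t)) (M + M) (N - L - L) M (N - L - L - M) fun k r h => ?_
    rw [← finsum_zero (α := ℤ)]
    exact finsum_congr fun t => h0 k r t (by lia)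

end Tensor

/-! ### Coefficients of exponentials over a possibly noncommutative ring. -/

section Exponential

theorem coeff_pow_of_lt {R : Type*} [Ring R] {A : PowerSeries R} (hA : PowerSeries.coeff 0 A = 0) {k r : ℕ}
    (h : k < r) : PowerSeries.coeff k (A ^ r) = 0 := by
  induction r generalizing k with
  | zero => lia
  | succ r ih =>
    rw [pow_succ', PowerSeries.coeff_mul]
    refine Finset.sum_eq_zero fun x hx => ?_
    rw [Finset.HasAntidiagonal.mem_antidiagonal] at hx
    by_cases h' : x.2 < r
    · rw [ih h', mul_zero]
    · rw [show x.1 = 0 by lia, hA, zero_mul]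

variable {R S : Type*} [Ring R] [Algebra ℂ R] [Ring S] [Algebra ℂ S]

theorem expCoeff_map (φ : R →ₐ[ℂ] S) (A : PowerSeries R) (k : ℕ) :
    expCoeff (A.map (φ : R →+* S)) k = φ (expCoeff A k) := by
  rw [expCoeff, expCoeff, map_sum]
  refine Finset.sum_congr rfl fun r _ => ?_
  rw [← map_pow, PowerSeries.coeff_map, map_smul]
  rfl

/-- `A^r` begins in degree `r`, so the exponential series may be truncated anywhere beyond `k`. Thus
different coefficients can be summed over one range. -/
theorem expCoeff_eq_sum {A : PowerSeries R} (hA : PowerSeries.coeff 0 A = 0) {k n : ℕ}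
    (h : k < n) : expCoeff A k =
      ∑ r ∈ Finset.range n, ((r.factorial : ℂ)⁻¹) • PowerSeries.coeff k (A ^ r) := by
  rw [expCoeff]
  refine Finset.sum_subset (Finset.range_mono h) fun r _ hr => ?_
  rw [coeff_pow_of_lt hA (by simpa using hr), smul_zero]

theorem expCoeff_zero (A : PowerSeries R) : expCoeff A 0 = 1 := by
  simp [expCoeff]

theorem inv_factorial_succ_mul (r : ℕ) :
    (((r + 1).factorial : ℂ)⁻¹) * ((r : ℂ) + 1) = (r.factorial : ℂ)⁻¹ := by
  have h : ((r : ℂ) + 1) ≠ 0 := Nat.cast_add_one_ne_zero r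
  rw [Nat.factorial_succ]
  push_cast
  rw [mul_inv, mul_right_comm, inv_mul_cancel₀ h, one_mul]

theorem mul_pow_of_commutator {A D N : R} (h : D * A = A * D + N) (hN : Commute A N) (r : ℕ) :
    D * A ^ (r + 1) = A ^ (r + 1) * D + ((r : ℂ) + 1) • (A ^ r * N) := by
  induction r with
  | zero => simp [h]
  | succ r ih =>
    rw [pow_succ A (r + 1), ← mul_assoc, ih, add_mul, mul_assoc, h, mul_add, smul_mul_assoc,
      mul_assoc (A ^ r), ← hN.eq, ← mul_assoc (A ^ r), ← pow_succ, mul_assoc]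
    push_cast
    module

/-- If `[D, A(t)] = κ t^m` then `[D, exp A(t)] = κ t^m exp A(t)`. -/
theorem commutator_expCoeff {A : PowerSeries R} (hA : PowerSeries.coeff 0 A = 0) (D : R) (κ : ℂ)
    {m : ℕ} (hm : 0 < m) (h : ∀ n, D * PowerSeries.coeff n A =
      PowerSeries.coeff n A * D + if n = m then κ • 1 else 0) (k : ℕ) :
    D * expCoeff A k =
      expCoeff A k * D + if m ≤ k then κ • expCoeff A (k - m) else 0 := by
  -- With `D` as a constant series, the hypothesis becomes `[D, A] = N` with `N` commuting with `A`,
  -- whence `[D, A^{r+1}] = (r + 1) A^r N`.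
  let N : PowerSeries R := PowerSeries.C (κ • 1) * PowerSeries.X ^ m
  have h1 : PowerSeries.C D * A = A * PowerSeries.C D + N := by
    ext n
    rw [map_add, PowerSeries.coeff_C_mul, PowerSeries.coeff_mul_C, h n,
      PowerSeries.coeff_C_mul_X_pow]
  have h2 : Commute A N := by
    refine Commute.mul_right ?_ (PowerSeries.commute_X_pow A m)
    ext n
    rw [PowerSeries.coeff_C_mul, PowerSeries.coeff_mul_C, mul_smul_comm, smul_mul_assoc, mul_one,
      one_mul]
  have h3 : ∀ r : ℕ, D * PowerSeries.coeff k (A ^ (r + 1)) = PowerSeries.coeff k (A ^ (r + 1)) * D +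
      ((r : ℂ) + 1) • if m ≤ k then κ • PowerSeries.coeff (k - m) (A ^ r) else 0 := fun r => by
    have := congrArg (PowerSeries.coeff k) (mul_pow_of_commutator h1 h2 r)
    rw [PowerSeries.coeff_C_mul, map_add, PowerSeries.coeff_mul_C] at this
    rw [this]
    congr 1
    rw [show ((r : ℂ) + 1) • (A ^ r * N) = (r + 1) • (A ^ r * N) by
      rw [← Nat.cast_smul_eq_nsmul ℂ]; push_cast; rfl, map_nsmul, ← mul_assoc,
      PowerSeries.coeff_mul_X_pow', ← Nat.cast_smul_eq_nsmul ℂ]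
    push_cast
    split_ifs
    · rw [PowerSeries.coeff_mul_C, mul_smul_comm, mul_one]
    · rfl
  rw [expCoeff, Finset.sum_range_succ', mul_add, add_mul, Finset.mul_sum, Finset.sum_mul,
    add_right_comm]
  congr 1
  · rw [← sub_eq_iff_eq_add', ← Finset.sum_sub_distrib]
    have h4 : ∀ r : ℕ, D * (((r + 1).factorial : ℂ)⁻¹ • PowerSeries.coeff k (A ^ (r + 1))) -
        (((r + 1).factorial : ℂ)⁻¹ • PowerSeries.coeff k (A ^ (r + 1))) * D =
        (r.factorial : ℂ)⁻¹ • if m ≤ k then κ • PowerSeries.coeff (k - m) (A ^ r) else 0 := by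
      intro r
      rw [mul_smul_comm, smul_mul_assoc, ← smul_sub, h3, add_sub_cancel_left, smul_smul,
        inv_factorial_succ_mul]
    rw [Finset.sum_congr rfl fun r _ => h4 r]
    split_ifs with hk
    · rw [expCoeff_eq_sum hA (show k - m < k by lia), Finset.smul_sum]
      exact Finset.sum_congr rfl fun r _ => smul_comm _ _ _
    · simp
  · rw [pow_zero, PowerSeries.coeff_one]
    split_ifs <;> simp

/-- The differential equation `(exp A)' = exp(A) A'`, read off in degree `k`. -/
theorem expCoeff_succ {R : Type*} [CommRing R] [Algebra ℂ R] {A : PowerSeries R}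
    (hA : PowerSeries.coeff 0 A = 0) (k : ℕ) : ((k : ℂ) + 1) • expCoeff A (k + 1) =
      ∑ x ∈ Finset.HasAntidiagonal.antidiagonal k,
        expCoeff A x.1 * (((x.2 : ℂ) + 1) • PowerSeries.coeff (x.2 + 1) A) := by
  have h1 : ∀ r : ℕ, ((k : ℂ) + 1) • PowerSeries.coeff (k + 1) (A ^ (r + 1)) =
      ((r : ℂ) + 1) • ∑ x ∈ Finset.HasAntidiagonal.antidiagonal k,
        PowerSeries.coeff x.1 (A ^ r) * (((x.2 : ℂ) + 1) • PowerSeries.coeff (x.2 + 1) A) := by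
    intro r
    have h := congrArg (PowerSeries.coeff k) (Derivation.leibniz_pow
      (PowerSeries.derivative R) A (r + 1))
    have hc : ∀ (n : ℕ) (a : R), a * ((n : R) + 1) = ((n : ℂ) + 1) • a := fun n a => by
      rw [Algebra.smul_def, mul_comm]
      simp
    rw [PowerSeries.coeff_derivative, hc, Nat.add_sub_cancel, map_nsmul, smul_eq_mul,
      PowerSeries.coeff_mul] at h
    rw [h, ← Nat.cast_smul_eq_nsmul ℂ]
    push_cast
    congr 1
    refine Finset.sum_congr rfl fun x _ => ?_
    rw [PowerSeries.coeff_derivative, hc]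
  conv_lhs => rw [expCoeff, Finset.sum_range_succ']
  rw [smul_add, pow_zero, PowerSeries.coeff_one,
    if_neg (Nat.succ_ne_zero k), smul_zero, smul_zero, add_zero, Finset.smul_sum]
  have h2 : ∀ r : ℕ, ((k : ℂ) + 1) • ((r + 1).factorial : ℂ)⁻¹ • PowerSeries.coeff (k + 1) (A ^ (r + 1))
      = ∑ x ∈ Finset.HasAntidiagonal.antidiagonal k, ((r.factorial : ℂ)⁻¹ •
        PowerSeries.coeff x.1 (A ^ r)) * (((x.2 : ℂ) + 1) • PowerSeries.coeff (x.2 + 1) A) := by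
    intro r
    rw [smul_comm, h1, smul_smul, inv_factorial_succ_mul, Finset.smul_sum]
    exact Finset.sum_congr rfl fun x _ => (smul_mul_assoc _ _ _).symm
  rw [Finset.sum_congr rfl fun r _ => h2 r, Finset.sum_comm]
  refine Finset.sum_congr rfl fun x hx => ?_
  rw [Finset.HasAntidiagonal.mem_antidiagonal] at hx
  rw [← Finset.sum_mul, ← expCoeff_eq_sum hA (by lia)]

end Exponential

/-! ### Creation exponentials as polynomials, annihilation exponentials as translations. -/

section Oscillators

open MvPolynomial (pderiv)

theorem pderiv_comm (i k : ℕ) (p : Osc) : pderiv i (pderiv k p) = pderiv k (pderiv i p) := by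
  have h : ⁅pderiv (R := ℂ) i, pderiv k⁆ = 0 := MvPolynomial.derivation_ext fun m => by
    rw [Derivation.commutator_apply, MvPolynomial.pderiv_X, MvPolynomial.pderiv_X, Pi.single_apply,
      Pi.single_apply, Derivation.zero_apply]
    split_ifs <;> simp
  have := congr_arg (fun d : Derivation ℂ Osc Osc => d p) h
  rwa [Derivation.commutator_apply, Derivation.zero_apply, sub_eq_zero] at this

/-- The coefficients of `exp (η ∑_{n>0} x_{n-1} z^n / n)`. -/
def expPoly (η : ℂ) (k : ℤ) : Osc :=
  if k < 0 then 0
  else expCoeff (PowerSeries.mk fun n : ℕ =>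
    if n = 0 then 0 else (η / n) • MvPolynomial.X (n - 1)) k.toNat

theorem expPoly_of_neg (η : ℂ) {k : ℤ} (hk : k < 0) : expPoly η k = 0 := if_pos hk

theorem expPoly_zero (η : ℂ) : expPoly η 0 = 1 := by
  rw [expPoly, if_neg (by lia)]
  exact expCoeff_zero _

theorem osc_neg_succ (i : ℕ) : osc (-((i : ℤ) + 1)) = LinearMap.mulLeft ℂ (MvPolynomial.X i) := by
  rw [osc, if_pos (by lia), show (-(-((i : ℤ) + 1)) - 1).toNat = i by lia]

theorem osc_succ (i : ℕ) : osc ((i : ℤ) + 1) = ((i : ℂ) + 1) • (pderiv i).toLinearMap := by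
  rw [osc, if_neg (by lia), show ((i : ℤ) + 1 - 1).toNat = i by lia]
  push_cast
  rfl

/-- Creation operators are multiplications, and `Algebra.lmul` is an algebra map, so the exponential
can be computed in the polynomial ring. -/
theorem expCreate_eq (η : ℂ) (k : ℤ) : expCreate η k = LinearMap.mulLeft ℂ (expPoly η k) := by
  rw [expCreate, expPoly]
  split_ifs
  · simp
  · change _ = Algebra.lmul ℂ Osc _
    rw [← expCoeff_map]
    congr 1
    ext1 n
    rw [PowerSeries.coeff_map, PowerSeries.coeff_mk, PowerSeries.coeff_mk]
    split_ifs with hn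
    · simp
    · obtain ⟨i, rfl⟩ := Nat.exists_eq_succ_of_ne_zero hn
      have := osc_neg_succ i
      push_cast at this ⊢
      rw [this]
      ext p
      simp

theorem expPoly_succ (η : ℂ) (k : ℤ) : ((k : ℂ) + 1) • expPoly η (k + 1) =
    η • ∑ᶠ i : ℕ, MvPolynomial.X i * expPoly η (k - i) := by
  rcases lt_or_ge k 0 with hk | hk
  · rw [finsum_congr fun i : ℕ => by rw [expPoly_of_neg η (show k - i < 0 by lia), mul_zero],
      finsum_zero, smul_zero]
    rcases eq_or_ne k (-1) with rfl | h
    · simp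
    · rw [expPoly_of_neg η (by lia), smul_zero]
  · lift k to ℕ using hk
    rw [finsum_eq_sum_of_support_subset (s := Finset.range (k + 1))]
    · rw [expPoly, if_neg (by lia), show ((k : ℤ) + 1).toNat = k + 1 by lia]
      have := expCoeff_succ (A := PowerSeries.mk fun n : ℕ =>
        if n = 0 then 0 else (η / n) • (MvPolynomial.X (n - 1) : Osc)) (by simp) k
      rw [Int.cast_natCast, this, Finset.Nat.sum_antidiagonal_eq_sum_range_succ_mk,
        ← Finset.sum_range_reflect, Finset.smul_sum]
      refine Finset.sum_congr rfl fun i hi => ?_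
      rw [Finset.mem_range] at hi
      have h0 : ((i : ℂ) + 1) ≠ 0 := Nat.cast_add_one_ne_zero i
      rw [expPoly, if_neg (by lia), show ((k : ℤ) - i).toNat = k - i by lia]
      simp only [Nat.add_sub_cancel, PowerSeries.coeff_mk]
      rw [if_neg (by lia), show k.succ - 1 - i = k - i by lia,
        Nat.sub_sub_self (show i ≤ k by lia)]
      push_cast
      rw [smul_smul, mul_div_cancel₀ _ h0, mul_smul_comm, mul_comm]
    · intro i hi
      by_contra h
      simp only [Finset.coe_range, Set.mem_Iio, not_lt] at h
      exact hi (by beta_reduce; rw [expPoly_of_neg η (by lia), mul_zero])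

theorem pderiv_expPoly (η : ℂ) (i : ℕ) (k : ℤ) :
    pderiv i (expPoly η k) = (η / (i + 1)) • expPoly η (k - (i + 1)) := by
  rcases lt_or_ge k 0 with hk | hk
  · rw [expPoly_of_neg η hk, expPoly_of_neg η (by lia), map_zero, smul_zero]
  · have h := commutator_expCoeff (A := (PowerSeries.mk fun n : ℕ =>
        if n = 0 then 0 else (η / n) • (MvPolynomial.X (n - 1) : Osc)).map
          (Algebra.lmul ℂ Osc : Osc →+* Module.End ℂ Osc)) (by simp)
      (pderiv i).toLinearMap (η / (i + 1)) (Nat.succ_pos i) (fun n => ?_) k.toNat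
    -- The commutator identity holds for multiplication operators; applied to `1`, which `∂_i`
    -- kills, it gives the derivative of the polynomial.
    · have h' := LinearMap.congr_fun h 1
      have e : ∀ m : ℕ, expCoeff ((PowerSeries.mk fun n : ℕ =>
        if n = 0 then 0 else (η / n) • (MvPolynomial.X (n - 1) : Osc)).map
          (Algebra.lmul ℂ Osc : Osc →+* Module.End ℂ Osc)) m 1 = expPoly η m := fun m => by
        have := expCoeff_map (Algebra.lmul ℂ Osc) (PowerSeries.mk fun n : ℕ =>
          if n = 0 then 0 else (η / n) • (MvPolynomial.X (n - 1) : Osc)) m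
        erw [this]
        rw [expPoly, if_neg (by lia)]
        simp
      rw [Module.End.mul_apply, e, LinearMap.add_apply, Module.End.mul_apply,
        Derivation.coeFn_coe, Int.toNat_of_nonneg hk, Derivation.map_one_eq_zero, map_zero,
        zero_add] at h'
      rw [h']
      split_ifs with hik
      · rw [LinearMap.smul_apply, e]
        congr 2
        lia
      · rw [expPoly_of_neg η (by lia), smul_zero]
        rfl
    · rw [PowerSeries.coeff_map, PowerSeries.coeff_mk]
      ext p
      split_ifs with h1 h2 h2
      · lia
      · simp
      · subst h2
        simp [Derivation.leibniz, add_comm]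
      · have : (pderiv i) (MvPolynomial.X (n - 1) : Osc) = 0 :=
          MvPolynomial.pderiv_X_of_ne (by lia)
        simp [Derivation.leibniz, this]

/-- The annihilation exponentials, with integral index. -/
def annih (η : ℂ) (k : ℤ) : Module.End ℂ Osc := if k < 0 then 0 else expAnnih η k.toNat

theorem annih_of_neg (η : ℂ) {k : ℤ} (hk : k < 0) : annih η k = 0 := if_pos hk

theorem annih_zero (η : ℂ) : annih η 0 = 1 := by
  rw [annih, if_neg (by lia)]
  exact expCoeff_zero _

theorem annih_natCast (η : ℂ) (k : ℕ) : annih η k = expAnnih η k := by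
  rw [annih, if_neg (by lia)]
  rfl

/-- The factor `n` in `j(n) = n ∂_{n-1}` cancels the denominator. Hence the annihilation
exponential, in the variable `t = z^{-1}`, is the translation `x_i ↦ x_i - η t^{i+1}`. -/
theorem coeff_annihSeries (η : ℂ) (n : ℕ) : PowerSeries.coeff n (PowerSeries.mk fun n : ℕ =>
    if n = 0 then 0 else (-η / n) • osc n) =
    if n = 0 then 0 else -η • (pderiv (n - 1)).toLinearMap := by
  rw [PowerSeries.coeff_mk]
  split_ifs with hn
  · rfl
  · obtain ⟨i, rfl⟩ := Nat.exists_eq_succ_of_ne_zero hn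
    have h0 : ((i : ℂ) + 1) ≠ 0 := Nat.cast_add_one_ne_zero i
    have := osc_succ i
    push_cast at this ⊢
    rw [this, smul_smul, div_mul_cancel₀ _ h0]

theorem annih_X_mul (η : ℂ) (i : ℕ) (k : ℤ) (p : Osc) : annih η k (MvPolynomial.X i * p) =
    MvPolynomial.X i * annih η k p - η • annih η (k - (i + 1)) p := by
  rcases lt_or_ge k 0 with hk | hk
  · rw [annih_of_neg η hk, annih_of_neg η (by lia)]
    simp
  · lift k to ℕ using hk
    have h := commutator_expCoeff (A := PowerSeries.mk fun n : ℕ =>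
      if n = 0 then 0 else (-η / n) • osc n) (by rw [coeff_annihSeries, if_pos rfl])
      (LinearMap.mulLeft ℂ (MvPolynomial.X i)) η (Nat.succ_pos i) (fun n => ?_) k
    · have h' := LinearMap.congr_fun h p
      rw [annih_natCast, eq_sub_iff_add_eq]
      refine Eq.trans ?_ h'.symm
      rw [LinearMap.add_apply]
      congr 1
      split_ifs with hik
      · rw [show (k : ℤ) - (i + 1) = (k - (i + 1) : ℕ) by lia, annih_natCast]
        rfl
      · rw [annih_of_neg η (by lia), LinearMap.zero_apply, smul_zero]
    · rw [coeff_annihSeries]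
      refine LinearMap.ext fun q => ?_
      split_ifs with h1 h2 h2
      · lia
      · simp
      · subst h2
        simp [Derivation.leibniz]
      · have : (pderiv (n - 1)) (MvPolynomial.X i : Osc) = 0 :=
          MvPolynomial.pderiv_X_of_ne (by lia)
        simp [Derivation.leibniz, this]

theorem pderiv_annih (η : ℂ) (i : ℕ) (k : ℤ) (p : Osc) :
    pderiv i (annih η k p) = annih η k (pderiv i p) := by
  rcases lt_or_ge k 0 with hk | hk
  · rw [annih_of_neg η hk]
    simp
  · lift k to ℕ using hk
    -- The case `κ = 0` of the commutator formula; the exponent `i + 1` plays no role beyond being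
    -- positive.
    have h := commutator_expCoeff (A := PowerSeries.mk fun n : ℕ =>
      if n = 0 then 0 else (-η / n) • osc n) (by rw [coeff_annihSeries, if_pos rfl])
      (pderiv i).toLinearMap 0 (Nat.succ_pos i) (fun n => ?_) k
    · have h' := LinearMap.congr_fun h p
      rw [zero_smul, ite_self, add_zero] at h'
      rw [annih_natCast, expAnnih]
      simpa only [Module.End.mul_apply, Derivation.coeFn_coe] using h'
    · rw [coeff_annihSeries, zero_smul, ite_self, add_zero]
      split_ifs
      · simp
      · refine LinearMap.ext fun q => ?_
        simp only [Module.End.mul_apply, LinearMap.smul_apply, Derivation.coeFn_coe, map_smul]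
        rw [pderiv_comm]

theorem annih_one (η : ℂ) (k : ℤ) : annih η k 1 = if k = 0 then 1 else 0 := by
  split_ifs with h
  · rw [h, annih_zero]
    rfl
  · rcases lt_or_ge k 0 with hk | hk
    · rw [annih_of_neg η hk]
      rfl
    · lift k to ℕ using hk
      have hk0 : k ≠ 0 := by simpa using h
      rw [annih_natCast, expAnnih, expCoeff, LinearMap.sum_apply]
      refine Finset.sum_eq_zero fun r _ => ?_
      rw [LinearMap.smul_apply]
      refine smul_eq_zero_of_right _ ?_
      cases r with
      | zero => rw [pow_zero, PowerSeries.coeff_one, if_neg hk0]; rfl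
      | succ r =>
        rw [pow_succ, PowerSeries.coeff_mul, LinearMap.sum_apply]
        refine Finset.sum_eq_zero fun x _ => ?_
        rw [Module.End.mul_apply, coeff_annihSeries]
        split_ifs <;> simp

end Oscillators

theorem finite_support_smul {ι V : Type*} [AddCommGroup V] [Module ℂ V] {f : ι → V} (a : ℂ)
    (hf : (Function.support f).Finite) : (Function.support fun i => a • f i).Finite :=
  hf.subset (Function.support_const_smul_subset a f)

/-! ### The oscillator part of a vertex operator and its commutators. -/

section VertexOsc

open MvPolynomial (pderiv)

theorem annih_eventually (η : ℂ) (p : Osc) : ∃ K : ℤ, ∀ k > K, annih η k p = 0 := by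
  obtain ⟨K, hK⟩ := expAnnih_eventually η p
  refine ⟨K, fun k hk => ?_⟩
  rw [annih, if_neg (by lia)]
  exact hK _ (by lia)

theorem finite_vertexOsc (η : ℂ) (M : ℤ) (p : Osc) :
    (Function.support fun b : ℤ => expPoly η (M + b) * annih η b p).Finite := by
  obtain ⟨K, hK⟩ := annih_eventually η p
  refine finite_support_int 0 K fun b hb => ?_
  rcases hb with hb | hb
  · rw [annih_of_neg η hb, LinearMap.zero_apply, mul_zero]
  · rw [hK b hb, mul_zero]

/-- Extending the sum by zeros from `ℕ` to `ℤ` allows it to be shifted freely. -/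
theorem vertexOsc_apply (η : ℂ) (M : ℤ) (p : Osc) :
    vertexOsc η M p = ∑ᶠ b : ℤ, expPoly η (M + b) * annih η b p := by
  have h : ∀ k : ℕ, expPoly η (M + (-(k : ℤ) - 1)) * annih η (-(k : ℤ) - 1) p = 0 := fun k => by
    rw [annih_of_neg η (by lia), LinearMap.zero_apply, mul_zero]
  rw [finsum_int (finite_vertexOsc η M p), finsum_congr h, finsum_zero, add_zero, vertexOsc,
    locSum_apply]
  refine finsum_congr fun b => ?_
  rw [expCreate_eq, annih_natCast]
  rfl

theorem vertexOsc_one (η : ℂ) (M : ℤ) : vertexOsc η M 1 = expPoly η M := by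
  rw [vertexOsc_apply, finsum_eq_single _ 0 fun b hb => by rw [annih_one, if_neg hb, mul_zero],
    annih_one, if_pos rfl, mul_one, add_zero]

theorem pderiv_vertexOsc (η : ℂ) (i : ℕ) (M : ℤ) (p : Osc) :
    pderiv i (vertexOsc η M p) =
      vertexOsc η M (pderiv i p) + (η / (i + 1)) • vertexOsc η (M - (i + 1)) p := by
  simp only [vertexOsc_apply]
  rw [smul_finsum' _ (finite_vertexOsc η (M - (i + 1)) p),
    ← finsum_add_distrib (finite_vertexOsc η M _)
      (finite_support_smul _ (finite_vertexOsc η (M - (i + 1)) p)),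
    map_finsum _ (finite_vertexOsc η M p)]
  refine finsum_congr fun b => ?_
  rw [Derivation.leibniz, pderiv_annih, pderiv_expPoly, smul_eq_mul, smul_eq_mul, mul_comm
    (annih η b p), smul_mul_assoc, show M + b - (i + 1) = M - (i + 1) + b by ring]

/-- Multiplication by `x_i` commutes with the creation exponential, so the correction is that of the
translation by the annihilation exponential. Together with `pderiv_vertexOsc` this is `[j(n),
X_η(z)] = η z^n X_η(z)` for `n ≠ 0`. -/
theorem X_mul_vertexOsc (η : ℂ) (i : ℕ) (M : ℤ) (p : Osc) :
    MvPolynomial.X i * vertexOsc η M p =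
      vertexOsc η M (MvPolynomial.X i * p) + η • vertexOsc η (M + (i + 1)) p := by
  have h : vertexOsc η (M + (i + 1)) p =
      ∑ᶠ b : ℤ, expPoly η (M + b) * annih η (b - (i + 1)) p := by
    rw [vertexOsc_apply, ← finsum_comp_equiv (Equiv.addRight ((i : ℤ) + 1))
      (f := fun b => expPoly η (M + b) * annih η (b - (i + 1)) p)]
    refine finsum_congr fun b => ?_
    rw [Equiv.coe_addRight, add_sub_cancel_right, add_right_comm, add_assoc]
  have hfin : (Function.support fun b : ℤ =>
      expPoly η (M + b) * annih η (b - (i + 1)) p).Finite := by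
    obtain ⟨K, hK⟩ := annih_eventually η p
    refine finite_support_int 0 (K + (i + 1)) fun b hb => ?_
    rcases hb with hb | hb
    · rw [annih_of_neg η (by lia), LinearMap.zero_apply, mul_zero]
    · rw [hK _ (by lia), mul_zero]
  rw [h, vertexOsc_apply, vertexOsc_apply, smul_finsum' _ hfin,
    ← finsum_add_distrib (finite_vertexOsc η M _)
      (finite_support_smul _ hfin), mul_finsum' _ _
      (finite_vertexOsc η M p)]
  refine finsum_congr fun b => ?_
  rw [annih_X_mul, mul_sub, mul_smul_comm, sub_add_cancel, mul_left_comm]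

theorem expPoly_succ_eq_sum (η : ℂ) (k : ℤ) {n : ℕ} (hn : k < n) :
    ((k : ℂ) + 1) • expPoly η (k + 1) =
      η • ∑ i ∈ Finset.range n, MvPolynomial.X i * expPoly η (k - i) := by
  rw [expPoly_succ, finsum_eq_sum_of_support_subset (s := Finset.range n)]
  intro i hi
  by_contra h
  simp only [Finset.coe_range, Set.mem_Iio, not_lt] at h
  exact hi (by beta_reduce; rw [expPoly_of_neg η (by lia), mul_zero])

/-- `exp` of annihilation operators applied to `exp` of creation operators yields the
factor `1 - w / x`. -/
theorem annih_expPoly {η η' : ℂ} (h : η' * η = 1) (b k : ℤ) : annih η b (expPoly η' k) =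
    (if b = 0 then expPoly η' k else 0) - if b = 1 then expPoly η' (k - 1) else 0 := by
  rcases lt_or_ge k 0 with hk | hk
  · simp [expPoly_of_neg η' hk, expPoly_of_neg η' (show k - 1 < 0 by lia)]
  lift k to ℕ using hk
  induction k using Nat.strong_induction_on generalizing b with
  | _ k ih =>
    have ih' : ∀ (m : ℤ) (b : ℤ), m < k → annih η b (expPoly η' m) =
        (if b = 0 then expPoly η' m else 0) - if b = 1 then expPoly η' (m - 1) else 0 := by
      intro m b hm
      rcases lt_or_ge m 0 with hm0 | hm0
      · simp [expPoly_of_neg η' hm0, expPoly_of_neg η' (show m - 1 < 0 by lia)]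
      · lift m to ℕ using hm0
        exact ih m (by lia) b
    rcases lt_or_ge b 1 with hb | hb
    · rcases eq_or_ne b 0 with rfl | hb0
      · simp [annih_zero]
      · rw [annih_of_neg η (by lia), if_neg hb0, if_neg (by lia), LinearMap.zero_apply, sub_zero]
    obtain ⟨c, rfl⟩ : ∃ c : ℕ, b = c + 1 := ⟨(b - 1).toNat, by lia⟩
    cases k with
    | zero =>
      rw [Nat.cast_zero, expPoly_zero, annih_one, expPoly_of_neg η' (by lia), ite_self, sub_zero]
    | succ n =>
      have h0 : ((n : ℂ) + 1) ≠ 0 := Nat.cast_add_one_ne_zero n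
      refine smul_right_injective _ h0 ?_
      -- The recursion for `expPoly` replaces the identity `exp(-∑ t^n/n) = 1 - t`. The range is
      -- long enough to contain the indices `c` and `c - 1` selected below.
      have h1 := expPoly_succ_eq_sum η' n (n := n + c + 2) (by lia)
      have h2 := expPoly_succ_eq_sum η' (n - 1) (n := n + c + 2) (by lia)
      simp only [Int.cast_sub, Int.cast_natCast, Int.cast_one, sub_add_cancel] at h2
      simp only [Int.cast_natCast] at h1
      beta_reduce
      push_cast
      rw [← map_smul, h1, map_smul, map_sum]
      have h3 : ∀ i ∈ Finset.range (n + c + 2), annih η (c + 1)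
          (MvPolynomial.X i * expPoly η' (n - i)) = -(if (c : ℤ) + 1 = 1 then
            MvPolynomial.X i * expPoly η' (n - 1 - i) else 0) -
          η • ((if c = i then expPoly η' (n - i) else 0) -
            if c = i + 1 then expPoly η' (n - i - 1) else 0) := by
        intro i _
        rw [annih_X_mul, ih' _ _ (by lia), ih' _ _ (by lia), if_neg (by lia)]
        have e1 : ((c : ℤ) + 1 - (i + 1) = 0) ↔ c = i := by lia
        have e2 : ((c : ℤ) + 1 - (i + 1) = 1) ↔ c = i + 1 := by lia
        simp only [e1, e2]
        rw [zero_sub, mul_neg, mul_ite, mul_zero, sub_right_comm (n : ℤ)]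
      rw [Finset.sum_congr rfl h3, Finset.sum_sub_distrib, Finset.sum_neg_distrib,
        ← Finset.smul_sum, Finset.sum_sub_distrib, Finset.sum_ite_eq, if_pos (by simp; lia),
        if_neg (by lia)]
      -- For `c = 0`, the recursion gives `-n e_n` and `η'η = 1` gives `-e_n`, where `e_n` is
      -- `expPoly η' n`; they add up to `-(n + 1) e_n`. For `c > 0`, the deltas select `i = c` and
      -- `i = c - 1`, whose terms cancel.
      rcases Nat.eq_zero_or_pos c with rfl | hc
      · simp only [Nat.cast_zero, zero_add, if_true]
        rw [Finset.sum_eq_zero fun i _ => if_neg (by lia)]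
        rw [smul_sub, smul_neg, ← h2, smul_smul, h]
        simp only [add_sub_cancel_right, sub_zero]
        module
      · obtain ⟨c, rfl⟩ := Nat.exists_eq_succ_of_ne_zero hc.ne'
        simp only [Nat.succ_eq_add_one, add_left_inj]
        rw [Finset.sum_ite_eq, if_pos (by simp; lia), if_neg (by lia)]
        simp only [if_neg (show ¬ (((c + 1 : ℕ) : ℤ) + 1 = 1) by lia)]
        push_cast
        simp [sub_sub]

end VertexOsc

/-! ### The Heisenberg algebra and the equation `∂X_η = η :jX_η:`. -/

section Boson

theorem jMode_single (n l : ℤ) (p : Osc) : jMode n (Finsupp.single l p) =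
    Finsupp.single l ((if n = 0 then (Complex.I * l) • LinearMap.id else osc n) p) := by
  simp only [jMode, Finsupp.lsum_single, LinearMap.comp_apply, Finsupp.lsingle_apply]

theorem jMode_zero_single (l : ℤ) (p : Osc) :
    jMode 0 (Finsupp.single l p) = (Complex.I * l) • Finsupp.single l p := by
  rw [jMode_single, if_pos rfl, Finsupp.smul_single]
  rfl

theorem jMode_neg_single (i : ℕ) (l : ℤ) (p : Osc) : jMode (-((i : ℤ) + 1)) (Finsupp.single l p) =
    Finsupp.single l (MvPolynomial.X i * p) := by
  rw [jMode_single, if_neg (by lia), osc_neg_succ]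
  rfl

theorem jMode_pos_single (i : ℕ) (l : ℤ) (p : Osc) : jMode ((i : ℤ) + 1) (Finsupp.single l p) =
    Finsupp.single l (((i : ℂ) + 1) • MvPolynomial.pderiv i p) := by
  rw [jMode_single, if_neg (by lia), osc_succ]
  rfl

theorem int_cases (n : ℤ) : n = 0 ∨ (∃ i : ℕ, n = i + 1) ∨ ∃ i : ℕ, n = -((i : ℤ) + 1) := by
  rcases lt_trichotomy n 0 with h | h | h
  · exact Or.inr (Or.inr ⟨(-n - 1).toNat, by lia⟩)
  · exact Or.inl h
  · exact Or.inr (Or.inl ⟨(n - 1).toNat, by lia⟩)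

/-- The Fock space is generated from the highest weight vectors by the operators `j(-n)`. -/
theorem boson_induction {P : BosonFock → Prop} (hadd : ∀ x y, P x → P y → P (x + y))
    (hsmul : ∀ (a : ℂ) x, P x → P (a • x)) (hvac : ∀ l, P (Finsupp.single l 1))
    (hj : ∀ n x, P x → P (jMode n x)) (x : BosonFock) : P x := by
  induction x using Finsupp.induction_linear with
  | zero => simpa using hsmul 0 _ (hvac 0)
  | add x y hx hy => exact hadd x y hx hy
  | single l p =>
    induction p using MvPolynomial.induction_on with
    | C a =>
      have := hsmul a _ (hvac l)
      rwa [Finsupp.smul_single, MvPolynomial.smul_eq_C_mul, mul_one] at this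
    | add p q hp hq => rw [Finsupp.single_add]; exact hadd _ _ hp hq
    | mul_X p i hp => rw [mul_comm, ← jMode_neg_single]; exact hj _ _ hp

theorem jMode_comm (m n : ℤ) (x : BosonFock) : jMode m (jMode n x) =
    jMode n (jMode m x) + if m + n = 0 then (m : ℂ) • x else 0 := by
  induction x using Finsupp.induction_linear with
  | zero => simp
  | add x y hx hy =>
    simp only [map_add, hx, hy]
    split_ifs
    · rw [smul_add]; abel
    · abel
  | single l p =>
    rcases int_cases m with rfl | ⟨i, rfl⟩ | ⟨i, rfl⟩ <;>
    rcases int_cases n with rfl | ⟨k, rfl⟩ | ⟨k, rfl⟩ <;>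
    simp only [jMode_zero_single, jMode_neg_single, jMode_pos_single, map_smul]
    · simp
    · rw [if_neg (by lia), add_zero]
    · rw [if_neg (by lia), add_zero]
    · rw [if_neg (by lia), add_zero]
    · rw [if_neg (by lia), add_zero, Derivation.map_smul, Derivation.map_smul, pderiv_comm,
        smul_comm]
    · rw [Derivation.leibniz, MvPolynomial.pderiv_X, Pi.single_apply]
      by_cases hik : k = i
      · subst hik
        rw [if_pos rfl, if_pos (by lia), Finsupp.smul_single, ← Finsupp.single_add]
        congr 1
        push_cast
        simp
      · rw [if_neg hik, if_neg (by lia)]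
        simp
    · rw [if_neg (by lia), add_zero]
    · rw [Derivation.leibniz, MvPolynomial.pderiv_X, Pi.single_apply]
      by_cases hik : i = k
      · subst hik
        rw [if_pos rfl, if_pos (by lia), Finsupp.smul_single, ← Finsupp.single_add]
        congr 1
        push_cast
        simp only [smul_eq_mul, mul_one, smul_add, mul_smul_comm]
        module
      · rw [if_neg hik, if_neg (by lia)]
        simp
    · rw [if_neg (by lia), add_zero, mul_left_comm]

theorem coeff_jB (k : ℤ) (x : BosonFock) : coeff jB k x = jMode (-k - 1) x := rfl

/-- A nonzero central term needs `p + q = -2`; on one side of the splitting this forces `p = q =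
-1`, the mode `j(0)`, whose central term is zero. -/
theorem partsCommute_jB : PartsCommute jB jB := fun p q h x => by
  rw [coeff_jB, coeff_jB, coeff_jB, coeff_jB, jMode_comm]
  by_cases h' : -p - 1 + (-q - 1) = 0
  · have : p = -1 := by lia
    simp [this]
  · rw [if_neg h', add_zero]

theorem coeff_vertexB_single (e N l : ℤ) (p : Osc) : coeff (vertexB e) N (Finsupp.single l p) =
    Finsupp.single (l + e) (vertexOsc (Complex.I * e) (N + e * l) p) := by
  change Finsupp.lsum ℂ (fun l : ℤ => Finsupp.lsingle (l + e) ∘ₗ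
      vertexOsc (Complex.I * e) (N + e * l)) (Finsupp.single l p) = _
  simp only [Finsupp.lsum_single, LinearMap.comp_apply, Finsupp.lsingle_apply]

theorem coeff_vertexB_vac (e N l : ℤ) : coeff (vertexB e) N (Finsupp.single l 1) =
    Finsupp.single (l + e) (expPoly (Complex.I * e) (N + e * l)) := by
  rw [coeff_vertexB_single, vertexOsc_one]

theorem jMode_vertexB (n e N : ℤ) (x : BosonFock) : jMode n (coeff (vertexB e) N x) =
    coeff (vertexB e) N (jMode n x) + (Complex.I * e) • coeff (vertexB e) (N - n) x := by
  induction x using Finsupp.induction_linear with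
  | zero => simp
  | add x y hx hy => simp only [map_add, hx, hy, smul_add]; abel
  | single l p =>
    rw [coeff_vertexB_single, coeff_vertexB_single]
    rcases int_cases n with rfl | ⟨i, rfl⟩ | ⟨i, rfl⟩
    · rw [jMode_zero_single, jMode_zero_single, map_smul, coeff_vertexB_single, sub_zero,
        ← add_smul]
      push_cast
      ring_nf
    · have h0 : ((i : ℂ) + 1) ≠ 0 := Nat.cast_add_one_ne_zero i
      rw [jMode_pos_single, jMode_pos_single, coeff_vertexB_single, pderiv_vertexOsc, smul_add,
        smul_smul, mul_div_cancel₀ _ h0, Finsupp.single_add, map_smul, Finsupp.smul_single,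
        sub_add_eq_add_sub]
    · rw [jMode_neg_single, jMode_neg_single, coeff_vertexB_single, X_mul_vertexOsc,
        Finsupp.single_add, Finsupp.smul_single, sub_neg_eq_add, add_right_comm]

/-- Besides `η z^n :jX_η:`, the commutator of `j(n)` with `j(z)` contributes `n z^{n-1} X_η`, which
comes from the single exponent `p = n - 1`. -/
theorem jMode_diag_nopTerm (n e N : ℤ) (x : BosonFock) :
    jMode n (coeff (nop 1 jB (vertexB e)) N x) = coeff (nop 1 jB (vertexB e)) N (jMode n x) +
      (Complex.I * e) • coeff (nop 1 jB (vertexB e)) (N - n) x +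
        (n : ℂ) • coeff (vertexB e) (N - n + 1) x := by
  have hfin := fun (N : ℤ) x => (bddBelow₂_nopTerm 1 jB (vertexB e) x).finite_support N
  have h1 : ∀ p, jMode n (nopTerm 1 jB (vertexB e) x p (N - p)) =
      nopTerm 1 jB (vertexB e) (jMode n x) p (N - p) +
        (Complex.I * e) • nopTerm 1 jB (vertexB e) x p (N - n - p) +
        if p = n - 1 then (n : ℂ) • coeff (vertexB e) (N - n + 1) x else 0 := by
    intro p
    have e1 : (n + (-p - 1) = 0) ↔ p = n - 1 := by lia
    have e2 : p = n - 1 → N - p = N - n + 1 := by lia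
    simp only [nopTerm, coeff_jB, one_smul, ← sub_right_comm N p n]
    split_ifs with hp hpn hpn
    · rw [jMode_comm, if_pos (e1.mpr hpn), jMode_vertexB, map_add, map_smul, e2 hpn]
    · rw [jMode_comm, if_neg (mt e1.mp hpn), jMode_vertexB, map_add, map_smul]
    · rw [jMode_vertexB, jMode_comm, if_pos (e1.mpr hpn), map_add, map_smul, e2 hpn]
      abel
    · rw [jMode_vertexB, jMode_comm, if_neg (mt e1.mp hpn), add_zero, add_zero]
  have hsingle : (Function.support fun p : ℤ =>
      if p = n - 1 then (n : ℂ) • coeff (vertexB e) (N - n + 1) x else 0).Finite :=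
    finite_support_int (n - 1) (n - 1) fun p hp => if_neg (by lia)
  rw [coeff_nop, coeff_nop, coeff_nop, diag, diag, diag, map_finsum _ (hfin N x),
    finsum_congr h1, finsum_add_distrib _ hsingle, finsum_add_distrib (hfin N (jMode n x))
    (finite_support_smul _ (hfin (N - n) x)),
    smul_finsum' _ (hfin (N - n) x), finsum_eq_single _ (n - 1) fun p hp => if_neg hp, if_pos rfl]
  exact ((hfin N (jMode n x)).union (finite_support_smul _ (hfin (N - n) x))).subset (Function.support_add _ _)

/-- The equation holds on highest weight vectors by the recursion for `expPoly`, and both sides have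
the same commutators with all `j(n)`: differentiating `z^n X_η` yields the term `n z^{n-1} X_η`
found for `:jX_η:`. -/
theorem deriv_vertexB (e : ℤ) :
    deriv (vertexB e) = (Complex.I * e) • nop 1 jB (vertexB e) := by
  have key : ∀ (x : BosonFock) (N : ℤ), ((N : ℂ) + 1) • coeff (vertexB e) (N + 1) x =
      (Complex.I * e) • coeff (nop 1 jB (vertexB e)) N x := by
    intro x
    induction x using boson_induction with
    | hadd x y hx hy => intro N; simp only [map_add, smul_add, hx, hy]
    | hsmul a x hx =>
      intro N
      rw [map_smul, map_smul, smul_comm, hx, smul_comm]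
    | hj n x hx =>
      intro N
      have h1 := congrArg (jMode n) (hx N)
      rw [map_smul, map_smul, jMode_vertexB, jMode_diag_nopTerm] at h1
      have h2 := hx (N - n)
      rw [smul_add, smul_add, smul_add, ← h2, show N + 1 - n = N - n + 1 by ring] at h1
      rw [← sub_eq_zero] at h1 ⊢
      rw [← h1]
      push_cast
      module
    | hvac l =>
      intro N
      have hfin := (bddBelow₂_nopTerm 1 jB (vertexB e) (Finsupp.single l 1)).finite_support N
      have h1 : ∀ k : ℕ, nopTerm 1 jB (vertexB e) (Finsupp.single l 1) k (N - k) =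
          Finsupp.lsingle (R := ℂ) (l + e)
            (MvPolynomial.X k * expPoly (Complex.I * e) (N + e * l - k)) := by
        intro k
        rw [nopTerm, if_pos (by lia), coeff_jB, coeff_vertexB_vac,
          show -(k : ℤ) - 1 = -((k : ℤ) + 1) by ring, jMode_neg_single,
          show N - (k : ℤ) + e * l = N + e * l - k by ring]
        rfl
      have h2 : ∀ k : ℕ, k ≠ 0 →
          nopTerm 1 jB (vertexB e) (Finsupp.single l 1) (-k - 1) (N - (-k - 1)) = 0 := by
        intro k hk
        obtain ⟨i, rfl⟩ := Nat.exists_eq_succ_of_ne_zero hk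
        rw [nopTerm, if_neg (by lia), coeff_jB,
          show -(-((i + 1 : ℕ) : ℤ) - 1) - 1 = (i : ℤ) + 1 by push_cast; ring, jMode_pos_single]
        simp
      -- The exponent `-1` belongs to the zero mode `j(0) = il`; it accounts for the derivative of
      -- the factor `z^{ηα}`.
      have h3 : nopTerm 1 jB (vertexB e) (Finsupp.single l 1) (-(0 : ℕ) - 1)
          (N - (-(0 : ℕ) - 1)) = (Complex.I * l) • coeff (vertexB e) (N + 1)
            (Finsupp.single l 1) := by
        rw [nopTerm, if_neg (by lia), coeff_jB, one_smul, show -(-((0 : ℕ) : ℤ) - 1) - 1 = 0 by simp,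
          jMode_zero_single, map_smul, show N - (-((0 : ℕ) : ℤ) - 1) = N + 1 by simp]
      have hfin' : (Function.support fun k : ℕ =>
          (MvPolynomial.X k * expPoly (Complex.I * e) (N + e * l - k) : Osc)).Finite := by
        refine (Set.finite_Iic (N + e * l).toNat).subset fun k hk => ?_
        by_contra hc
        simp only [Set.mem_Iic, not_le] at hc
        exact hk (by beta_reduce; rw [expPoly_of_neg _ (by lia), mul_zero])
      have h4 := expPoly_succ (Complex.I * e) (N + e * l)
      rw [coeff_nop, diag, finsum_int hfin, finsum_congr h1, finsum_eq_single _ 0 h2, h3,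
        ← map_finsum _ hfin', smul_add,
        ← map_smul (Finsupp.lsingle (l + e)) (Complex.I * e), ← h4, coeff_vertexB_vac,
        show N + e * l + 1 = N + 1 + e * l by ring, smul_smul, Finsupp.lsingle_apply,
        Finsupp.smul_single, Finsupp.smul_single, ← Finsupp.single_add, ← add_smul]
      congr 2
      push_cast
      linear_combination (-(e : ℂ) * l) * Complex.I_sq
  refine field_ext fun N x => ?_
  rw [coeff_deriv, key, map_smul, Pi.smul_apply, LinearMap.smul_apply]

end Boson

theorem BddBelow₂.finite_support_shift {V : Type*} [AddCommGroup V] {f : ℤ → ℤ → V}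
    (hf : BddBelow₂ f) (N d : ℤ) : (Function.support fun p => f (p + d) (N - p)).Finite := by
  obtain ⟨M, hM⟩ := hf
  exact finite_support_int (M - d) (N - M) fun p hp => hM _ _ (by lia)

/-! ### Fields depending on a second variable `x`, regular at `x = w`. -/

section DiagonalFamilies

variable {V : Type*} [AddCommGroup V] [Module ℂ V]

/-- The fields `Y p` are the coefficients with respect to `x` of a field in `x` and `w` that is
regular on the diagonal, where it restricts to the field `Z`. -/
def IsDiag (Y : ℤ → VertexOperator ℂ V) (Z : VertexOperator ℂ V) : Prop :=
  ∀ v, BddBelow₂ (fun p q => coeff (Y p) q v) ∧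
    ∀ N, diag (fun p q => coeff (Y p) q v) N = coeff Z N v

/-- Only finitely many annihilation modes of `A` act nontrivially on `v`, so one bound serves all
three exponents. This permits the interchange of sums in `IsDiag.nop`. -/
theorem exists_bound_nopTerm (A : VertexOperator ℂ V) {Y : ℤ → VertexOperator ℂ V}
    (hY : ∀ v, BddBelow₂ (fun p q => coeff (Y p) q v)) (v : V) :
    ∃ M : ℤ, ∀ p r q, (p < M ∨ r < M ∨ q < M) → nopTerm 1 A (Y p) v r q = 0 := by
  obtain ⟨m, hm⟩ := hY v
  obtain ⟨a, ha⟩ := bounded_coeff A v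
  choose g hg using fun r : ℤ => hY (coeff A r v)
  beta_reduce at hm hg
  obtain ⟨M, hM⟩ := ((Set.finite_Ico a 0).image g).bddBelow
  refine ⟨min (min m a) (min M 0), fun p r q h => ?_⟩
  rw [nopTerm]
  split_ifs with hr
  · rw [hm p q (by lia), map_zero]
  · by_cases hr' : r < a
    · rw [ha r hr', map_zero, smul_zero]
    · have := hM ⟨r, ⟨by lia, by lia⟩, rfl⟩
      rw [hg r p q (by lia), smul_zero]

theorem IsDiag.nop {Y : ℤ → VertexOperator ℂ V} {Z : VertexOperator ℂ V} (h : IsDiag Y Z)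
    (A : VertexOperator ℂ V) : IsDiag (fun p => nop 1 A (Y p)) (nop 1 A Z) := by
  intro v
  obtain ⟨M, hM⟩ := exists_bound_nopTerm A (fun v => (h v).1) v
  constructor
  · refine ⟨min M (M + M), fun p q hpq => ?_⟩
    beta_reduce
    rw [coeff_nop, diag, ← finsum_zero (α := ℤ)]
    exact finsum_congr fun r => hM _ _ _ (by lia)
  · intro N
    simp only [coeff_nop, diag]
    rw [finsum_comm_of_finite]
    · refine finsum_congr fun r => ?_
      rw [nopTerm]
      have e : ∀ p, N - p - r = N - r - p := fun p => sub_right_comm N p r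
      split_ifs with hr
      · rw [← (h v).2, diag, map_finsum _ ((h v).1.finite_support _)]
        refine finsum_congr fun p => ?_
        rw [nopTerm, if_pos hr, e]
      · rw [← (h _).2, diag, one_smul]
        refine finsum_congr fun p => ?_
        rw [nopTerm, if_neg hr, e, one_smul]
    · exact finite_support_of_bounds (F := fun p r => nopTerm 1 A (Y p) v r (N - p - r))
        M (N - M - M) M (N - M - M) fun p r hpr => hM _ _ _ (by lia)

theorem IsDiag.smul {Y : ℤ → VertexOperator ℂ V} {Z : VertexOperator ℂ V} (h : IsDiag Y Z)
    (a : ℂ) : IsDiag (fun p => a • Y p) (a • Z) := by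
  intro v
  have e : (fun p q => coeff (a • Y p) q v) = a • fun p q => coeff (Y p) q v := by
    ext p q
    rw [map_smul]
    rfl
  rw [e, diag_smul (h v).1]
  exact ⟨(h v).1.smul a, fun N => by rw [Pi.smul_apply, (h v).2, map_smul]; rfl⟩

theorem IsDiag.sum {ι : Type*} (s : Finset ι) {Y : ι → ℤ → VertexOperator ℂ V}
    {Z : ι → VertexOperator ℂ V} (h : ∀ i, IsDiag (Y i) (Z i)) :
    IsDiag (fun p => ∑ i ∈ s, Y i p) (∑ i ∈ s, Z i) := by
  intro v
  have e : (fun p q => coeff (∑ i ∈ s, Y i p) q v) =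
      ∑ i ∈ s, fun p q => coeff (Y i p) q v := by
    ext p q
    simp only [map_sum, Finset.sum_apply, LinearMap.sum_apply]
  obtain ⟨h1, h2⟩ := diag_sum s (fun i p q => coeff (Y i p) q v) fun i _ => (h i v).1
  rw [e, h2]
  refine ⟨h1, fun N => ?_⟩
  simp only [map_sum, Finset.sum_apply, LinearMap.sum_apply, (h _ v).2]

/-- Used with `Y` the coefficients of `E(x, w)` and `Z` the identity field, to restrict
`:P_m(j(w))E(x, w):` to `:P_m(j):`. -/
theorem IsDiag.noEval {Y : ℤ → VertexOperator ℂ V} {Z : VertexOperator ℂ V} (h : IsDiag Y Z)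
    (P : MvPolynomial ℕ ℂ) (A : VertexOperator ℂ V) :
    IsDiag (fun p => noEval P A (Y p)) (noEval P A Z) := by
  refine IsDiag.sum _ fun m => IsDiag.smul ?_ _
  generalize (Finsupp.toMultiset m).sort.map (fun k => iterD k A) = L
  induction L with
  | nil => exact h
  | cons B L ih => exact ih.nop B

theorem iterD_apply_eq_dw_pow (Y : ℤ → VertexOperator ℂ V) (v : V) (n : ℕ) :
    (fun p q => coeff (iterD n (Y p)) q v) = (dw ^ n) fun p q => coeff (Y p) q v := by
  induction n with
  | zero => rfl
  | succ n ih =>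
    rw [pow_succ', Module.End.mul_apply, ← ih]
    ext p q
    rw [iterD_succ, coeff_deriv, dw_apply]

end DiagonalFamilies

/-! ### The regular quotient `E(x, w) = X_i(x)X_{-i}(w)/(x - w)`. -/

section VertexProduct

theorem finsum_nat_succ {M : Type*} [AddCommMonoid M] {f : ℕ → M}
    (hf : (Function.support f).Finite) : ∑ᶠ k, f k = f 0 + ∑ᶠ k, f (k + 1) := by
  obtain ⟨N, hN⟩ := hf.bddAbove
  rw [finsum_eq_sum_of_support_subset (s := Finset.range (N + 2)),
    finsum_eq_sum_of_support_subset (s := Finset.range (N + 1)), Finset.sum_range_succ', add_comm]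
  · intro k hk
    have := hN (show k + 1 ∈ Function.support f from hk)
    simp only [Finset.coe_range, Set.mem_Iio]
    lia
  · intro k hk
    have := hN hk
    simp only [Finset.coe_range, Set.mem_Iio]
    lia

/-- Coefficientwise `exp(a)exp(-a) = 1`. By the chain rule the derivative of this product is the sum
of two opposite terms, so coefficients of positive degree vanish. -/
theorem expPoly_mul_inv (η : ℂ) (N : ℤ) :
    ∑ᶠ a : ℤ, expPoly η a * expPoly (-η) (N - a) = if N = 0 then 1 else 0 := by
  let f : ℤ → ℤ → Osc := fun p q => expPoly η p * expPoly (-η) q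
  have hf : BddBelow₂ f := ⟨0, fun p q h => by
    rcases h with h | h
    · simp only [f, expPoly_of_neg η h, zero_mul]
    · simp only [f, expPoly_of_neg (-η) h, mul_zero]⟩
  change diag f N = _
  split_ifs with hN
  · subst hN
    rw [diag, finsum_eq_single _ 0]
    · simp only [f, sub_zero, expPoly_zero, mul_one]
    · intro p hp
      rcases lt_or_ge p 0 with h | h
      · simp only [f, expPoly_of_neg η h, zero_mul]
      · simp only [f, expPoly_of_neg (-η) (show 0 - p < 0 by lia), mul_zero]
  · rcases lt_or_ge N 0 with hN' | hN'
    · rw [diag, ← finsum_zero (α := ℤ)]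
      refine finsum_congr fun p => ?_
      rcases lt_or_ge p 0 with h | h
      · simp only [f, expPoly_of_neg η h, zero_mul]
      · simp only [f, expPoly_of_neg (-η) (show N - p < 0 by lia), mul_zero]
    · obtain ⟨n, rfl⟩ : ∃ n : ℕ, N = n + 1 := ⟨(N - 1).toNat, by lia⟩
      let g : ℕ → ℤ → ℤ → Osc := fun i p q => MvPolynomial.X i * f (p - i) q
      let h : ℕ → ℤ → ℤ → Osc := fun i p q => MvPolynomial.X i * f p (q - i)
      have hg : ∀ i, BddBelow₂ (g i) := fun i => hf.imp fun M hM p q hpq => by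
        simp only [g, hM (p - i) q (by lia), mul_zero]
      have hh : ∀ i, BddBelow₂ (h i) := fun i => hf.imp fun M hM p q hpq => by
        simp only [h, hM p (q - i) (by lia), mul_zero]
      have hgd : ∀ i, diag (g i) n = MvPolynomial.X i * diag f (n - i) := fun i => by
        rw [diag, sub_eq_add_neg, ← diag_shift, mul_finsum']
        · rfl
        · exact hf.finite_support_shift n (-i)
      have hhd : ∀ i, diag (h i) n = MvPolynomial.X i * diag f (n - i) := fun i => by
        rw [diag, diag, mul_finsum' _ _ (hf.finite_support _)]
        exact finsum_congr fun p => by simp only [h, sub_right_comm]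
      have h1 : diag (dx f) n = η • ∑ i ∈ Finset.range (n + 1), diag (g i) n := by
        rw [← Finset.sum_apply, ← (diag_sum _ g fun i _ => hg i).2, ← Pi.smul_apply,
          ← diag_smul (diag_sum _ g fun i _ => hg i).1]
        refine finsum_congr fun p => ?_
        rw [Pi.smul_apply, Pi.smul_apply, Finset.sum_apply, Finset.sum_apply]
        rcases lt_or_ge (n : ℤ) p with hp | hp
        · simp [g, f, dx_apply, expPoly_of_neg (-η) (show n - p < 0 by lia)]
        · rw [dx_apply, ← smul_mul_assoc, expPoly_succ_eq_sum η p (n := n + 1) (by lia),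
            smul_mul_assoc, Finset.sum_mul]
          simp only [g, f, mul_assoc]
      have h2 : diag (dw f) n = -η • ∑ i ∈ Finset.range (n + 1), diag (h i) n := by
        rw [← Finset.sum_apply, ← (diag_sum _ h fun i _ => hh i).2, ← Pi.smul_apply,
          ← diag_smul (diag_sum _ h fun i _ => hh i).1]
        refine finsum_congr fun p => ?_
        rw [Pi.smul_apply, Pi.smul_apply, Finset.sum_apply, Finset.sum_apply]
        rcases lt_or_ge p 0 with hp | hp
        · simp [h, f, dw_apply, expPoly_of_neg η hp]
        · rw [dw_apply, ← mul_smul_comm, expPoly_succ_eq_sum (-η) (n - p) (n := n + 1) (by lia),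
            mul_smul_comm, Finset.mul_sum]
          simp only [h, f, mul_left_comm]
      rw [Finset.sum_congr rfl fun i _ => hgd i] at h1
      rw [Finset.sum_congr rfl fun i _ => hhd i] at h2
      have h0 : ((n : ℂ) + 1) ≠ 0 := Nat.cast_add_one_ne_zero n
      have h3 := diag_succ hf n
      rw [h1, h2, neg_smul, add_neg_cancel, Int.cast_natCast] at h3
      exact (smul_eq_zero.mp h3).resolve_left h0

/-- The two terms are those of the contraction factor `1 - w/x`. -/
theorem vertexOsc_expPoly {η η' : ℂ} (h : η' * η = 1) (M k : ℤ) : vertexOsc η M (expPoly η' k) =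
    expPoly η M * expPoly η' k - expPoly η (M + 1) * expPoly η' (k - 1) := by
  rw [vertexOsc_apply, finsum_eq_sum_of_support_subset (s := {0, 1})]
  · rw [Finset.sum_pair (by lia)]
    simp [annih_expPoly h, sub_eq_add_neg]
  · intro b hb
    by_contra hc
    simp only [Finset.coe_pair, Set.mem_insert_iff, Set.mem_singleton_iff, not_or] at hc
    exact hb (by beta_reduce; rw [annih_expPoly h, if_neg hc.1, if_neg hc.2, sub_zero, mul_zero])

/-- The product `X_i(x) X_{-i}(w)`. -/
def vprod (x : BosonFock) (p q : ℤ) : BosonFock :=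
  coeff (vertexB 1) p (coeff (vertexB (-1)) q x)

theorem vprod_vac (l p q : ℤ) : vprod (Finsupp.single l 1) p q =
    Finsupp.single l (expPoly Complex.I (p - 1 + l) * expPoly (-Complex.I) (q - l) -
      expPoly Complex.I (p + l) * expPoly (-Complex.I) (q - 1 - l)) := by
  have h : -Complex.I * Complex.I = 1 := by simp
  rw [vprod, coeff_vertexB_vac, coeff_vertexB_single]
  push_cast
  rw [mul_neg_one, mul_one, vertexOsc_expPoly h]
  congr 4
  all_goals (try ring_nf)

theorem vprod_swap_vac (l p q : ℤ) :
    coeff (vertexB (-1)) q (coeff (vertexB 1) p (Finsupp.single l 1)) =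
      -vprod (Finsupp.single l 1) p q := by
  have h : Complex.I * -Complex.I = 1 := by simp
  rw [vprod_vac, coeff_vertexB_vac, coeff_vertexB_single, ← Finsupp.single_neg]
  push_cast
  rw [mul_neg_one, mul_one, vertexOsc_expPoly h, neg_sub, mul_comm (expPoly Complex.I _),
    mul_comm (expPoly Complex.I _)]
  congr 4
  all_goals (try ring_nf)

theorem jMode_vprod (n p q : ℤ) (x : BosonFock) : jMode n (vprod x p q) =
    vprod (jMode n x) p q + Complex.I • (vprod x (p - n) q - vprod x p (q - n)) := by
  rw [vprod, jMode_vertexB, jMode_vertexB, map_add, map_smul]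
  simp only [vprod]
  push_cast
  module

/-- Both orders are `±(x - w)E` on highest weight vectors, and their commutators with the `j(n)`
have the same form. There is no delta function term, as the operator product has no pole. -/
theorem vprod_swap (p q : ℤ) (x : BosonFock) :
    coeff (vertexB (-1)) q (coeff (vertexB 1) p x) = -vprod x p q := by
  induction x using boson_induction generalizing p q with
  | hadd x y hx hy => simp only [vprod, map_add, hx, hy] at *; abel
  | hsmul a x hx => simp only [vprod, map_smul, hx] at *; rw [smul_neg]
  | hvac l => exact vprod_swap_vac l p q
  | hj n x hx =>
    have h1 := congrArg (jMode n) (hx p q)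
    rw [jMode_vertexB, jMode_vertexB, map_neg, jMode_vprod, map_add, map_smul, hx, hx] at h1
    rw [← sub_eq_zero] at h1 ⊢
    rw [← h1]
    push_cast
    module

theorem vquot_aux (p q : ℤ) (x : BosonFock) : (Function.support fun k : ℕ =>
    (coeff (vertexB 1) (p + 1 + k) * coeff (vertexB (-1)) (q - k)) x).Finite := by
  obtain ⟨m, hm⟩ := bounded_coeff (vertexB (-1)) x
  refine (Set.finite_Iic (q - m).toNat).subset fun k hk => ?_
  by_contra h
  simp only [Set.mem_Iic, not_le] at h
  exact hk (by beta_reduce; rw [Module.End.mul_apply, hm (q - k) (by lia), map_zero])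

theorem vquot_bdd (x : BosonFock) : ∃ m : ℤ, ∀ p, ∀ q < m, locSum _ (vquot_aux p q) x = 0 := by
  obtain ⟨m, hm⟩ := bounded_coeff (vertexB (-1)) x
  refine ⟨m, fun p q hq => ?_⟩
  rw [locSum_apply, ← finsum_zero (α := ℕ)]
  exact finsum_congr fun k => by rw [Module.End.mul_apply, hm (q - k) (by lia), map_zero]

/-- The coefficients of `x^p` in `X_i(x) X_{-i}(w) / (x - w)`. -/
def vquot (p : ℤ) : VertexOperator ℂ BosonFock :=
  mkField (fun q => locSum _ (vquot_aux p q)) fun x => (vquot_bdd x).imp fun _ hm => hm p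

/-- The series `X_i(x) X_{-i}(w) / (x - w)`. -/
def vquotSeries (x : BosonFock) (p q : ℤ) : BosonFock := coeff (vquot p) q x

theorem vquotSeries_eq (x : BosonFock) (p q : ℤ) :
    vquotSeries x p q = ∑ᶠ k : ℕ, vprod x (p + 1 + k) (q - k) := rfl

theorem vquotSeries_bdd (x : BosonFock) : ∃ m : ℤ, ∀ p q, q < m → vquotSeries x p q = 0 :=
  vquot_bdd x

/-- The defining sum expands `1/(x - w)` in powers of `w/x`; multiplication by `x - w` makes it
telescope. -/
theorem mulSub_vquotSeries (x : BosonFock) : mulSub (vquotSeries x) = vprod x := by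
  ext1 p
  ext1 q
  have h : ∑ᶠ k : ℕ, vprod x (p - 1 + 1 + (k + 1 : ℕ)) (q - (k + 1 : ℕ)) =
      ∑ᶠ k : ℕ, vprod x (p + 1 + k) (q - 1 - k) :=
    finsum_congr fun k => by
      push_cast
      congr 1 <;> ring
  rw [mulSub_apply, vquotSeries_eq, vquotSeries_eq,
    finsum_nat_succ (f := fun k : ℕ => vprod x (p - 1 + 1 + k) (q - k)) (vquot_aux (p - 1) q x), h,
    add_sub_cancel_right]
  simp

theorem eq_vquotSeries_of_mulSub {x : BosonFock} {f : ℤ → ℤ → BosonFock} (M : ℤ)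
    (hM : ∀ p q, q < M → f p q = 0) (h : mulSub f = vprod x) : vquotSeries x = f := by
  obtain ⟨m, hm⟩ := vquotSeries_bdd x
  rw [← sub_eq_zero]
  refine eq_zero_of_mulSub_eq_zero (min m M) (fun p q hq => ?_) ?_
  · rw [Pi.sub_apply, Pi.sub_apply, hm p q (by lia), hM p q (by lia), sub_zero]
  · rw [map_sub, mulSub_vquotSeries, h, sub_self]

theorem vquotSeries_vac (l p q : ℤ) : vquotSeries (Finsupp.single l 1) p q =
    Finsupp.single l (expPoly Complex.I (p + l) * expPoly (-Complex.I) (q - l)) := by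
  refine congr_fun (congr_fun (eq_vquotSeries_of_mulSub (f := fun p q =>
    Finsupp.single l (expPoly Complex.I (p + l) * expPoly (-Complex.I) (q - l))) l ?_ ?_) p) q
  · intro p q hq
    simp only [expPoly_of_neg (-Complex.I) (show q - l < 0 by lia), mul_zero, Finsupp.single_zero]
  · ext1 p
    ext1 q
    rw [vprod_vac, mulSub_apply, Finsupp.single_sub]

/-- The commutator of `j(n)` with `X_i(x)X_{-i}(w)` is `i(x^n - w^n)` times the product. Division by
`x - w` is unique among series with exponents of `w` bounded below, so it passes to the quotient. -/
theorem vquotSeries_jMode (n : ℤ) (x : BosonFock) (p q : ℤ) :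
    vquotSeries (jMode n x) p q = jMode n (vquotSeries x p q) -
      Complex.I • (vquotSeries x (p - n) q - vquotSeries x p (q - n)) := by
  refine congr_fun (congr_fun (eq_vquotSeries_of_mulSub (f := fun p q =>
    jMode n (vquotSeries x p q) -
      Complex.I • (vquotSeries x (p - n) q - vquotSeries x p (q - n))) ?_ ?_ ?_) p) q
  · exact min (vquotSeries_bdd x).choose ((vquotSeries_bdd x).choose + n)
  · intro p q hq
    have h := (vquotSeries_bdd x).choose_spec
    simp only [h p q (by lia), h (p - n) q (by lia), h p (q - n) (by lia), map_zero, sub_zero,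
      smul_zero]
  · have h : ∀ p q, vquotSeries x (p - 1) q - vquotSeries x p (q - 1) = vprod x p q := fun p q =>
      congr_fun (congr_fun (mulSub_vquotSeries x) p) q
    ext1 p
    ext1 q
    have h1 := jMode_vprod n p q x
    rw [← h p q, ← h (p - n) q, ← h p (q - n), map_sub] at h1
    rw [mulSub_apply, eq_sub_of_add_eq h1.symm, sub_right_comm p 1 n, sub_right_comm q 1 n]
    module

/-- This is the regularity of `E`: the expansion in `w/x` alone does not bound the exponents of `x`.
It is visible in the explicit product on highest weight vectors and is preserved by the `j(n)`. -/
theorem bddBelow₂_vquotSeries (x : BosonFock) : BddBelow₂ (vquotSeries x) := by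
  induction x using boson_induction with
  | hadd x y hx hy =>
    have : vquotSeries (x + y) = vquotSeries x + vquotSeries y := by
      ext1 p; ext1 q; exact map_add _ _ _
    rw [this]
    exact hx.add hy
  | hsmul a x hx =>
    have : vquotSeries (a • x) = a • vquotSeries x := by
      ext1 p; ext1 q; exact map_smul _ _ _
    rw [this]
    exact hx.smul a
  | hvac l =>
    refine ⟨min l (-l), fun p q h => ?_⟩
    rw [vquotSeries_vac]
    by_cases hp : p + l < 0
    · rw [expPoly_of_neg _ hp, zero_mul, Finsupp.single_zero]
    · rw [expPoly_of_neg (-Complex.I) (show q - l < 0 by lia), mul_zero, Finsupp.single_zero]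
  | hj n x hx =>
    obtain ⟨M, hM⟩ := hx
    refine ⟨min M (M + n), fun p q h => ?_⟩
    rw [vquotSeries_jMode, hM p q (by lia), hM (p - n) q (by lia), hM p (q - n) (by lia)]
    simp

/-- On highest weight vectors this is `exp(a)exp(-a) = 1`; the correction `i(x^n - w^n)E` in the
commutator with `j(n)` vanishes on the diagonal. -/
theorem diag_vquotSeries (x : BosonFock) (N : ℤ) :
    diag (vquotSeries x) N = if N = 0 then x else 0 := by
  induction x using boson_induction generalizing N with
  | hadd x y hx hy =>
    have : vquotSeries (x + y) = vquotSeries x + vquotSeries y := by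
      ext1 p; ext1 q; exact map_add _ _ _
    rw [this, diag_add (bddBelow₂_vquotSeries x) (bddBelow₂_vquotSeries y), Pi.add_apply, hx, hy]
    split_ifs <;> simp
  | hsmul a x hx =>
    have : vquotSeries (a • x) = a • vquotSeries x := by
      ext1 p; ext1 q; exact map_smul _ _ _
    rw [this, diag_smul (bddBelow₂_vquotSeries x), Pi.smul_apply, hx]
    split_ifs <;> simp
  | hvac l =>
    have h1 : ∀ p, vquotSeries (Finsupp.single l 1) p (N - p) = Finsupp.lsingle (R := ℂ) l
        (expPoly Complex.I (p + l) * expPoly (-Complex.I) (N - (p + l))) := fun p => by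
      rw [vquotSeries_vac, sub_sub]
      rfl
    have h2 := expPoly_mul_inv Complex.I N
    rw [← finsum_comp_equiv (Equiv.addRight l)] at h2
    have h3 : (Function.support fun p : ℤ =>
        expPoly Complex.I (p + l) * expPoly (-Complex.I) (N - (p + l))).Finite := by
      refine finite_support_int (-l) (N - l) fun p hp => ?_
      rcases hp with hp | hp
      · rw [expPoly_of_neg _ (by lia), zero_mul]
      · rw [expPoly_of_neg (-Complex.I) (by lia), mul_zero]
    rw [diag, finsum_congr h1, ← map_finsum _ h3]
    refine (congrArg _ h2).trans ?_
    split_ifs <;> simp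
  | hj n x hx =>
    have h1 : ∀ p, vquotSeries (jMode n x) p (N - p) = jMode n (vquotSeries x p (N - p)) -
      Complex.I • (vquotSeries x (p - n) (N - p) - vquotSeries x p (N - n - p)) := fun p => by
        rw [vquotSeries_jMode, sub_right_comm N p n]
    have hb := bddBelow₂_vquotSeries x
    have hf2 : (Function.support fun p => vquotSeries x (p - n) (N - p)).Finite :=
      hb.finite_support_shift N (-n)
    have e1 : ∑ᶠ p, vquotSeries x (p - n) (N - p) = diag (vquotSeries x) (N - n) :=
      diag_shift _ N (-n)
    have e2 : ∑ᶠ p, vquotSeries x p (N - n - p) = diag (vquotSeries x) (N - n) := rfl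
    have hf3 : (Function.support fun p =>
        vquotSeries x (p - n) (N - p) - vquotSeries x p (N - n - p)).Finite :=
      (hf2.union (hb.finite_support (N - n))).subset (Function.support_sub _ _)
    rw [diag, finsum_congr h1, finsum_sub_distrib _ (finite_support_smul _ hf3),
      ← smul_finsum' _ hf3, finsum_sub_distrib hf2 (hb.finite_support (N - n)), e1, e2, sub_self,
      smul_zero, sub_zero, ← map_finsum _ (hb.finite_support N)]
    · refine (congrArg _ (hx N)).trans ?_
      split_ifs <;> simp
    · exact (hb.finite_support N).subset (Function.support_comp_subset (map_zero _) _)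

theorem isDiag_vquot : IsDiag vquot idField := fun x =>
  ⟨bddBelow₂_vquotSeries x, fun N => by rw [coeff_idField]; exact diag_vquotSeries x N⟩

/-- It suffices to check the equation after multiplication by `x - w`, where it follows from
`∂X_{-i} = -i :jX_{-i}:`. -/
theorem deriv_vquot (p : ℤ) : deriv (vquot p) = -Complex.I • nop 1 jB (vquot p) := by
  suffices h : ∀ x, (fun p q : ℤ => ((q : ℂ) + 1) • vquotSeries x p (q + 1) +
      Complex.I • coeff (nop 1 jB (vquot p)) q x) = 0 by
    refine field_ext fun q x => ?_
    rw [coeff_deriv, map_smul, Pi.smul_apply, LinearMap.smul_apply, neg_smul,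
      ← add_eq_zero_iff_eq_neg]
    exact congr_fun (congr_fun (h x) p) q
  clear p
  intro x
  have hE : ∀ p q, vprod x p q = vquotSeries x (p - 1) q - vquotSeries x p (q - 1) := fun p q =>
    (congr_fun (congr_fun (mulSub_vquotSeries x) p) q).symm
  have hd : ∀ q : ℤ, coeff (nop 1 jB (vertexB (-1))) q x =
      Complex.I • ((q : ℂ) + 1) • coeff (vertexB (-1)) (q + 1) x := fun q => by
    rw [← coeff_deriv, deriv_vertexB, map_smul, Pi.smul_apply, LinearMap.smul_apply, smul_smul]
    push_cast
    rw [mul_neg_one, mul_neg, Complex.I_mul_I, neg_neg, one_smul]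
  -- Moving the creation part of `j(w)` past `X_i(x)` costs `i/(x - w)` times `X_i(x)`. This
  -- produces the summand `iE`, which matches the `E` in `(x - w)∂_w E = ∂_w((x - w)E) + E`.
  have hS : ∀ p q : ℤ, coeff (nop 1 jB (vquot (p - 1))) q x - coeff (nop 1 jB (vquot p)) (q - 1) x =
      Complex.I • (((q : ℂ) + 1) • vprod x p (q + 1) + vquotSeries x p q) := by
    intro p q
    have h1 : ∀ r, nopTerm 1 jB (vquot (p - 1)) x r (q - r) -
        nopTerm 1 jB (vquot p) x r (q - 1 - r) =
        coeff (vertexB 1) p (nopTerm 1 jB (vertexB (-1)) x r (q - r)) +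
          Complex.I • if 0 ≤ r then vprod x (p + 1 + r) (q - r) else 0 := by
      intro r
      have h0 : ∀ y s, coeff (vquot (p - 1)) s y - coeff (vquot p) (s - 1) y =
          coeff (vertexB 1) p (coeff (vertexB (-1)) s y) := fun y s =>
        congr_fun (congr_fun (mulSub_vquotSeries y) p) s
      simp only [nopTerm, coeff_jB, sub_right_comm q 1 r, one_smul]
      split_ifs with hr
      · rw [← map_sub, h0, jMode_vertexB, vprod, show p - (-r - 1) = p + 1 + r by ring]
        push_cast
        rw [mul_one]
      · rw [h0, smul_zero, add_zero]
    have hf1 := (bddBelow₂_nopTerm 1 jB (vquot (p - 1)) x).finite_support q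
    have hf2 := (bddBelow₂_nopTerm 1 jB (vquot p) x).finite_support (q - 1)
    have hf3 := (bddBelow₂_nopTerm 1 jB (vertexB (-1)) x).finite_support q
    have hf3' : (Function.support fun r =>
        coeff (vertexB 1) p (nopTerm 1 jB (vertexB (-1)) x r (q - r))).Finite :=
      hf3.subset (Function.support_comp_subset (map_zero _) _)
    have hf4 : (Function.support fun r : ℤ =>
        if 0 ≤ r then vprod x (p + 1 + r) (q - r) else 0).Finite := by
      obtain ⟨m, hm⟩ := bounded_coeff (vertexB (-1)) x
      refine finite_support_int 0 (q - m) fun r hr => ?_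
      split_ifs with h
      · rw [vprod, hm _ (by lia), map_zero]
      · rfl
    have h2 : ∑ᶠ r : ℤ, (if 0 ≤ r then vprod x (p + 1 + r) (q - r) else 0) =
        vquotSeries x p q := by
      have h3 : ∀ k : ℕ, (if 0 ≤ -(k : ℤ) - 1 then
        vprod x (p + 1 + (-(k : ℤ) - 1)) (q - (-(k : ℤ) - 1)) else 0) = 0 := fun k =>
          if_neg (by lia)
      rw [finsum_int hf4, finsum_congr h3, finsum_zero, add_zero, vquotSeries_eq]
      exact finsum_congr fun k => if_pos (by lia)
    rw [coeff_nop, coeff_nop, diag, diag, ← finsum_sub_distrib hf1 hf2, finsum_congr h1,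
      finsum_add_distrib hf3' (finite_support_smul _ hf4), ← map_finsum _ hf3, ← smul_finsum' _ hf4, h2]
    have h3 := hd q
    rw [coeff_nop, diag] at h3
    rw [h3, map_smul, map_smul, smul_add]
    rfl
  obtain ⟨m, hm⟩ := vquotSeries_bdd x
  obtain ⟨M, hM⟩ := ((isDiag_vquot.nop jB) x).1
  beta_reduce at hM
  refine eq_zero_of_mulSub_eq_zero (min (m - 1) M) (fun p q hq => ?_) ?_
  · rw [hm p (q + 1) (by lia), hM p q (by lia), smul_zero, smul_zero, add_zero]
  · ext1 p
    ext1 q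
    have h1 := hS p q
    rw [sub_eq_iff_eq_add] at h1
    rw [mulSub_apply, h1, hE, sub_add_cancel, add_sub_cancel_right, smul_add, smul_smul,
      Complex.I_mul_I]
    push_cast
    rw [sub_add_cancel]
    change _ = (0 : BosonFock)
    module

theorem diag_dw_pow_vquotSeries (m : ℕ) (x : BosonFock) (N : ℤ) :
    diag ((dw ^ m) (vquotSeries x)) N = coeff (noEval (expQuot m) jB idField) N x := by
  rw [← (isDiag_vquot.noEval (expQuot m) jB x).2 N, show vquotSeries x = fun p q =>
    coeff (vquot p) q x from rfl, ← iterD_apply_eq_dw_pow]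
  simp only [iterD_eq_noEval partsCommute_jB _ (deriv_vquot _)]

end VertexProduct

/-! ### The anticommutation relations and the contraction of `c(x)` with `∂b(w)`. -/

section Fermions

theorem contract_wedge (a a' : ℕ ⊕ ℕ) (u : BCFock) : contract a (wedge a' u) =
    (if a = a' then u else 0) - wedge a' (contract a u) := by
  refine (CliffordAlgebra.contractLeft_ι_mul _ _ _).trans ?_
  rw [Finsupp.lapply_apply, Finsupp.single_apply, ite_smul, one_smul, zero_smul]
  simp only [eq_comm (a := a')]
  rfl

theorem wedge_wedge (a a' : ℕ ⊕ ℕ) (u : BCFock) : wedge a (wedge a' u) = -wedge a' (wedge a u) := by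
  simp only [wedge, LinearMap.mulLeft_apply]
  rw [← mul_assoc, ← mul_assoc, ← neg_mul, eq_neg_of_add_eq_zero_left
    (ExteriorAlgebra.ι_add_mul_swap (R := ℂ) (Finsupp.single a (1 : ℂ)) (Finsupp.single a' 1))]

theorem contract_contract (a a' : ℕ ⊕ ℕ) (u : BCFock) :
    contract a (contract a' u) = -contract a' (contract a u) :=
  CliffordAlgebra.contractLeft_comm _ _ _

theorem cMode_bMode (m n : ℤ) (u : BCFock) : cMode m (bMode n u) =
    (if m + n = 0 then u else 0) - bMode n (cMode m u) := by
  unfold cMode bMode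
  split_ifs with hm hn h hn h h
  all_goals first
    | lia
    | rw [wedge_wedge, zero_sub]
    | rw [contract_contract, zero_sub]
    | skip
  · rw [eq_sub_iff_add_eq, add_comm, ← eq_sub_iff_add_eq, contract_wedge, if_pos]
    congr 1
    lia
  · rw [eq_sub_iff_add_eq, add_comm, ← eq_sub_iff_add_eq, contract_wedge, if_neg]
    intro h'
    have := Sum.inr_injective h'
    lia
  · rw [contract_wedge, if_pos]
    congr 1
    lia
  · rw [contract_wedge, if_neg]
    intro h'
    have := Sum.inl_injective h'
    lia

theorem coeff_cF_deriv_bF (p q : ℤ) (u : BCFock) : coeff cF p (coeff (deriv bF) q u) =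
    (if p + q = -2 then ((q : ℂ) + 1) • u else 0) - coeff (deriv bF) q (coeff cF p u) := by
  rw [coeff_deriv, coeff_deriv, map_smul]
  change _ • cMode (-p - 1) (bMode (-(q + 1)) u) = _ - _ • bMode (-(q + 1)) (cMode (-p - 1) u)
  rw [cMode_bMode, smul_sub]
  congr 1
  by_cases h : p + q = -2
  · rw [if_pos h, if_pos (by lia)]
  · rw [if_neg h, if_neg (by lia), smul_zero]

/-- The normally ordered product of `c(x)` and `∂b(w)`. -/
def cdb (u : BCFock) (p q : ℤ) : BCFock := -nopTerm (-1) (deriv bF) cF u q p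

theorem bddBelow₂_cdb (u : BCFock) : BddBelow₂ (cdb u) := by
  obtain ⟨M, hM⟩ := bddBelow₂_nopTerm (-1) (deriv bF) cF u
  exact ⟨M, fun p q h => by rw [cdb, hM q p h.symm, neg_zero]⟩

/-- The extra terms `(q + 1) w^q x^{-q-2}`, `q ≥ 0`, expand `(x - w)^{-2}` for `|x| > |w|`. The
opposite order in `coeff_deriv_bF_cF_eq_cdb` has the expansion for `|w| > |x|`, with a minus sign.
-/
theorem coeff_cF_deriv_bF_eq_cdb (p q : ℤ) (u : BCFock) : coeff cF p (coeff (deriv bF) q u) =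
    cdb u p q + if 0 ≤ q ∧ p + q = -2 then ((q : ℂ) + 1) • u else 0 := by
  rw [cdb, nopTerm]
  by_cases hq : 0 ≤ q
  · simp only [hq, true_and, if_true, coeff_cF_deriv_bF]
    abel
  · simp only [hq, false_and, if_false, neg_smul, one_smul, neg_neg, add_zero]

theorem coeff_deriv_bF_cF_eq_cdb (p q : ℤ) (u : BCFock) : coeff (deriv bF) q (coeff cF p u) =
    -cdb u p q + if q < 0 ∧ p + q = -2 then ((q : ℂ) + 1) • u else 0 := by
  rw [cdb, nopTerm]
  by_cases hq : 0 ≤ q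
  · simp only [hq, not_lt.mpr hq, false_and, if_true, if_false, add_zero, neg_neg]
  · simp only [hq, not_le.mp hq, true_and, if_false, coeff_cF_deriv_bF, neg_smul, one_smul]
    abel

theorem diag_dw_pow_cdb (m : ℕ) (u : BCFock) (N : ℤ) : diag ((dw ^ m) (cdb u)) N =
    -coeff (nop (-1) (iterD (m + 1) bF) cF) N u := by
  have h : (dw ^ m) (cdb u) = fun p q => -nopTerm (-1) (iterD (m + 1) bF) cF u q p := by
    induction m with
    | zero => rfl
    | succ m ih =>
      rw [pow_succ', Module.End.mul_apply, ih]
      ext1 p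
      ext1 q
      rw [iterD_succ (m + 1), nopTerm_deriv_left, dw_apply, dx_apply, smul_neg]
  rw [h, coeff_nop, diag, diag, finsum_neg_distrib, ← finsum_comp_equiv (Equiv.subLeft N)]
  simp

end Fermions

/-! ### Division by `x - w` after removing the value on the diagonal. -/

section Contraction

variable {V : Type*} [AddCommGroup V]

/-- Coefficient form of `(x - w)^{-2} · (x - w)E = (x - w)^{-1}E`. -/
theorem finsum_summation_by_parts [Module ℂ V] {g : ℕ → V} (hg : (Function.support g).Finite) :
    ∑ᶠ k : ℕ, ((k : ℂ) + 1) • (g k - g (k + 1)) = ∑ᶠ k, g k := by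
  have h1 : (Function.support fun k : ℕ => ((k : ℂ) + 1) • g k).Finite :=
    hg.subset fun k hk h => hk (by simp only [h, smul_zero])
  have h2 : (Function.support fun k : ℕ => (k : ℂ) • g k).Finite :=
    hg.subset fun k hk h => hk (by simp only [h, smul_zero])
  have h3 : (Function.support fun k : ℕ => ((k : ℂ) + 1) • g (k + 1)).Finite :=
    (hg.preimage (add_left_injective 1).injOn).subset fun k hk h =>
      hk (by simp only [h, smul_zero])
  have h4 := finsum_nat_succ h2
  rw [Nat.cast_zero, zero_smul, zero_add] at h4
  push_cast at h4
  simp only [smul_sub]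
  rw [finsum_sub_distrib h1 h3, ← h4, ← finsum_sub_distrib h1 h2]
  exact finsum_congr fun k => by module

/-- The product of `1 / (x - w)` minus its restriction to the diagonal with a series. -/
def divSub (f : ℤ → ℤ → V) (p q : ℤ) : V :=
  if 0 ≤ p then ∑ᶠ k : ℕ, f (p + 1 + k) (q - k) else -∑ᶠ k : ℕ, f (p - k) (q + 1 + k)

theorem BddBelow₂.finite_support_up {f : ℤ → ℤ → V} (hf : BddBelow₂ f) (p q : ℤ) :
    (Function.support fun k : ℕ => f (p + k) (q - k)).Finite := by
  obtain ⟨M, hM⟩ := hf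
  refine (Set.finite_Iic (q - M).toNat).subset fun k hk => ?_
  by_contra h
  simp only [Set.mem_Iic, not_le] at h
  exact hk (hM _ _ (by lia))

theorem BddBelow₂.finite_support_down {f : ℤ → ℤ → V} (hf : BddBelow₂ f) (p q : ℤ) :
    (Function.support fun k : ℕ => f (p - k) (q + k)).Finite := by
  obtain ⟨M, hM⟩ := hf
  refine (Set.finite_Iic (p - M).toNat).subset fun k hk => ?_
  by_contra h
  simp only [Set.mem_Iic, not_le] at h
  exact hk (hM _ _ (by lia))

theorem BddBelow₂.divSub {f : ℤ → ℤ → V} (hf : BddBelow₂ f) : BddBelow₂ (divSub f) := by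
  obtain ⟨M, hM⟩ := hf
  refine ⟨min (min M 0) (M + M), fun p q h => ?_⟩
  rw [FMS.divSub]
  split_ifs with hp
  · rw [← finsum_zero (α := ℕ)]
    exact finsum_congr fun k => hM _ _ (by lia)
  · rw [neg_eq_zero, ← finsum_zero (α := ℕ)]
    refine finsum_congr fun k => ?_
    by_cases hk : p - k < M
    · exact hM _ _ (Or.inl hk)
    · exact hM _ _ (by lia)

/-- The branches of `divSub` expand `f/(x - w)` for `|x| > |w|` when `p ≥ 0` and for `|w| > |x|`
when `p < 0`. In these ranges `f(w, w)/(x - w)` contributes nothing, so both compute `(f(x, w) -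
f(w, w))/(x - w)`. The branches meet at `p = 0`, where the diagonal appears. -/
theorem mulSub_divSub [Module ℂ V] {f : ℤ → ℤ → V} (hf : BddBelow₂ f) (p q : ℤ) :
    mulSub (divSub f) p q = f p q - if p = 0 then diag f q else 0 := by
  rw [mulSub_apply, divSub, divSub]
  have hup := finsum_nat_succ (hf.finite_support_up p q)
  have hdown := finsum_nat_succ (hf.finite_support_down p q)
  have e1 : ∀ k : ℕ, f (p - 1 + 1 + k) (q - k) = f (p + k) (q - k) := fun k => by
    rw [sub_add_cancel]
  have e2 : ∀ k : ℕ, f (p + 1 + k) (q - 1 - k) = f (p + (k + 1 : ℕ)) (q - (k + 1 : ℕ)) := fun k => by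
    push_cast
    congr 1 <;> ring
  have e3 : ∀ k : ℕ, f (p - k) (q - 1 + 1 + k) = f (p - k) (q + k) := fun k => by
    rw [sub_add_cancel]
  have e4 : ∀ k : ℕ, f (p - 1 - k) (q + 1 + k) = f (p - (k + 1 : ℕ)) (q + (k + 1 : ℕ)) := fun k => by
    push_cast
    congr 1 <;> ring
  simp only [Nat.cast_zero, add_zero, sub_zero] at hup hdown
  rw [finsum_congr e1, finsum_congr e2, finsum_congr e3, finsum_congr e4]
  rcases lt_trichotomy p 0 with hp | rfl | hp
  · rw [if_neg (by lia), if_neg (by lia), if_neg (by lia), hdown]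
    abel
  · rw [if_neg (by lia), if_pos le_rfl, if_pos rfl, diag, finsum_int (hf.finite_support q)]
    have e5 : ∀ k : ℕ, f (-(k : ℤ) - 1) (q - (-(k : ℤ) - 1)) =
        f (0 - (k + 1 : ℕ)) (q + (k + 1 : ℕ)) := fun k => by
      push_cast
      congr 1 <;> ring
    simp only [zero_add] at hup ⊢
    rw [finsum_congr e5, hup]
    abel
  · rw [if_pos (by lia), if_pos (by lia), if_neg (by lia), hup]
    abel

end Contraction

/-! ### The operator product of `γ(x)` and `β(w)`. -/

section Product

theorem finite_support_tmul {V W : Type*} [AddCommGroup V] [Module ℂ V] [AddCommGroup W]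
    [Module ℂ W] (A : VertexOperator ℂ V) (B : VertexOperator ℂ W) (N : ℤ) (u : V) (y : W) :
    (Function.support fun k => coeff A k u ⊗ₜ[ℂ] coeff B (N - k) y).Finite := by
  obtain ⟨m, hm⟩ := bounded_coeff A u
  obtain ⟨l, hl⟩ := bounded_coeff B y
  refine finite_support_int m (N - l) fun k hk => ?_
  rcases hk with hk | hk
  · rw [hm k hk, TensorProduct.zero_tmul]
  · rw [hl (N - k) (by lia), TensorProduct.tmul_zero]

theorem coeff_beta (N : ℤ) (u : BCFock) (y : BosonFock) : coeff beta N (u ⊗ₜ[ℂ] y) =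
    ∑ᶠ k, coeff (deriv bF) k u ⊗ₜ[ℂ] coeff (vertexB (-1)) (N - k) y := by
  rw [beta, b, deriv_onLeft, X, coeff_nop_onLeft_onRight]

theorem coeff_gamma (N : ℤ) (u : BCFock) (y : BosonFock) : coeff gamma N (u ⊗ₜ[ℂ] y) =
    ∑ᶠ k, coeff cF k u ⊗ₜ[ℂ] coeff (vertexB 1) (N - k) y := by
  rw [gamma, c, X, coeff_nop_onLeft_onRight]

theorem bddBelow₂_vprod (y : BosonFock) : BddBelow₂ (vprod y) := by
  rw [← mulSub_vquotSeries]
  exact (bddBelow₂_vquotSeries y).mulSub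

theorem finite_support_tconv {V W : Type*} [AddCommGroup V] [Module ℂ V] [AddCommGroup W]
    [Module ℂ W] {f : ℤ → ℤ → V} {g : ℤ → ℤ → W} (hf : BddBelow₂ f) (hg : BddBelow₂ g) (p q : ℤ) :
    (Function.support fun x : ℤ × ℤ => f x.1 x.2 ⊗ₜ[ℂ] g (p - x.1) (q - x.2)).Finite := by
  obtain ⟨M, hM⟩ := hf
  obtain ⟨L, hL⟩ := hg
  refine finite_support_of_bounds (F := fun r s => f r s ⊗ₜ[ℂ] g (p - r) (q - s))
    M (p - L) M (q - L) fun r s h => ?_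
  by_cases h' : r < M ∨ s < M
  · rw [hM _ _ h', TensorProduct.zero_tmul]
  · rw [hL _ _ (by lia), TensorProduct.tmul_zero]

theorem finsum_tconv_add {V W : Type*} [AddCommGroup V] [Module ℂ V] [AddCommGroup W]
    [Module ℂ W] {f : ℤ → ℤ → V} {g : ℤ → ℤ → W} (hf : BddBelow₂ f) (hg : BddBelow₂ g) (p q : ℤ)
    {F : ℤ → ℤ → V ⊗[ℂ] W} {P : ℤ → Prop} [DecidablePred P] {G : ℤ → V ⊗[ℂ] W} (a b : ℤ)
    (hG : ∀ s, (s < a ∨ b < s) → (if P s then G s else 0) = 0)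
    (hF : ∀ r s, F r s = f r s ⊗ₜ[ℂ] g (p - r) (q - s) +
      if P s ∧ r + s = -2 then G s else 0) :
    ∑ᶠ s, ∑ᶠ r, F r s = tconv f g p q + ∑ᶠ s, (if P s then G s else 0) ∧
      ∑ᶠ r, ∑ᶠ s, F r s = tconv f g p q + ∑ᶠ s, if P s then G s else 0 := by
  have hfin1 := finite_support_tconv hf hg p q
  have hfin2 : (Function.support fun x : ℤ × ℤ =>
      if P x.2 ∧ x.1 + x.2 = -2 then G x.2 else 0).Finite := by
    refine finite_support_of_bounds (F := fun r s => if P s ∧ r + s = -2 then G s else 0)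
      (-2 - b) (-2 - a) a b fun r s h => ?_
    by_cases h' : P s ∧ r + s = -2
    · have := hG s (by lia)
      rw [if_pos h'.1] at this
      rw [if_pos h', this]
    · rw [if_neg h']
  have hfin : (Function.support fun x : ℤ × ℤ => F x.1 x.2).Finite := by
    simp only [hF]
    exact (hfin1.union hfin2).subset (Function.support_add _ _)
  rw [finsum_comm_of_finite (f := fun s r => F r s)
    (hfin.preimage (Equiv.prodComm ℤ ℤ).injective.injOn), and_self]
  rw [← finsum_curry (fun x : ℤ × ℤ => F x.1 x.2) hfin]
  simp only [hF]
  rw [finsum_add_distrib hfin1 hfin2, finsum_curry _ hfin1, finsum_curry _ hfin2]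
  congr 1
  rw [finsum_comm_of_finite (f := fun r s => if P s ∧ r + s = -2 then G s else 0) hfin2]
  refine finsum_congr fun s => ?_
  rw [finsum_eq_single _ (-2 - s) fun r hr => if_neg (by lia)]
  simp

/-- The contraction `(x - w)^{-2}` of the fermions meets the zero of `X_i(x)X_{-i}(w) = (x - w)E`;
what is left is `E/(x - w)` for `|x| > |w|`. -/
theorem coeff_gamma_beta (p q : ℤ) (u : BCFock) (y : BosonFock) :
    coeff gamma p (coeff beta q (u ⊗ₜ[ℂ] y)) = tconv (cdb u) (vprod y) p q +
      u ⊗ₜ[ℂ] ∑ᶠ k : ℕ, vquotSeries y (p + 1 + k) (q - k) := by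
  obtain ⟨M, hM⟩ := bddBelow₂_vprod y
  have h1 := (finsum_tconv_add (bddBelow₂_cdb u) (bddBelow₂_vprod y) p q (P := fun s => 0 ≤ s)
    (F := fun r s => coeff cF r (coeff (deriv bF) s u) ⊗ₜ[ℂ] vprod y (p - r) (q - s))
    (G := fun s => u ⊗ₜ[ℂ] (((s : ℂ) + 1) • vprod y (p + s + 2) (q - s))) 0 (q - M) ?_ ?_).1
  · have hE := (bddBelow₂_vquotSeries y).finite_support_up (p + 1) q
    have h2 : ∀ k : ℕ, vprod y (p + k + 2) (q - k) = vquotSeries y (p + 1 + k) (q - k) -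
        vquotSeries y (p + 1 + (k + 1 : ℕ)) (q - (k + 1 : ℕ)) := fun k => by
      rw [← mulSub_vquotSeries, mulSub_apply]
      push_cast
      congr 2 <;> ring
    have h3 : (Function.support fun k : ℕ =>
        ((k : ℂ) + 1) • vprod y (p + k + 2) (q - k)).Finite := by
      refine (Set.finite_Iic (q - M).toNat).subset fun k hk => ?_
      by_contra h
      simp only [Set.mem_Iic, not_le] at h
      exact hk (by beta_reduce; rw [hM _ _ (by lia), smul_zero])
    rw [coeff_beta, map_finsum _ (finite_support_tmul _ _ _ _ _), ← finsum_summation_by_parts hE,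
      finsum_congr fun s => coeff_gamma p _ _]
    refine h1.trans (congrArg _ ?_)
    rw [finsum_int]
    · have h4 : ∀ k : ℕ, (if 0 ≤ -(k : ℤ) - 1 then u ⊗ₜ[ℂ] ((((-(k : ℤ) - 1 : ℤ) : ℂ) + 1) •
          vprod y (p + (-(k : ℤ) - 1) + 2) (q - (-(k : ℤ) - 1))) else 0) = 0 := fun k =>
        if_neg (by lia)
      rw [finsum_congr h4, finsum_zero, add_zero]
      simp only [← h2]
      rw [tmul_finsum u h3]
      exact finsum_congr fun k => by rw [if_pos (by lia), Int.cast_natCast]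
    · refine finite_support_int 0 (q - M) fun s hs => ?_
      split_ifs with h
      · rw [hM _ _ (by lia), smul_zero, TensorProduct.tmul_zero]
      · rfl
  · intro s hs
    split_ifs with h
    · rw [hM _ _ (by lia), smul_zero, TensorProduct.tmul_zero]
    · rfl
  · intro r s
    rw [coeff_cF_deriv_bF_eq_cdb, TensorProduct.add_tmul]
    congr 1
    split_ifs with h
    · rw [TensorProduct.smul_tmul, show p - r = p + s + 2 by lia]
    · rw [TensorProduct.zero_tmul]

/-- The signs from exchanging the fermions and the vertex operators cancel, so the result differs
from the other order only in expanding `E/(x - w)` for `|w| > |x|`. -/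
theorem coeff_beta_gamma (p q : ℤ) (u : BCFock) (y : BosonFock) :
    coeff beta q (coeff gamma p (u ⊗ₜ[ℂ] y)) = tconv (cdb u) (vprod y) p q -
      u ⊗ₜ[ℂ] ∑ᶠ k : ℕ, vquotSeries y (p - k) (q + 1 + k) := by
  obtain ⟨M, hM⟩ := bddBelow₂_vprod y
  have h1 := (finsum_tconv_add (bddBelow₂_cdb u) (bddBelow₂_vprod y) p q (P := fun s => s < 0)
    (F := fun r s => coeff (deriv bF) s (coeff cF r u) ⊗ₜ[ℂ]
      coeff (vertexB (-1)) (q - s) (coeff (vertexB 1) (p - r) y))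
    (G := fun s => -(u ⊗ₜ[ℂ] (((s : ℂ) + 1) • vprod y (p + s + 2) (q - s)))) (M - p - 2) (-1)
    ?_ ?_).2
  · have hE := (bddBelow₂_vquotSeries y).finite_support_down p (q + 1)
    have h2 : ∀ k : ℕ, vprod y (p - k) (q + 1 + (k + 1)) = -(vquotSeries y (p - k) (q + 1 + k) -
        vquotSeries y (p - (k + 1 : ℕ)) (q + 1 + (k + 1 : ℕ))) := fun k => by
      rw [← mulSub_vquotSeries, mulSub_apply, neg_sub]
      push_cast
      congr 2 <;> ring
    have h3 : (Function.support fun k : ℕ =>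
        ((k : ℂ) + 1) • (vquotSeries y (p - k) (q + 1 + k) -
        vquotSeries y (p - (k + 1 : ℕ)) (q + 1 + (k + 1 : ℕ)))).Finite := by
      refine (Set.finite_Iic (p - M).toNat).subset fun k hk => ?_
      by_contra h
      simp only [Set.mem_Iic, not_le] at h
      exact hk (by beta_reduce; rw [← neg_eq_iff_eq_neg.mpr (h2 k), hM _ _ (by lia), neg_zero,
        smul_zero])
    have h5 : (Function.support fun k : ℕ => -(u ⊗ₜ[ℂ] ((((-(k : ℤ) - 1 : ℤ) : ℂ) + 1) •
          vprod y (p + (-(k : ℤ) - 1) + 2) (q - (-(k : ℤ) - 1))))).Finite := by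
      refine (Set.finite_Iic (p + 2 - M).toNat).subset fun k hk => ?_
      by_contra h
      simp only [Set.mem_Iic, not_le] at h
      exact hk (by beta_reduce; rw [hM _ _ (by lia), smul_zero, TensorProduct.tmul_zero, neg_zero])
    rw [coeff_gamma, map_finsum _ (finite_support_tmul _ _ _ _ _), ← finsum_summation_by_parts hE,
      finsum_congr fun s => coeff_beta q _ _]
    refine h1.trans ?_
    rw [sub_eq_add_neg]
    refine congrArg _ ?_
    rw [finsum_int]
    · have h4 : ∀ k : ℕ, (if (k : ℤ) < 0 then -(u ⊗ₜ[ℂ] ((((k : ℤ) : ℂ) + 1) •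
          vprod y (p + k + 2) (q - k))) else 0) = 0 := fun k => if_neg (by lia)
      -- The term `k = 0`, that is `s = -1`, is split off because its coefficient `s + 1` is zero.
      rw [finsum_congr h4, finsum_zero, zero_add, finsum_congr fun k : ℕ => if_pos (by lia),
        finsum_nat_succ h5, tmul_finsum u h3, ← finsum_neg_distrib]
      push_cast
      simp only [neg_zero, neg_add_cancel, zero_smul, TensorProduct.tmul_zero, zero_add]
      refine finsum_congr fun k => ?_
      have h6 := h2 k
      push_cast at h6
      rw [← neg_eq_iff_eq_neg.mpr h6, show p + (-((k : ℤ) + 1) - 1) + 2 = p - k by ring,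
        show q - (-((k : ℤ) + 1) - 1) = q + 1 + (k + 1) by ring, sub_add_cancel, neg_smul, smul_neg]
    · refine finite_support_int (M - p - 2) (-1) fun s hs => ?_
      split_ifs with h
      · rw [hM _ _ (by lia), smul_zero, TensorProduct.tmul_zero, neg_zero]
      · rfl
  · intro s hs
    split_ifs with h
    · rw [hM _ _ (by lia), smul_zero, TensorProduct.tmul_zero, neg_zero]
    · rfl
  · intro r s
    rw [coeff_deriv_bF_cF_eq_cdb, vprod_swap, TensorProduct.add_tmul, TensorProduct.tmul_neg,
      TensorProduct.neg_tmul, neg_neg]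
    congr 1
    split_ifs with h
    · rw [TensorProduct.tmul_neg, TensorProduct.smul_tmul, show p - r = p + s + 2 by lia]
    · rw [TensorProduct.zero_tmul]

/-- Normal ordering uses the order `γβ` for `p ≥ 0` and `βγ` for `p < 0`, exactly the case
distinction in `divSub`. -/
theorem nopTerm_gamma_beta (u : BCFock) (y : BosonFock) : nopTerm 1 gamma beta (u ⊗ₜ[ℂ] y) =
    mulSub (tconv (cdb u) (vquotSeries y)) +
      fun p q => u ⊗ₜ[ℂ] divSub (vquotSeries y) p q := by
  rw [← tconv_mulSub (bddBelow₂_cdb u) (bddBelow₂_vquotSeries y), mulSub_vquotSeries]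
  ext1 p
  ext1 q
  rw [Pi.add_apply, Pi.add_apply, nopTerm, divSub, coeff_gamma_beta, coeff_beta_gamma]
  split_ifs
  · rfl
  · rw [one_smul, TensorProduct.tmul_neg, sub_eq_add_neg]

end Product

/-! ### The value `C_n = -1/(n + 1)`. -/

section Constants

/-- The Beta integral `∫_0^1 t^y (1 - t)^n dt`, with the binomial expanded; here by induction
through Pascal's rule. -/
theorem sum_alternating_choose_div (n y : ℕ) :
    ∑ m ∈ Finset.range (n + 1), (n.choose m : ℂ) * ((-1) ^ m / (m + y + 1)) =
      n.factorial * y.factorial / (n + y + 1).factorial := by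
  induction n generalizing y with
  | zero =>
    have h : (y.factorial : ℂ) ≠ 0 := Nat.cast_ne_zero.mpr y.factorial_ne_zero
    have h' : (y : ℂ) + 1 ≠ 0 := Nat.cast_add_one_ne_zero y
    simp only [zero_add, Finset.sum_range_one, Nat.choose_self, Nat.factorial_succ,
      Nat.factorial_zero, pow_zero, Nat.cast_zero, Nat.cast_one]
    push_cast
    field_simp
  | succ n ih =>
    rw [Finset.sum_choose_succ_mul (fun m _ => (-1 : ℂ) ^ m / (m + y + 1)) n, ih]
    have h : ∀ m : ℕ, (n.choose m : ℂ) * ((-1) ^ (m + 1) / ((m + 1 : ℕ) + y + 1)) =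
        -((n.choose m : ℂ) * ((-1) ^ m / (m + (y + 1 : ℕ) + 1))) := fun m => by
      push_cast
      rw [pow_succ, mul_neg_one, neg_div, mul_neg, add_right_comm (m : ℂ) 1 y, add_assoc (m : ℂ) y 1]
    rw [Finset.sum_congr rfl fun m _ => h m, Finset.sum_neg_distrib, ih]
    have h1 : ((n + y + 1).factorial : ℂ) ≠ 0 := Nat.cast_ne_zero.mpr (Nat.factorial_ne_zero _)
    have h2 : (n : ℂ) + y + 1 + 1 ≠ 0 := by exact_mod_cast Nat.succ_ne_zero (n + y + 1)
    rw [show n + (y + 1) + 1 = n + y + 1 + 1 by ring, show n + 1 + y + 1 = n + y + 1 + 1 by ring,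
      Nat.factorial_succ (n + y + 1), Nat.factorial_succ n, Nat.factorial_succ y]
    push_cast
    field_simp
    ring

theorem constC_eq (n : ℕ) : constC n = -((n : ℂ) + 1)⁻¹ := by
  have h := sum_alternating_choose_div n 1
  have h1 : (n : ℂ) + 1 ≠ 0 := Nat.cast_add_one_ne_zero n
  have h2 : (n : ℂ) + 1 + 1 ≠ 0 := by exact_mod_cast Nat.succ_ne_zero (n + 1)
  have h3 : (n.factorial : ℂ) ≠ 0 := Nat.cast_ne_zero.mpr (Nat.factorial_ne_zero _)
  have h4 : ∀ m : ℕ, (-1) ^ (m + 1) * (n.choose m : ℂ) / (m + 2) =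
      -((n.choose m : ℂ) * ((-1) ^ m / (m + (1 : ℕ) + 1))) := fun m => by
    rw [pow_succ, Nat.cast_one, add_assoc, one_add_one_eq_two]
    ring
  rw [constC, Finset.sum_congr rfl fun m _ => h4 m, Finset.sum_neg_distrib, h, Nat.factorial_succ (n + 1),
    Nat.factorial_succ n, Nat.factorial_one]
  push_cast
  rw [show (n : ℂ) + 2 = n + 1 + 1 by ring]
  field_simp

end Constants

/-! ### The formula for `J^n`. -/

section Bosonization

theorem diag_dw_pow_tmul {V W : Type*} [AddCommGroup V] [Module ℂ V] [AddCommGroup W]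
    [Module ℂ W] (u : V) {R : ℤ → ℤ → W} (hR : BddBelow₂ R) (n : ℕ) (N : ℤ) :
    diag ((dw ^ n) fun p q => u ⊗ₜ[ℂ] R p q) N = u ⊗ₜ[ℂ] diag ((dw ^ n) R) N := by
  have h : (dw ^ n) (fun p q => u ⊗ₜ[ℂ] R p q) = fun p q => u ⊗ₜ[ℂ] (dw ^ n) R p q := by
    induction n with
    | zero => rfl
    | succ n ih =>
      funext p q
      rw [pow_succ', pow_succ', Module.End.mul_apply, Module.End.mul_apply, ih, dw_apply, dw_apply,
        TensorProduct.tmul_smul]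
  rw [h, diag, diag, tmul_finsum u ((hR.dw_pow n).finite_support N)]

/-- Since `E(w, w) = 1`, the product is `E - 1`, and one derivative removes the constant. -/
theorem dw_pow_succ_mulSub_divSub (n : ℕ) (y : BosonFock) :
    (dw ^ (n + 1)) (mulSub (divSub (vquotSeries y))) = (dw ^ (n + 1)) (vquotSeries y) := by
  rw [pow_succ, Module.End.mul_apply, Module.End.mul_apply]
  congr 1
  funext p q
  rw [dw_apply, dw_apply, mulSub_divSub (bddBelow₂_vquotSeries y), diag_vquotSeries]
  by_cases h : q + 1 = 0
  · rw [show (q : ℂ) + 1 = 0 by exact_mod_cast h, zero_smul, zero_smul]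
  · rw [if_neg h, ite_self, sub_zero]

theorem diag_dw_pow_divSub (n : ℕ) (y : BosonFock) (N : ℤ) :
    diag ((dw ^ n) (divSub (vquotSeries y))) N =
      constC n • coeff (noEval (expQuot (n + 1)) jB idField) N y := by
  have h := diag_dw_pow_succ_mulSub n (bddBelow₂_vquotSeries y).divSub
  have h1 : (n : ℂ) + 1 ≠ 0 := Nat.cast_add_one_ne_zero n
  rw [dw_pow_succ_mulSub_divSub] at h
  rw [← diag_dw_pow_vquotSeries, h, constC_eq, Pi.smul_apply, smul_smul, neg_mul_neg,
    inv_mul_cancel₀ h1, one_smul]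

theorem bc_zero_right (k : ℕ) : bc k 0 = onLeft (nop (-1) (iterD k bF) cF) := by
  rw [bc, iterD_zero, b, c, iterD_onLeft, nop_onLeft]

theorem ofJ_eq (p : MvPolynomial ℕ ℂ) : ofJ p = onRight (noEval p jB idField) := by
  rw [ofJ, j, ← onRight_idField, noEval_onRight]

theorem coeff_ofJ (p : MvPolynomial ℕ ℂ) (N : ℤ) (u : BCFock) (y : BosonFock) :
    coeff (ofJ p) N (u ⊗ₜ[ℂ] y) = u ⊗ₜ[ℂ] coeff (noEval p jB idField) N y := by
  rw [ofJ_eq, coeff_onRight]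

theorem coeff_nop_bc_ofJ (m n : ℕ) (N : ℤ) (u : BCFock) (y : BosonFock) :
    coeff (nop 1 (bc (m + 1) 0) (ofJ (expQuot n))) N (u ⊗ₜ[ℂ] y) =
      -∑ᶠ k, diag ((dw ^ m) (cdb u)) k ⊗ₜ[ℂ] diag ((dw ^ n) (vquotSeries y)) (N - k) := by
  rw [bc_zero_right, ofJ_eq, coeff_nop_onLeft_onRight, ← finsum_neg_distrib]
  exact finsum_congr fun k => by
    rw [diag_dw_pow_cdb, diag_dw_pow_vquotSeries, TensorProduct.neg_tmul, neg_neg]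

theorem diag_dw_pow_mulSub_tconv (n : ℕ) (N : ℤ) (u : BCFock) (y : BosonFock) :
    diag ((dw ^ n) (mulSub (tconv (cdb u) (vquotSeries y)))) N =
      ∑ k ∈ Finset.Icc 1 n, ((k : ℂ) * n.choose k) •
        coeff (nop 1 (bc (n - k + 1) 0) (ofJ (expQuot (k - 1)))) N (u ⊗ₜ[ℂ] y) := by
  have hf := bddBelow₂_cdb u
  have hg := bddBelow₂_vquotSeries y
  cases n with
  | zero => rw [pow_zero, Module.End.one_apply, diag_mulSub (hf.tconv hg)]; rfl
  | succ n =>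
    have hb : ∀ x ∈ Finset.HasAntidiagonal.antidiagonal n,
        BddBelow₂ (tconv ((dw ^ x.1) (cdb u)) ((dw ^ x.2) (vquotSeries y))) := fun x _ =>
      (hf.dw_pow x.1).tconv (hg.dw_pow x.2)
    rw [diag_dw_pow_succ_mulSub _ (hf.tconv hg), dw_pow_tconv hf hg, (diag_sum _ _ ?_).2,
      Pi.smul_apply, Finset.sum_apply, Finset.smul_sum]
    -- Of the `n` derivatives left, `k - 1` fall on `E` and give `P_{k-1}`; the others fall on `:c
    -- ∂b:`. The coefficients match by `(n + 1) binom(n,k-1) = k binom(n+1,k)`.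
    · refine (Finset.sum_nbij' (fun k => (n + 1 - k, k - 1)) (fun x => x.2 + 1) ?_ ?_ ?_ ?_ ?_).symm
      · intro k hk
        rw [Finset.mem_Icc] at hk
        rw [Finset.HasAntidiagonal.mem_antidiagonal]
        lia
      · intro x hx
        rw [Finset.HasAntidiagonal.mem_antidiagonal] at hx
        rw [Finset.mem_Icc]
        lia
      · intro k hk
        rw [Finset.mem_Icc] at hk
        lia
      · intro x hx
        rw [Finset.HasAntidiagonal.mem_antidiagonal] at hx
        ext <;> simp only <;> lia
      · intro k hk
        rw [Finset.mem_Icc] at hk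
        obtain ⟨k, rfl⟩ : ∃ m, k = m + 1 := ⟨k - 1, by lia⟩
        have hc : ((n + 1 : ℕ).choose (k + 1) : ℂ) * ((k : ℂ) + 1) =
            ((n : ℂ) + 1) * (n.choose k : ℂ) := by
          exact_mod_cast (Nat.add_one_mul_choose_eq n k).symm
        simp only [add_tsub_cancel_right, Nat.add_sub_add_right]
        rw [coeff_nop_bc_ofJ, Nat.choose_symm (by lia), ← Nat.cast_smul_eq_nsmul ℂ,
          diag_smul ((hf.dw_pow _).tconv (hg.dw_pow _)), Pi.smul_apply,
          diag_tconv (hf.dw_pow _) (hg.dw_pow _)]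
        push_cast
        rw [mul_comm, hc]
        module
    · intro x hx
      rw [← Nat.cast_smul_eq_nsmul ℂ]
      exact (hb x hx).smul _

theorem J_eq_bosonized (n : ℕ) : J n = bosonized expQuot n := by
  refine field_ext_tmul fun N u y => ?_
  have h1 : BddBelow₂ (tconv (cdb u) (vquotSeries y)) :=
    (bddBelow₂_cdb u).tconv (bddBelow₂_vquotSeries y)
  have h2 : BddBelow₂ (divSub (vquotSeries y)) := (bddBelow₂_vquotSeries y).divSub
  have h3 : BddBelow₂ fun p q => u ⊗ₜ[ℂ] divSub (vquotSeries y) p q :=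
    h2.imp fun M hM p q h => by
      beta_reduce
      rw [hM p q h, TensorProduct.tmul_zero]
  rw [J, coeff_nop, nopTerm_iterD_right, nopTerm_gamma_beta, map_add,
    diag_add (h1.mulSub.dw_pow n) (h3.dw_pow n), Pi.add_apply, diag_dw_pow_mulSub_tconv,
    diag_dw_pow_tmul u h2, diag_dw_pow_divSub, bosonized, map_add, Pi.add_apply,
    LinearMap.add_apply, map_sum, Finset.sum_apply, LinearMap.sum_apply, map_smul, Pi.smul_apply,
    LinearMap.smul_apply, coeff_ofJ, TensorProduct.tmul_smul]
  congr 1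

end Bosonization

/-! ### Existence and uniqueness of `P_m`. -/

section Quotients

variable {V : Type*} [AddCommGroup V] [Module ℂ V]

/-- The field `A`, applied to `v`, has no negative powers of `z`. -/
def IsCreative (A : VertexOperator ℂ V) (v : V) : Prop := ∀ N < 0, coeff A N v = 0

theorem IsCreative.iterD {A : VertexOperator ℂ V} {v : V} (h : IsCreative A v) (k : ℕ) :
    IsCreative (iterD k A) v := by
  induction k with
  | zero => exact h
  | succ k ih =>
    intro N hN
    rw [iterD_succ, coeff_deriv]
    by_cases hN' : N = -1
    · simp [hN']
    · rw [ih _ (by lia), smul_zero]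

theorem coeff_zero_iterD (A : VertexOperator ℂ V) (k : ℕ) (v : V) :
    coeff (iterD k A) 0 v = (k.factorial : ℂ) • coeff A k v := by
  induction k generalizing A with
  | zero => simp [iterD_zero]
  | succ k ih =>
    rw [iterD_succ', ih, coeff_deriv, smul_smul, Nat.factorial_succ]
    push_cast
    rw [mul_comm]

theorem IsCreative.nop {A Y : VertexOperator ℂ V} {v : V} (hA : IsCreative A v)
    (hY : IsCreative Y v) :
    IsCreative (nop 1 A Y) v ∧ coeff (nop 1 A Y) 0 v = coeff A 0 (coeff Y 0 v) := by
  have h : ∀ p q, (p < 0 ∨ q < 0) → nopTerm 1 A Y v p q = 0 := fun p q hpq => by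
    rw [nopTerm]
    split_ifs with hp
    · rw [hY q (by lia), map_zero]
    · rw [hA p (by lia), map_zero, smul_zero]
  refine ⟨fun N hN => ?_, ?_⟩
  · rw [coeff_nop, diag, finsum_congr fun p => h p (N - p) (by lia), finsum_zero]
  · rw [coeff_nop, diag, finsum_eq_single _ 0 fun p hp => h p (0 - p) (by lia)]
    rfl

theorem isCreative_jB : IsCreative jB (Finsupp.single 0 1) := fun N hN => by
  rw [coeff_jB]
  rcases int_cases (-N - 1) with h | ⟨i, h⟩ | ⟨i, h⟩
  · rw [h, jMode_zero_single]
    simp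
  · rw [h, jMode_pos_single]
    simp
  · lia

/-- The rescaling `x_k ↦ k! x_k`. -/
def factorialScale : MvPolynomial ℕ ℂ →ₐ[ℂ] MvPolynomial ℕ ℂ :=
  MvPolynomial.aeval fun k => (k.factorial : ℂ) • MvPolynomial.X k

theorem factorialScale_injective : Function.Injective factorialScale := by
  let g : MvPolynomial ℕ ℂ →ₐ[ℂ] MvPolynomial ℕ ℂ :=
    MvPolynomial.aeval fun k => (k.factorial : ℂ)⁻¹ • MvPolynomial.X k
  have h : g.comp factorialScale = AlgHom.id ℂ _ := MvPolynomial.algHom_ext fun k => by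
    have hk : (k.factorial : ℂ) ≠ 0 := Nat.cast_ne_zero.mpr k.factorial_ne_zero
    rw [AlgHom.comp_apply, factorialScale, MvPolynomial.aeval_X, map_smul, MvPolynomial.aeval_X,
      smul_smul, mul_inv_cancel₀ hk, one_smul, AlgHom.id_apply]
  exact Function.LeftInverse.injective (g := g) fun p => DFunLike.congr_fun h p

/-- On the highest weight vector of `H_0` the constant term of `∂^k j` is `k! j(-k-1)` and that of
`X_{-i}` is the shift to `H_{-i}`, so the constant term of the product displays `p` up to rescaling
its variables. Uniqueness of `P_m` rests on this. -/
theorem noEval_vertexB_vac (p : MvPolynomial ℕ ℂ) :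
    IsCreative (noEval p jB (vertexB (-1))) (Finsupp.single 0 1) ∧
      coeff (noEval p jB (vertexB (-1))) 0 (Finsupp.single 0 1) =
        Finsupp.single (-1) (factorialScale p) := by
  rw [noEval_eq_opEval]
  induction p using MvPolynomial.induction_on with
  | C a =>
    rw [opEval_C, LinearMap.smul_apply, Module.End.one_apply]
    refine ⟨fun N hN => ?_, ?_⟩
    · rw [map_smul, Pi.smul_apply, LinearMap.smul_apply, coeff_vertexB_vac,
        expPoly_of_neg _ (by lia), Finsupp.single_zero, smul_zero]
    · rw [map_smul, Pi.smul_apply, LinearMap.smul_apply, coeff_vertexB_vac, mul_zero, add_zero,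
        expPoly_zero, Finsupp.smul_single, zero_add, factorialScale, MvPolynomial.aeval_C,
        Algebra.algebraMap_eq_smul_one]
  | add p q hp hq =>
    rw [map_add, LinearMap.add_apply, map_add, map_add, Finsupp.single_add]
    refine ⟨fun N hN => ?_, ?_⟩
    · rw [map_add, Pi.add_apply, LinearMap.add_apply, hp.1 N hN, hq.1 N hN, add_zero]
    · rw [Pi.add_apply, LinearMap.add_apply, hp.2, hq.2]
  | mul_X p k hp =>
    rw [mul_comm, opEval_X_mul _ fun k l => partsCommute_jB.commute_iterD k l, Module.End.mul_apply,
      nopHom_apply]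
    refine ((isCreative_jB.iterD k).nop hp.1).imp_right fun h => ?_
    rw [h, hp.2, coeff_zero_iterD, coeff_jB, show -(k : ℤ) - 1 = -((k : ℤ) + 1) by ring,
      jMode_neg_single, Finsupp.smul_single, map_mul, factorialScale, MvPolynomial.aeval_X,
      smul_mul_assoc]

theorem one_tmul_injective :
    Function.Injective fun y : BosonFock => (1 : BCFock) ⊗ₜ[ℂ] y := by
  intro y y' h
  have := congrArg (TensorProduct.lid ℂ BosonFock ∘
    LinearMap.rTensor BosonFock (ExteriorAlgebra.algebraMapInv (R := ℂ)
      (M := (ℕ ⊕ ℕ) →₀ ℂ)).toLinearMap) h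
  simpa using this

theorem noEval_j_X (p : MvPolynomial ℕ ℂ) :
    noEval p j (X (-1)) = onRight (noEval p jB (vertexB (-1))) :=
  noEval_onRight p jB (vertexB (-1))

theorem isExpQuotient_expQuot (m : ℕ) : IsExpQuotient m (expQuot m) := by
  rw [IsExpQuotient, noEval_j_X, X, iterD_onRight, ← iterD_eq_noEval partsCommute_jB]
  rw [deriv_vertexB, Int.cast_neg, Int.cast_one, mul_neg_one]

theorem IsExpQuotient.eq_expQuot {m : ℕ} {p : MvPolynomial ℕ ℂ} (h : IsExpQuotient m p) :
    p = expQuot m := by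
  have h1 : noEval p j (X (-1)) = noEval (expQuot m) j (X (-1)) :=
    Eq.trans h (isExpQuotient_expQuot m).symm
  rw [noEval_j_X, noEval_j_X] at h1
  have h2 := congrArg (fun A => coeff A 0 ((1 : BCFock) ⊗ₜ[ℂ] Finsupp.single (0 : ℤ) (1 : Osc))) h1
  simp only [coeff_onRight, (noEval_vertexB_vac _).2] at h2
  exact factorialScale_injective (Finsupp.single_injective _ (one_tmul_injective h2))

end Quotients

/-! ### Membership in the normally ordered polynomials. -/

section Membership

variable {V : Type*} [AddCommGroup V] [Module ℂ V] {G : Set (VertexOperator ℂ V)}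

theorem nop_mem_noPolys {A Y : VertexOperator ℂ V} (hA : A ∈ G) (hY : Y ∈ noPolys G) :
    nop 1 A Y ∈ noPolys G := by
  change nopHom A Y ∈ noPolys G
  suffices h : noPolys G ≤ (noPolys G).comap (nopHom A) from h hY
  refine Submodule.span_le.mpr ?_
  rintro _ ⟨L, hL, rfl⟩
  exact Submodule.subset_span ⟨A :: L, List.forall_mem_cons.mpr ⟨hA, hL⟩, rfl⟩

theorem noEval_idField_mem_noPolys {A : VertexOperator ℂ V} {p : MvPolynomial ℕ ℂ} {s : Set ℕ}
    (hp : p ∈ MvPolynomial.supported ℂ s) (hA : ∀ k ∈ s, iterD k A ∈ G) :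
    noEval p A idField ∈ noPolys G := by
  refine Submodule.sum_mem _ fun m hm => Submodule.smul_mem _ _ (Submodule.subset_span
    ⟨_, fun B hB => ?_, rfl⟩)
  obtain ⟨k, hk, rfl⟩ := List.mem_map.mp hB
  rw [Multiset.mem_sort, Finsupp.mem_toMultiset] at hk
  exact hA k (MvPolynomial.mem_supported.mp hp
    ((MvPolynomial.mem_vars_iff_mem_support k).mpr ⟨m, hm, hk⟩))

theorem bosonized_mem_noPolys (n : ℕ) : bosonized expQuot n ∈
    noPolys ({A | ∃ k l : ℕ, 0 < k ∧ k + l ≤ n ∧ A = bc k l} ∪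
      {A | ∃ k : ℕ, k ≤ n ∧ A = iterD k j}) := by
  have h : ∀ m ≤ n + 1, ofJ (expQuot m) ∈
      noPolys ({A | ∃ k l : ℕ, 0 < k ∧ k + l ≤ n ∧ A = bc k l} ∪
        {A | ∃ k : ℕ, k ≤ n ∧ A = iterD k j}) := fun m hm =>
    noEval_idField_mem_noPolys (expQuot_mem_supported m) fun k (hk : k < m) =>
      Or.inr ⟨k, by lia, rfl⟩
  refine add_mem (sum_mem fun k hk => Submodule.smul_mem _ _ (nop_mem_noPolys (Or.inl
    ⟨n - k + 1, 0, by lia, ?_, rfl⟩) (h _ ?_))) (Submodule.smul_mem _ _ (h _ le_rfl))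
  all_goals
    rw [Finset.mem_Icc] at hk
    lia

end Membership

/-! ### Transport to the `βγ` Fock space. -/

section Intertwiners

variable {V W : Type*} [AddCommGroup V] [Module ℂ V] [AddCommGroup W] [Module ℂ W]

/-- The linear map `ε` intertwines the modes of the fields `A` and `A'`. -/
def Intertwines (ε : V →ₗ[ℂ] W) (A : VertexOperator ℂ V) (A' : VertexOperator ℂ W) : Prop :=
  ∀ k v, ε (coeff A k v) = coeff A' k (ε v)

theorem Intertwines.iterD {ε : V →ₗ[ℂ] W} {A : VertexOperator ℂ V} {A' : VertexOperator ℂ W}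
    (h : Intertwines ε A A') (n : ℕ) : Intertwines ε (iterD n A) (iterD n A') := by
  induction n with
  | zero => exact h
  | succ n ih =>
    intro k v
    rw [iterD_succ, iterD_succ, coeff_deriv, coeff_deriv, map_smul, ih]

/-- On each vector a coefficient of the product is a finite sum of products of modes, which `ε`
respects term by term. -/
theorem Intertwines.nop {ε : V →ₗ[ℂ] W} {A B : VertexOperator ℂ V} {A' B' : VertexOperator ℂ W}
    (hA : Intertwines ε A A') (hB : Intertwines ε B B') (s : ℂ) :
    Intertwines ε (nop s A B) (nop s A' B') := fun N v => by
  rw [coeff_nop, coeff_nop, diag, map_finsum _ ((bddBelow₂_nopTerm s A B v).finite_support N)]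
  refine finsum_congr fun p => ?_
  rw [nopTerm, nopTerm]
  split_ifs
  · rw [hA, hB]
  · rw [map_smul, hB, hA]

end Intertwiners

end FMS

end

/-! ### Assembly. -/

theorem mainTheorem7 :
    (∀ m : ℕ, ∃! p : MvPolynomial ℕ ℂ, FMS.IsExpQuotient m p) ∧
    ∀ P : ℕ → MvPolynomial ℕ ℂ, (∀ m, FMS.IsExpQuotient m (P m)) → ∀ n : ℕ,
      FMS.J n = FMS.bosonized P n ∧
      FMS.J n ∈ FMS.noPolys ({A | ∃ k l : ℕ, 0 < k ∧ k + l ≤ n ∧ A = FMS.bc k l} ∪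
        {A | ∃ k : ℕ, k ≤ n ∧ A = FMS.iterD k FMS.j}) ∧
      ∀ ε : FMS.BGFock →ₗ[ℂ] FMS.Total, FMS.IsBosonization ε → ∀ (k : ℤ) (v : FMS.BGFock),
        ε (HVertexOperator.coeff (FMS.JM n) k v) =
          HVertexOperator.coeff (FMS.bosonized P n) k (ε v) := by
  refine ⟨fun m => ⟨FMS.expQuot m, FMS.isExpQuotient_expQuot m, fun p hp => hp.eq_expQuot⟩,
    fun P hP n => ?_⟩
  -- By uniqueness it is enough to treat the recursively defined polynomials.
  obtain rfl : P = FMS.expQuot := funext fun m => (hP m).eq_expQuot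
  refine ⟨FMS.J_eq_bosonized n, ?_, fun ε hε => ?_⟩
  · rw [FMS.J_eq_bosonized]
    exact FMS.bosonized_mem_noPolys n
  · rw [← FMS.J_eq_bosonized]
    exact FMS.Intertwines.nop hε.map_gamma (FMS.Intertwines.iterD hε.map_beta n) 1
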